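/- Let $\Gamma$ be a topological group (for instance a Lie group) and $R$ a field such that $(\Gamma,R)$ is a halving pair: there are $D\ge 1$ and $u\in H^D(B\Gamma;R)$ such that the map $R[u]\to H^*(B\Gamma;R)$ from the polynomial ring is an isomorphism; for example $(\mathbb Z_2,\mathbb F_2)$, $(\mathrm U(1),\mathbb Q)$, $(\mathrm{Sp}(1),\mathbb Q)$ with $D=1,2,4$. All cohomology is singular cohomology with coefficients in $R$. Let $X$ be a space with a continuous action of $\Gamma$, let $X^\Gamma$ be its fixed point set, let $B_\Gamma X=E\Gamma\times_\Gamma X$ and $B\Gamma=E\Gamma/\Gamma$ (with Milnor's model of $E\Gamma$), let $H_\Gamma^*(X)=H^*(B_\Gamma X)$ and $H_\Gamma^*=H^*(B\Gamma)$, let $\pi^*:H_\Gamma^*\to H_\Gamma^*(X)$ be induced by the projection $B_\Gamma X\to B\Gamma$, let $\rho:H_\Gamma^*(X)\to H^*(X)$ be the forgetful map (restriction to the fibre $X\subset B_\Gamma X$), and let $r:H_\Gamma^*(X)\to H_\Gamma^*(X^\Gamma)=H^*(X^\Gamma)[u]$ be the restriction map. Suppose that $X$ is a halving space: $H^n(X)=0$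 unless $n$ is divisible by $2D$, and there is given a degree-preserving $R$-linear map $\sigma:H^*(X)\to H_\Gamma^*(X)$ with $\rho\sigma=\mathrm{id}$ such that for every $i\ge 0$ and every nonzero $x\in H^{2Di}(X)$, $r(\sigma(x))$ is a polynomial in $u$ of degree exactly $i$. Let $\kappa:H^*(X)\to H^*(X^\Gamma)$ be the $R$-linear map that sends $x\in H^{2Di}(X)$ to the coefficient of $u^i$ in $r(\sigma(x))$. Then $\kappa$ is well defined, maps $H^{2Di}(X)$ to $H^{Di}(X^\Gamma)$ for all $i$, and is a (unital) ring homomorphism; $\sigma$ is a (unital) ring homomorphism; and the Leray–Hirsch map $$H^*(X)\otimes_R H_\Gamma^*\to H_\Gamma^*(X),\qquad x\otimes b\mapsto \sigma(x)\,\pi^*(b),$$ is an isomorphism of $R$-algebras, and thus of $H_\Gamma^*$-algebras. -/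

import Mathlib

universe u v

namespace Halving

open CategoryTheory Simplicial DirectSum

section Simplicial
variable (R : Type v) [CommRing R]

/-- The `n`-cochains of a simplicial set with coefficients in `R`. -/
abbrev Cochain (S : SSet.{u}) (n : ℕ) : Type (max u v) := S _⦋n⦌ → R

variable {S T : SSet.{u}}

/-- The coboundary `(δf)(s) = ∑ᵢ (-1)ⁱ f(dᵢ s)`. -/
def coboundary (S : SSet.{u}) (n : ℕ) : Cochain R S n →ₗ[R] Cochain R S (n + 1) where
  toFun f := fun s => ∑ i : Fin (n + 2), (-1 : R) ^ (i : ℕ) * f (S.δ i s)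
  map_add' f g := by
    funext s
    simp [mul_add, Finset.sum_add_distrib]
  map_smul' c f := by
    funext s
    simp [Finset.mul_sum, mul_left_comm]

/-- The cocycles of degree `n`. -/
def cocycles (S : SSet.{u}) (n : ℕ) : Submodule R (Cochain R S n) :=
  LinearMap.ker (coboundary R S n)

/-- The coboundaries of degree `n` (there are none but `0` in degree `0`). -/
def coboundaries (S : SSet.{u}) (n : ℕ) : Submodule R (Cochain R S n) :=
  match n with
  | 0 => ⊥
  | n + 1 => LinearMap.range (coboundary R S n)

/-- The cohomology of a simplicial set in degree `n`: cocycles modulo coboundaries. -/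
def SCohomology (S : SSet.{u}) (n : ℕ) : Type (max u v) :=
  cocycles R S n ⧸ (coboundaries R S n).submoduleOf (cocycles R S n)

instance (S : SSet.{u}) (n : ℕ) : AddCommGroup (SCohomology R S n) :=
  inferInstanceAs (AddCommGroup (_ ⧸ (coboundaries R S n).submoduleOf (cocycles R S n)))

instance (S : SSet.{u}) (n : ℕ) : Module R (SCohomology R S n) :=
  inferInstanceAs (Module R (_ ⧸ (coboundaries R S n).submoduleOf (cocycles R S n)))

/-- The cohomology class of a cocycle. -/
def cls (S : SSet.{u}) (n : ℕ) : cocycles R S n →ₗ[R] SCohomology R S n :=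
  ((coboundaries R S n).submoduleOf (cocycles R S n)).mkQ

variable {R}

/-- The front `p`-face of an `n`-simplex. -/
def front {n : ℕ} (p : ℕ) (h : p ≤ n) (s : S _⦋n⦌) : S _⦋p⦌ :=
  S.map (SimplexCategory.subinterval 0 p (by omega)).op s

/-- The back `q`-face of an `n`-simplex, `n = p + q`. -/
def back {n : ℕ} (p q : ℕ) (h : p + q = n) (s : S _⦋n⦌) : S _⦋q⦌ :=
  S.map (SimplexCategory.subinterval p q (by omega)).op s

lemma hom_ext_val {a b : ℕ} {f g : ⦋a⦌ ⟶ ⦋b⦌}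
    (h : ∀ x : Fin (a + 1), (f x : ℕ) = (g x : ℕ)) : f = g := by
  ext x
  exact h x

lemma subinterval_val {n : ℕ} (j l : ℕ) (h : j + l ≤ n) (x : Fin (l + 1)) :
    ((SimplexCategory.subinterval j l h x : Fin (n + 1)) : ℕ) = x + j := rfl

lemma delta_val {n : ℕ} (i : Fin (n + 2)) (x : Fin (n + 1)) :
    ((x : ℕ) < i ∧ ((SimplexCategory.δ i x : Fin (n + 2)) : ℕ) = x) ∨
      ((i : ℕ) ≤ x ∧ ((SimplexCategory.δ i x : Fin (n + 2)) : ℕ) = x + 1) := by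
  change (_ ∧ ((i.succAbove x : Fin (n + 2)) : ℕ) = _) ∨ (_ ∧ ((i.succAbove x : Fin _) : ℕ) = _)
  simp only [Fin.succAbove, Fin.lt_def, Fin.val_castSucc]
  split_ifs with h
  · exact Or.inl ⟨h, rfl⟩
  · exact Or.inr ⟨by omega, rfl⟩

lemma map_map_eq {a b b' c : ℕ} (f : ⦋a⦌ ⟶ ⦋b⦌) (g : ⦋b⦌ ⟶ ⦋c⦌) (f' : ⦋a⦌ ⟶ ⦋b'⦌)
    (g' : ⦋b'⦌ ⟶ ⦋c⦌) (h : ∀ x : Fin (a + 1), (g (f x) : ℕ) = (g' (f' x) : ℕ)) (s : S _⦋c⦌) :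
    S.map f.op (S.map g.op s) = S.map f'.op (S.map g'.op s) := by
  have : f ≫ g = f' ≫ g' := hom_ext_val h
  rw [← comp_apply, ← comp_apply, ← S.map_comp, ← S.map_comp, ← op_comp, ← op_comp, this]

lemma map_map_eq' {a b c : ℕ} (f : ⦋a⦌ ⟶ ⦋b⦌) (g : ⦋b⦌ ⟶ ⦋c⦌) (k : ⦋a⦌ ⟶ ⦋c⦌)
    (h : ∀ x : Fin (a + 1), (g (f x) : ℕ) = (k x : ℕ)) (s : S _⦋c⦌) :
    S.map f.op (S.map g.op s) = S.map k.op s := by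
  have : f ≫ g = k := hom_ext_val h
  rw [← comp_apply, ← S.map_comp, ← op_comp, this]

/-- The cup product of cochains: `(f ⌣ g)(s) = f(front face of s) * g(back face of s)`. -/
def cupCochain {p q n : ℕ} (h : p + q = n) :
    Cochain R S p →ₗ[R] Cochain R S q →ₗ[R] Cochain R S n :=
  LinearMap.mk₂ R (fun f g s => f (front p (by omega) s) * g (back p q h s))
    (fun _ _ _ => by funext s; simp [add_mul])
    (fun _ _ _ => by funext s; simp [mul_assoc])
    (fun _ _ _ => by funext s; simp [mul_add])
    (fun _ _ _ => by funext s; simp [mul_left_comm])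

lemma front_delta_low {p q n : ℕ} (h : p + q = n) (i : ℕ) (hi : i < p + 2) (s : S _⦋n + 1⦌) :
    S.δ (⟨i, hi⟩ : Fin (p + 2)) (front (p + 1) (by omega) s) =
      front p (by omega) (S.δ (⟨i, by omega⟩ : Fin (n + 2)) s) := by
  apply map_map_eq
  intro x
  have a := delta_val (⟨i, hi⟩ : Fin (p + 2)) x
  have b := delta_val (⟨i, by omega⟩ : Fin (n + 2))
    (SimplexCategory.subinterval (n := n) 0 p (by omega) x)
  simp only [subinterval_val] at a b ⊢
  omega

lemma front_delta_high {p q n : ℕ} (h : p + q = n) (i : ℕ) (hi : i < n + 2) (hp : p < i)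
    (s : S _⦋n + 1⦌) :
    front p (by omega) (S.δ (⟨i, hi⟩ : Fin (n + 2)) s) = front p (by omega) s := by
  apply map_map_eq'
  intro x
  have := x.2
  have b := delta_val (⟨i, hi⟩ : Fin (n + 2))
    (SimplexCategory.subinterval (n := n) 0 p (by omega) x)
  simp only [subinterval_val] at b ⊢
  omega

lemma back_delta_low {p q n : ℕ} (h : p + q = n) (i : ℕ) (hi : i < p + 1) (s : S _⦋n + 1⦌) :
    back p q h (S.δ (⟨i, by omega⟩ : Fin (n + 2)) s) = back (p + 1) q (by omega) s := by
  apply map_map_eq'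
  intro x
  have b := delta_val (⟨i, by omega⟩ : Fin (n + 2))
    (SimplexCategory.subinterval (n := n) p q (by omega) x)
  simp only [subinterval_val] at b ⊢
  omega

lemma back_delta_high {p q n : ℕ} (h : p + q = n) (j : ℕ) (hj : j < q + 2) (s : S _⦋n + 1⦌) :
    S.δ (⟨j, hj⟩ : Fin (q + 2)) (back p (q + 1) (by omega) s) =
      back p q h (S.δ (⟨p + j, by omega⟩ : Fin (n + 2)) s) := by
  apply map_map_eq
  intro x
  have a := delta_val (⟨j, hj⟩ : Fin (q + 2)) x
  have b := delta_val (⟨p + j, by omega⟩ : Fin (n + 2))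
    (SimplexCategory.subinterval (n := n) p q (by omega) x)
  simp only [subinterval_val] at a b ⊢
  omega

/-- The Leibniz rule. -/
lemma coboundary_cup {p q n : ℕ} (h : p + q = n) (f : Cochain R S p) (g : Cochain R S q) :
    coboundary R S n (cupCochain h f g) =
      cupCochain (by omega : p + 1 + q = n + 1) (coboundary R S p f) g +
        (-1 : R) ^ p • cupCochain (by omega : p + (q + 1) = n + 1) f (coboundary R S q g) := by
  funext s
  subst h
  change ∑ i : Fin (p + q + 2), (-1 : R) ^ (i : ℕ) *
      (f (front p _ (S.δ i s)) * g (back p q _ (S.δ i s))) =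
    (∑ i : Fin (p + 2), (-1 : R) ^ (i : ℕ) * f (S.δ i (front (p + 1) _ s))) *
        g (back (p + 1) q _ s) +
      (-1 : R) ^ p * (f (front p _ s) *
        ∑ j : Fin (q + 2), (-1 : R) ^ (j : ℕ) * g (S.δ j (back p (q + 1) _ s)))
  have e : p + 1 + (q + 1) = p + q + 2 := by omega
  rw [← (finCongr e).sum_comp, Fin.sum_univ_add]
  rw [Fin.sum_univ_castSucc (n := p + 1) (f := fun i : Fin (p + 2) =>
      (-1 : R) ^ (i : ℕ) * f (S.δ i (front (p + 1) (by omega) s))),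
    Fin.sum_univ_succ (n := q + 1) (f := fun j : Fin (q + 2) =>
      (-1 : R) ^ (j : ℕ) * g (S.δ j (back p (q + 1) (by omega) s))),
    add_mul, Finset.sum_mul, mul_add, mul_add]
  have h1 : ∀ i : Fin (p + 1), (-1 : R) ^ ((finCongr e (Fin.castAdd (q + 1) i) : Fin _) : ℕ) *
      (f (front p (by omega) (S.δ (finCongr e (Fin.castAdd (q + 1) i)) s)) *
        g (back p q rfl (S.δ (finCongr e (Fin.castAdd (q + 1) i)) s))) =
      (-1 : R) ^ (i.castSucc : ℕ) * f (S.δ i.castSucc (front (p + 1) (by omega) s)) *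
        g (back (p + 1) q (by omega) s) := by
    intro i
    have a := front_delta_low (S := S) (rfl : p + q = p + q) i (by omega) s
    have b := back_delta_low (S := S) (rfl : p + q = p + q) i (by omega) s
    have c : finCongr e (Fin.castAdd (q + 1) i) = (⟨i, by omega⟩ : Fin (p + q + 2)) := rfl
    have d : i.castSucc = (⟨i, by omega⟩ : Fin (p + 2)) := rfl
    rw [c, d, a, b, mul_assoc]
  have h2 : ∀ j : Fin (q + 1), (-1 : R) ^ ((finCongr e (Fin.natAdd (p + 1) j) : Fin _) : ℕ) *
      (f (front p (by omega) (S.δ (finCongr e (Fin.natAdd (p + 1) j)) s)) *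
        g (back p q rfl (S.δ (finCongr e (Fin.natAdd (p + 1) j)) s))) =
      (-1 : R) ^ p * (f (front p (by omega) s) * ((-1 : R) ^ (j.succ : ℕ) *
        g (S.δ j.succ (back p (q + 1) (by omega) s)))) := by
    intro j
    have a := front_delta_high (S := S) (rfl : p + q = p + q) (p + (j + 1)) (by omega)
      (by omega) s
    have b := back_delta_high (S := S) (rfl : p + q = p + q) (j + 1) (by omega) s
    have c : finCongr e (Fin.natAdd (p + 1) j) = (⟨p + (j + 1), by omega⟩ : Fin (p + q + 2)) := by
      ext
      simp
      try omega
    have d : j.succ = (⟨j + 1, by omega⟩ : Fin (q + 2)) := rfl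
    rw [c, d, a, b]
    simp only [pow_add]
    ring
  have h3 : front p (by omega) s =
      S.δ (Fin.last (p + 1)) (front (p + 1) (by omega : p + 1 ≤ p + q + 1) s) := by
    rw [← front_delta_high (S := S) (rfl : p + q = p + q) (p + 1) (by omega) (by omega) s]
    exact (front_delta_low (S := S) (rfl : p + q = p + q) (p + 1) (by omega) s).symm
  have h4 : S.δ (0 : Fin (q + 2)) (back p (q + 1) (by omega : p + (q + 1) = p + q + 1) s) =
      back (p + 1) q (by omega) s := by
    rw [← back_delta_low (S := S) (rfl : p + q = p + q) p (by omega) s]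
    exact back_delta_high (S := S) (rfl : p + q = p + q) 0 (by omega) s
  simp only [h1, h2, ← h3, h4, ← Finset.mul_sum, Fin.val_last, Fin.val_zero, pow_zero, pow_succ]
  ring

lemma cup_assoc {p q r m k n : ℕ} (h₁ : p + q = m) (h₂ : m + r = n) (h₃ : q + r = k)
    (h₄ : p + k = n) (f : Cochain R S p) (g : Cochain R S q) (l : Cochain R S r) :
    cupCochain h₂ (cupCochain h₁ f g) l = cupCochain h₄ f (cupCochain h₃ g l) := by
  funext s
  change f (front p _ (front m _ s)) * g (back p q _ (front m _ s)) * l (back m r _ s) =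
    f (front p _ s) * (g (front q _ (back p k _ s)) * l (back q r _ (back p k _ s)))
  have a : front p (by omega) (front m (by omega) s) = front p (by omega) s := by
    apply map_map_eq'
    intro x
    simp only [subinterval_val]
  have b : back p q h₁ (front m (by omega) s) = front q (by omega) (back p k h₄ s) := by
    apply map_map_eq
    intro x
    simp only [subinterval_val]
    try omega
  have c : back q r h₃ (back p k h₄ s) = back m r h₂ s := by
    apply map_map_eq'
    intro x
    simp only [subinterval_val]
    omega
  rw [a, b, c, mul_assoc]

lemma cls_surjective (n : ℕ) : Function.Surjective (cls R S n) :=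
  Submodule.mkQ_surjective _

lemma cls_eq_zero {n : ℕ} (a : cocycles R S n) :
    cls R S n a = 0 ↔ (a : Cochain R S n) ∈ coboundaries R S n :=
  Submodule.Quotient.mk_eq_zero _

/-- Two linear maps on cohomology that agree on classes of cocycles are equal. -/
lemma scohomology_ext {n : ℕ} {M : Type*} [AddCommGroup M] [Module R M]
    {f g : SCohomology R S n →ₗ[R] M} (h : ∀ a, f (cls R S n a) = g (cls R S n a)) : f = g := by
  ext x
  obtain ⟨a, rfl⟩ := cls_surjective n x
  exact h a

/-- Linear maps out of cohomology. -/
def clsLift {n : ℕ} {M : Type*} [AddCommGroup M] [Module R M] (f : cocycles R S n →ₗ[R] M)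
    (hf : ∀ a : cocycles R S n, (a : Cochain R S n) ∈ coboundaries R S n → f a = 0) : SCohomology R S n →ₗ[R] M :=
  Submodule.liftQ _ f fun a ha => hf a ha

@[simp]
lemma clsLift_cls {n : ℕ} {M : Type*} [AddCommGroup M] [Module R M] (f : cocycles R S n →ₗ[R] M)
    (hf : ∀ a : cocycles R S n, (a : Cochain R S n) ∈ coboundaries R S n → f a = 0) (a : cocycles R S n) :
    clsLift f hf (cls R S n a) = f a := rfl

lemma coboundary_cocycle {n : ℕ} (a : cocycles R S n) : coboundary R S n a = 0 := a.2

/-- The cup product of cocycles. -/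
def cupCocycle {p q n : ℕ} (h : p + q = n) :
    cocycles R S p →ₗ[R] cocycles R S q →ₗ[R] cocycles R S n :=
  LinearMap.mk₂ R (fun a b => ⟨cupCochain h a b, by
      rw [cocycles, LinearMap.mem_ker, coboundary_cup, coboundary_cocycle, coboundary_cocycle]
      simp⟩)
    (fun _ _ _ => by ext1; simp)
    (fun _ _ _ => by ext1; simp)
    (fun _ _ _ => by ext1; simp)
    (fun _ _ _ => by ext1; simp)

@[simp]
lemma cupCocycle_coe {p q n : ℕ} (h : p + q = n) (a : cocycles R S p) (b : cocycles R S q) :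
    (cupCocycle h a b : Cochain R S n) = cupCochain h (a : Cochain R S p) (b : Cochain R S q) := rfl

lemma cup_mem_left {p q n : ℕ} (h : p + q = n) (f : Cochain R S p) (b : cocycles R S q)
    (hf : f ∈ coboundaries R S p) : cupCochain h f (b : Cochain R S q) ∈ coboundaries R S n := by
  cases p with
  | zero =>
    rw [show f = 0 from hf]
    simp
  | succ p =>
    obtain ⟨c, rfl⟩ := hf
    obtain ⟨n, rfl⟩ : ∃ m, n = m + 1 := ⟨p + q, by omega⟩
    refine ⟨cupCochain (by omega : p + q = n) c b, ?_⟩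
    rw [coboundary_cup, coboundary_cocycle]
    simp

lemma cup_mem_right {p q n : ℕ} (h : p + q = n) (a : cocycles R S p) (g : Cochain R S q)
    (hg : g ∈ coboundaries R S q) : cupCochain h (a : Cochain R S p) g ∈ coboundaries R S n := by
  cases q with
  | zero =>
    rw [show g = 0 from hg]
    simp
  | succ q =>
    obtain ⟨c, rfl⟩ := hg
    obtain ⟨n, rfl⟩ : ∃ m, n = m + 1 := ⟨p + q, by omega⟩
    refine ⟨(-1 : R) ^ p • cupCochain (by omega : p + q = n) a c, ?_⟩
    rw [map_smul, coboundary_cup, coboundary_cocycle, smul_add, smul_smul, ← pow_add]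
    simp [← two_mul]

/-- The cup product in cohomology. -/
def cup {p q n : ℕ} (h : p + q = n) :
    SCohomology R S p →ₗ[R] SCohomology R S q →ₗ[R] SCohomology R S n :=
  clsLift
    { toFun := fun a => clsLift (cls R S n ∘ₗ cupCocycle h a) fun b hb =>
        (cls_eq_zero _).2 (cup_mem_right h a b hb)
      map_add' := fun a a' => scohomology_ext fun b => by simp
      map_smul' := fun c a => scohomology_ext fun b => by simp }
    fun a ha => scohomology_ext fun b => (cls_eq_zero _).2 (cup_mem_left h a b ha)

@[simp]
lemma cup_cls {p q n : ℕ} (h : p + q = n) (a : cocycles R S p) (b : cocycles R S q) :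
    cup h (cls R S p a) (cls R S q b) = cls R S n (cupCocycle h a b) := rfl

variable (R S) in
/-- The constant cochain `1`, as a cocycle of degree `0`. -/
def oneCocycle : cocycles R S 0 :=
  ⟨fun _ => 1, by
    rw [cocycles, LinearMap.mem_ker]
    funext s
    simp [coboundary]⟩

instance : GradedMonoid.GOne (SCohomology R S) where
  one := cls R S 0 (oneCocycle R S)

instance : GradedMonoid.GMul (SCohomology R S) where
  mul a b := cup rfl a b

lemma mk_cup {p q n : ℕ} (h : p + q = n) (a : SCohomology R S p) (b : SCohomology R S q) :
    (GradedMonoid.mk p a * GradedMonoid.mk q b : GradedMonoid (SCohomology R S)) =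
      GradedMonoid.mk n (cup h a b) := by
  subst h
  rfl

lemma front_self {n : ℕ} (s : S _⦋n⦌) : front n le_rfl s = s := by
  have : SimplexCategory.subinterval (n := n) 0 n (by omega) = 𝟙 _ := hom_ext_val fun x => rfl
  simp [front, this]

lemma back_self {n : ℕ} (s : S _⦋n⦌) : back 0 n (by omega) s = s := by
  have : SimplexCategory.subinterval (n := n) 0 n (by omega) = 𝟙 _ := hom_ext_val fun x => rfl
  simp [back, this]

lemma one_cup {n : ℕ} (a : SCohomology R S n) :
    cup (by omega : 0 + n = n) (cls R S 0 (oneCocycle R S)) a = a := by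
  obtain ⟨a, rfl⟩ := cls_surjective n a
  rw [cup_cls]
  congr 1
  ext1
  funext s
  change (1 : R) * a.1 (back 0 n _ s) = a.1 s
  rw [back_self, one_mul]

lemma cup_one {n : ℕ} (a : SCohomology R S n) :
    cup (by omega : n + 0 = n) a (cls R S 0 (oneCocycle R S)) = a := by
  obtain ⟨a, rfl⟩ := cls_surjective n a
  rw [cup_cls]
  congr 1
  ext1
  funext s
  change a.1 (front n _ s) * (1 : R) = a.1 s
  rw [front_self, mul_one]

instance : DirectSum.GRing (SCohomology R S) where
  one_mul := by
    rintro ⟨n, a⟩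
    exact (mk_cup (by omega : 0 + n = n) _ _).trans (congrArg _ (one_cup a))
  mul_one := by
    rintro ⟨n, a⟩
    exact (mk_cup (by omega : n + 0 = n) _ _).trans (congrArg _ (cup_one a))
  mul_assoc := by
    rintro ⟨p, a⟩ ⟨q, b⟩ ⟨r, c⟩
    obtain ⟨a, rfl⟩ := cls_surjective p a
    obtain ⟨b, rfl⟩ := cls_surjective q b
    obtain ⟨c, rfl⟩ := cls_surjective r c
    change GradedMonoid.mk p _ * GradedMonoid.mk q _ * GradedMonoid.mk r _ =
      GradedMonoid.mk p _ * (GradedMonoid.mk q _ * GradedMonoid.mk r _)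
    rw [mk_cup rfl, mk_cup rfl, mk_cup rfl, mk_cup (by omega : p + (q + r) = p + q + r)]
    congr 1
    simp only [cup_cls]
    congr 1
    ext1
    exact cup_assoc _ _ _ _ _ _ _
  mul_zero a := map_zero _
  zero_mul b := by change cup rfl 0 b = 0; simp
  mul_add a b c := map_add _ _ _
  add_mul a b c := by change cup rfl (a + b) c = cup rfl a c + cup rfl b c; simp
  natCast n := n • cls R S 0 (oneCocycle R S)
  natCast_zero := zero_smul _ _
  natCast_succ n := succ_nsmul _ _
  intCast n := n • cls R S 0 (oneCocycle R S)
  intCast_ofNat n := natCast_zsmul _ _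
  intCast_negSucc_ofNat n := by
    change Int.negSucc n • _ = -((n + 1 : ℕ) • _)
    rw [negSucc_zsmul]

instance : DirectSum.GAlgebra R (SCohomology R S) where
  toFun := (LinearMap.toSpanSingleton R _ (cls R S 0 (oneCocycle R S))).toAddMonoidHom
  map_one := one_smul R (cls R S 0 (oneCocycle R S))
  map_mul r s := by
    refine Eq.trans ?_ (mk_cup (by omega : 0 + 0 = 0) (r • cls R S 0 (oneCocycle R S))
      (s • cls R S 0 (oneCocycle R S))).symm
    congr 1
    rw [map_smul, map_smul, LinearMap.smul_apply, one_cup]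
    change (r * s) • cls R S 0 (oneCocycle R S) = s • r • cls R S 0 (oneCocycle R S)
    rw [mul_comm, mul_smul]
  commutes := by
    rintro r ⟨n, a⟩
    refine (mk_cup (by omega : 0 + n = n) (r • cls R S 0 (oneCocycle R S)) a).trans
      (Eq.trans ?_ (mk_cup (by omega : n + 0 = n) a (r • cls R S 0 (oneCocycle R S))).symm)
    congr 1
    rw [map_smul, map_smul, LinearMap.smul_apply, one_cup, cup_one]
  smul_def := by
    rintro r ⟨n, a⟩
    refine Eq.trans ?_ (mk_cup (by omega : 0 + n = n) (r • cls R S 0 (oneCocycle R S)) a).symm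
    change GradedMonoid.mk n (r • a) = _
    congr 1
    rw [map_smul, LinearMap.smul_apply, one_cup]

/-- Pullback of cochains along a map of simplicial sets. -/
def cochainMap (φ : S ⟶ T) (n : ℕ) : Cochain R T n →ₗ[R] Cochain R S n where
  toFun f := fun s => f (φ.app (Opposite.op ⦋n⦌) s)
  map_add' _ _ := rfl
  map_smul' _ _ := rfl

lemma app_map (φ : S ⟶ T) {a b : ℕ} (θ : ⦋a⦌ ⟶ ⦋b⦌) (s : S _⦋b⦌) :
    φ.app (Opposite.op ⦋a⦌) (S.map θ.op s) = T.map θ.op (φ.app (Opposite.op ⦋b⦌) s) := by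
  rw [← comp_apply, ← comp_apply, φ.naturality]

lemma coboundary_cochainMap (φ : S ⟶ T) (n : ℕ) (f : Cochain R T n) :
    coboundary R S n (cochainMap φ n f) = cochainMap φ (n + 1) (coboundary R T n f) := by
  funext s
  change ∑ i : Fin (n + 2), (-1 : R) ^ (i : ℕ) * f (φ.app _ (S.δ i s)) =
    ∑ i : Fin (n + 2), (-1 : R) ^ (i : ℕ) * f (T.δ i (φ.app _ s))
  refine Finset.sum_congr rfl fun i _ => ?_
  congr 2
  exact app_map φ _ s

/-- Pullback of cocycles. -/
def cocycleMap (φ : S ⟶ T) (n : ℕ) : cocycles R T n →ₗ[R] cocycles R S n :=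
  (cochainMap φ n).restrict fun f hf => by
    rw [cocycles, LinearMap.mem_ker] at hf ⊢
    rw [coboundary_cochainMap, hf, map_zero]

lemma cochainMap_mem (φ : S ⟶ T) (n : ℕ) (f : Cochain R T n) (hf : f ∈ coboundaries R T n) :
    cochainMap φ n f ∈ coboundaries R S n := by
  cases n with
  | zero =>
    rw [show f = 0 from hf, map_zero]
    exact Submodule.zero_mem _
  | succ n =>
    obtain ⟨c, rfl⟩ := hf
    exact ⟨cochainMap φ n c, coboundary_cochainMap φ n c⟩

variable (R) in
/-- Pullback in cohomology, degree by degree. -/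
def scohomologyMap (φ : S ⟶ T) (n : ℕ) : SCohomology R T n →ₗ[R] SCohomology R S n :=
  clsLift (cls R S n ∘ₗ cocycleMap φ n) fun a ha =>
    (cls_eq_zero _).2 (cochainMap_mem φ n (a : Cochain R T n) ha)

@[simp]
lemma scohomologyMap_cls (φ : S ⟶ T) (n : ℕ) (a : cocycles R T n) :
    scohomologyMap R φ n (cls R T n a) = cls R S n (cocycleMap φ n a) := rfl

lemma scohomologyMap_one (φ : S ⟶ T) :
    scohomologyMap R φ 0 (cls R T 0 (oneCocycle R T)) = cls R S 0 (oneCocycle R S) := rfl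

lemma scohomologyMap_cup (φ : S ⟶ T) {p q n : ℕ} (h : p + q = n) (a : SCohomology R T p)
    (b : SCohomology R T q) :
    scohomologyMap R φ n (cup h a b) = cup h (scohomologyMap R φ p a) (scohomologyMap R φ q b) := by
  obtain ⟨a, rfl⟩ := cls_surjective p a
  obtain ⟨b, rfl⟩ := cls_surjective q b
  simp only [cup_cls, scohomologyMap_cls]
  congr 1
  ext1
  funext s
  change a.1 (front p _ _) * b.1 (back p q _ _) =
    a.1 (φ.app _ (front p _ _)) * b.1 (φ.app _ (back p q _ _))
  rw [front, back, front, back, app_map, app_map]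

variable (R) in
/-- Pullback as a homomorphism of total cohomology rings. -/
noncomputable def scohomologyHom (φ : S ⟶ T) :
    (⨁ n, SCohomology R T n) →ₐ[R] ⨁ n, SCohomology R S n :=
  DirectSum.toAlgebra R (SCohomology R T)
    (fun n => DirectSum.lof R ℕ (SCohomology R S) n ∘ₗ scohomologyMap R φ n)
    (congrArg (DirectSum.of (SCohomology R S) 0) (scohomologyMap_one φ))
    (fun {p q} a b => (congrArg (DirectSum.of (SCohomology R S) (p + q))
      (scohomologyMap_cup φ rfl a b)).trans
        (DirectSum.of_mul_of (scohomologyMap R φ p a) (scohomologyMap R φ q b)).symm)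

end Simplicial

section Topology

variable (R : Type v) [CommRing R]

/-- Singular cohomology of a topological space in degree `n`. -/
abbrev HDeg (X : Type u) [TopologicalSpace X] (n : ℕ) : Type (max u v) :=
  SCohomology R (TopCat.toSSet.obj (TopCat.of X)) n

/-- The singular cohomology ring `H^*(X; R) = ⨁ₙ H^n(X; R)` with the cup product. -/
abbrev HRing (X : Type u) [TopologicalSpace X] : Type (max u v) :=
  ⨁ n, HDeg R X n

/-- The homogeneous elements of degree `n` in the cohomology ring. -/
noncomputable def degreePart (X : Type u) [TopologicalSpace X] (n : ℕ) : Submodule R (HRing R X) :=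
  LinearMap.range (DirectSum.lof R ℕ (HDeg R X) n)

/-- The ring homomorphism `f^* : H^*(Y) → H^*(X)` induced by a continuous map `f : X → Y`. -/
noncomputable def pullback {X Y : Type u} [TopologicalSpace X] [TopologicalSpace Y] (f : C(X, Y)) :
    HRing R Y →ₐ[R] HRing R X :=
  scohomologyHom R (TopCat.toSSet.map (TopCat.ofHom f))

/-- The total space `EΓ` of Milnor's universal bundle: the infinite join of copies of `Γ`.
A point is a sequence of barycentric coordinates `t i`, almost all zero and with sum `1`, together
with an element `g i` of `Γ` for every `i` with `t i ≠ 0`. -/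
@[ext]
structure MilnorE (Γ : Type u) where
  t : ℕ →₀ ℝ
  t_nonneg : ∀ i, 0 ≤ t i
  t_sum : (t.sum fun _ a => a) = 1
  g : ∀ i, t i ≠ 0 → Γ

namespace MilnorE

variable {Γ : Type u}

/-- Milnor's topology: the coarsest one for which all `t i` are continuous, and all `g i` are
continuous on the open sets `{t i ≠ 0}`. -/
instance [TopologicalSpace Γ] : TopologicalSpace (MilnorE Γ) :=
  TopologicalSpace.generateFrom
    ({A | ∃ (i : ℕ) (V : Set ℝ), IsOpen V ∧ A = {e | e.t i ∈ V}} ∪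
      {A | ∃ (i : ℕ) (W : Set Γ), IsOpen W ∧ A = {e | ∃ h : e.t i ≠ 0, e.g i h ∈ W}})

/-- The free action of `Γ` on `EΓ` by left multiplication of all `g i`. -/
instance [Group Γ] : MulAction Γ (MilnorE Γ) where
  smul γ e := ⟨e.t, e.t_nonneg, e.t_sum, fun i h => γ * e.g i h⟩
  one_smul e := by
    change (⟨e.t, e.t_nonneg, e.t_sum, fun i h => 1 * e.g i h⟩ : MilnorE Γ) = e
    simp
  mul_smul a b e := by
    change (⟨e.t, e.t_nonneg, e.t_sum, fun i h => a * b * e.g i h⟩ : MilnorE Γ) =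
      ⟨e.t, e.t_nonneg, e.t_sum, fun i h => a * (b * e.g i h)⟩
    simp [mul_assoc]

/-- The base point: the unit of `Γ` in the first copy of `Γ`. -/
noncomputable def base [Group Γ] : MilnorE Γ where
  t := Finsupp.single 0 1
  t_nonneg i := by
    rw [Finsupp.single_apply]
    split_ifs <;> norm_num
  t_sum := by simp
  g _ _ := 1

end MilnorE

section Borel

variable (Γ : Type u) [Group Γ] [TopologicalSpace Γ]

/-- The classifying space `BΓ = EΓ / Γ`. -/
abbrev Classifying : Type u := MulAction.orbitRel.Quotient Γ (MilnorE Γ)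

/-- The Borel construction `B_Γ X = EΓ ×_Γ X`, the quotient of `EΓ × X` by the diagonal action. -/
abbrev Borel (X : Type u) [MulAction Γ X] : Type u :=
  MulAction.orbitRel.Quotient Γ (MilnorE Γ × X)

variable {Γ}
variable {X Y : Type u} [TopologicalSpace X] [MulAction Γ X] [TopologicalSpace Y] [MulAction Γ Y]

/-- The map of Borel constructions induced by an equivariant continuous map. -/
def borelMap (f : C(X, Y)) (hf : ∀ (γ : Γ) (x : X), f (γ • x) = γ • f x) :
    C(Borel Γ X, Borel Γ Y) where
  toFun := Quotient.map' (fun z => (z.1, f z.2)) (by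
    rintro a b ⟨γ, rfl⟩
    exact ⟨γ, by simp [Prod.smul_def, hf]⟩)
  continuous_toFun := Continuous.quotient_map' (by fun_prop) _

variable (Γ X)

/-- The bundle projection `B_Γ X → BΓ`. -/
def borelProj : C(Borel Γ X, Classifying Γ) where
  toFun := Quotient.map' (fun z => z.1) (by
    rintro a b ⟨γ, rfl⟩
    exact ⟨γ, rfl⟩)
  continuous_toFun := Continuous.quotient_map' continuous_fst _

/-- The inclusion `X → B_Γ X` of the fibre over the base point. -/
noncomputable def fibreInclusion : C(X, Borel Γ X) where
  toFun x := Quotient.mk'' (MilnorE.base, x)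
  continuous_toFun := continuous_quotient_mk'.comp (by fun_prop)

/-- The fixed point set `X^Γ`, with the subspace topology. -/
abbrev Fixed : Type u := MulAction.fixedPoints Γ X

/-- The (trivial) action of `Γ` on `X^Γ`, the restriction of the action on `X`. -/
instance fixedAction : MulAction Γ (Fixed Γ X) where
  smul γ x := ⟨γ • (x : X), by rw [x.2 γ]; exact x.2⟩
  one_smul x := Subtype.ext (one_smul Γ (x : X))
  mul_smul a b x := Subtype.ext (mul_smul a b (x : X))

/-- The inclusion `B_Γ X^Γ → B_Γ X`. -/
def borelFixedInclusion : C(Borel Γ (Fixed Γ X), Borel Γ X) :=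
  borelMap ⟨Subtype.val, continuous_subtype_val⟩ fun _ _ => rfl

/-- The projection `B_Γ X^Γ → X^Γ`; together with `B_Γ X^Γ → BΓ` it identifies `B_Γ X^Γ` with
`BΓ × X^Γ`, as the action on `X^Γ` is trivial. -/
def borelFixedProj : C(Borel Γ (Fixed Γ X), Fixed Γ X) where
  toFun := Quotient.lift (fun z => z.2) (by
    rintro a b ⟨γ, rfl⟩
    exact Subtype.ext (b.2.2 γ))
  continuous_toFun := continuous_snd.quotient_lift _

/-- The equivariant cohomology ring `H_Γ^*(X; R) = H^*(B_Γ X; R)`. -/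
abbrev EqRing : Type (max u v) := HRing R (Borel Γ X)

/-- The forgetful map `ρ : H_Γ^*(X) → H^*(X)`. -/
noncomputable def forget : EqRing R Γ X →ₐ[R] HRing R X :=
  pullback R (fibreInclusion Γ X)

/-- The map `H_Γ^* = H^*(BΓ) → H_Γ^*(X)` giving the `H_Γ^*`-algebra structure. -/
noncomputable def fromClassifying : HRing R (Classifying Γ) →ₐ[R] EqRing R Γ X :=
  pullback R (borelProj Γ X)

/-- The restriction `r : H_Γ^*(X) → H_Γ^*(X^Γ)`. -/
noncomputable def restrictFixed : EqRing R Γ X →ₐ[R] EqRing R Γ (Fixed Γ X) :=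
  pullback R (borelFixedInclusion Γ X)

variable {R} {Γ}

/-- `(Γ, R)` is a halving pair with generator `u` of degree `D > 0`: the map
`R[u] → H^*(BΓ; R)` is an isomorphism. -/
structure IsHalvingPair (D : ℕ) (u : HDeg R (Classifying Γ) D) : Prop where
  pos : 0 < D
  bijective : Function.Bijective
    (Polynomial.aeval (R := R) (DirectSum.of (HDeg R (Classifying Γ)) D u))

variable (D : ℕ) (u : HDeg R (Classifying Γ) D)

/-- The identification `H^*(X^Γ)[u] → H_Γ^*(X^Γ)`, `∑ⱼ aⱼ uʲ ↦ ∑ⱼ aⱼ ⌣ uʲ`. An element of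
`H_Γ^*(X^Γ)` is regarded as the polynomial in `u` that is mapped to it. -/
noncomputable def polyToEq (p : Polynomial (HRing R (Fixed Γ X))) : EqRing R Γ (Fixed Γ X) :=
  p.eval₂ (pullback R (borelFixedProj Γ X)).toRingHom
    (fromClassifying R Γ (Fixed Γ X) (DirectSum.of (HDeg R (Classifying Γ)) D u))

variable {X}

/-- `σ : H^*(X) → H_Γ^*(X)` is a Leray-Hirsch section: it preserves degrees, and `ρ σ = id`. -/
structure IsLerayHirschSection (σ : HRing R X →ₗ[R] EqRing R Γ X) : Prop where
  degree : ∀ n, ∀ x ∈ degreePart R X n, σ x ∈ degreePart R (Borel Γ X) n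
  section_eq : ∀ x, forget R Γ X (σ x) = x

/-- `X` is a halving space by means of the Leray-Hirsch section `σ`: the cohomology of `X` is zero
outside the degrees `2Di`, and `r(σ(x))` is a polynomial in `u` of degree exactly `i` for every
nonzero `x` of degree `2Di`. -/
structure IsHalvingSection (σ : HRing R X →ₗ[R] EqRing R Γ X) : Prop
    extends IsLerayHirschSection σ where
  vanish : ∀ n, ¬ 2 * D ∣ n → Subsingleton (HDeg R X n)
  degree_condition : ∀ i, ∀ x ∈ degreePart R X (2 * D * i), x ≠ 0 →
    ∃ p : Polynomial (HRing R (Fixed Γ X)),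
      polyToEq X D u p = restrictFixed R Γ X (σ x) ∧ p.degree = i

/-- `κ(x)` is the coefficient of `uⁱ` in `r(σ(x))` for all `x` of degree `2Di`. -/
def IsLeadingCoeff (σ : HRing R X →ₗ[R] EqRing R Γ X)
    (κ : HRing R X →ₗ[R] HRing R (Fixed Γ X)) : Prop :=
  ∀ i, ∀ x ∈ degreePart R X (2 * D * i),
    ∃ p : Polynomial (HRing R (Fixed Γ X)),
      polyToEq X D u p = restrictFixed R Γ X (σ x) ∧ κ x = p.coeff i

end Borel
end Topology
end Halving

open Halving
open scoped TensorProduct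

universe w w'

namespace Halving

open CategoryTheory

/-! ### Relative injectivity and acyclic models for presheaves of vector spaces -/

section AcyclicModels

/-! The core is a comparison of degrees in u. Let x and y have degrees 2Di and 2Dj. By the
Leray–Hirsch theorem σ(x)σ(y) = ∑ σ(v_k) u^k for unique v_k, and for degree reasons a nonzero v_k
lies in some degree 2Ds with k + 2s = 2(i+j). After restriction to X^Γ the k-th term is a polynomial
in u of degree exactly s + k = i + j + k/2. These degrees grow with k, so the term with the largest
k cannot cancel, whereas r(σ(x)) r(σ(y)) has degree at most i + j. Hence only k = 0 survives, and
applying ρ gives v_0 = xy (`IsHalvingSection.map_mul_of_mem`). Multiplicativity of κ is then a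
comparison of the coefficients of u^(i+j).

Most of the work is the Leray–Hirsch theorem for B_ΓX → BΓ without any finiteness assumption on X
(`IsLerayHirschSection.lerayHirschMap_bijective`). Cochains of the base with values in the graded
vector space V = H^*(X) are mapped to cochains of the total space: the front face is fed to the
V-valued cochain, and the back face to a cocycle representing σ of the resulting vector. Both sides
are complexes of presheaves on the simplicial sets over the base that are injective relative to the
simplices of the base. Acyclic models, applied to the mapping cone, reduce the comparison to single
simplices (`isQuasiIsoAt_twist`), where it says that σ restricts to a basis of the cohomology. Since
every H^n(BΓ) has dimension at most 1, the cohomology of BΓ with coefficients in V is H^*(BΓ) ⊗ V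
even if V has infinite dimension (`exists_smul_sub_mem_vcoboundaries`).

The condition on simplices is verified by lifting singular simplices of BΓ to EΓ, which turns the
pullback of B_ΓX into a product Δ[m] × Sing X (`exists_iso_pullback`). It holds at the base point
because ρσ = id, and it spreads to all simplices because H^0(BΓ) is spanned by 1
(`restrictsToBases_borelProj`).

The same theorem for the trivial action on X^Γ identifies H_Γ^*(X^Γ) with H^*(X^Γ)[u]. Acyclic
models also yield graded commutativity (`cup_graded_comm`). As u² ≠ 0, this forces (-1)^D = 1 in R,
so u is central; hence both the polynomial ring and the tensor product carry the right
multiplication without signs. -/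

lemma exists_comp_eq_of_ker_le {k : Type*} [Field k] {M N W : Type*} [AddCommGroup M] [Module k M] [AddCommGroup N]
    [Module k N] [AddCommGroup W] [Module k W] (f : M →ₗ[k] N) (g : M →ₗ[k] W)
    (h : LinearMap.ker f ≤ LinearMap.ker g) : ∃ l : N →ₗ[k] W, ∀ x, l (f x) = g x := by
  obtain ⟨l, hl⟩ := LinearMap.exists_extend
    ((LinearMap.ker f).liftQ g h ∘ₗ f.quotKerEquivRange.symm.toLinearMap)
  refine ⟨l, fun x => ?_⟩
  have h1 := LinearMap.congr_fun hl ⟨_, LinearMap.mem_range_self f x⟩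
  have h2 : f.quotKerEquivRange.symm ⟨_, LinearMap.mem_range_self f x⟩ =
      (LinearMap.ker f).mkQ x := by
    rw [LinearEquiv.symm_apply_eq]
    rfl
  refine h1.trans ?_
  change Submodule.liftQ _ _ h (f.quotKerEquivRange.symm _) = _
  rw [h2]
  rfl

/-- A presheaf of `R`-modules on a category. -/
structure LinearPresheaf (R : Type v) [Ring R] (C : Type w') [Category.{u} C] where
  obj : C → Type w
  [addCommGroup : ∀ X, AddCommGroup (obj X)]
  [module : ∀ X, Module R (obj X)]
  res : ∀ {X Y : C}, (Y ⟶ X) → (obj X →ₗ[R] obj Y)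
  res_res : ∀ {X Y Z : C} (g : Y ⟶ X) (h : Z ⟶ Y) (x : obj X), res h (res g x) = res (h ≫ g) x

attribute [instance] LinearPresheaf.addCommGroup LinearPresheaf.module

namespace LinearPresheaf

variable {R : Type v} [Ring R] {C : Type w'} [Category.{u} C]

/-- A morphism of presheaves of modules. -/
structure Hom (P Q : LinearPresheaf.{u, v, w, w'} R C) where
  app : ∀ X, P.obj X →ₗ[R] Q.obj X
  naturality : ∀ {X Y : C} (g : Y ⟶ X) (x : P.obj X), Q.res g (app X x) = app Y (P.res g x)

/-- The product of a family of presheaves. -/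
def pi {ι : Type} (P : ι → LinearPresheaf.{u, v, w, w'} R C) :
    LinearPresheaf.{u, v, w, w'} R C where
  obj X := ∀ i, (P i).obj X
  res g :=
LinearMap.pi fun i => (P i).res g ∘ₗ LinearMap.proj i
  res_res g h x := funext fun i => (P i).res_res g h (x i)

/-- The binary product of presheaves. -/
def prod (P Q : LinearPresheaf.{u, v, w, w'} R C) : LinearPresheaf.{u, v, w, w'} R C where
  obj X := P.obj X × Q.obj X
  res g := (P.res g).prodMap (Q.res g)
  res_res g h x := Prod.ext (P.res_res g h x.1) (Q.res_res g h x.2)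

/-- A presheaf `T` is injective relative to a class of models if a map `P → T` extends along
`P → Q` as soon as it vanishes on the kernel of `P → Q` at every model. -/
def IsModelInjective (M : C → Prop) (T : LinearPresheaf.{u, v, w, w'} R C) : Prop :=
  ∀ (P Q : LinearPresheaf.{u, v, w, w'} R C) (α : Hom P Q) (g : Hom P T),
    (∀ m, M m → ∀ x, α.app m x = 0 → g.app m x = 0) →
    ∃ g' : Hom Q T, ∀ X x, g'.app X (α.app X x) = g.app X x

variable {M : C → Prop}

lemma IsModelInjective.prod {T T' : LinearPresheaf.{u, v, w, w'} R C}
    (hT : IsModelInjective M T) (hT' : IsModelInjective M T') :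
    IsModelInjective M (T.prod T') := by
  intro P Q α g hg
  obtain ⟨a, ha⟩ := hT P Q α ⟨fun X => LinearMap.fst R _ _ ∘ₗ g.app X,
    fun k x => congrArg Prod.fst (g.naturality k x)⟩ fun m hm x hx => congrArg Prod.fst (hg m hm x hx)
  obtain ⟨b, hb⟩ := hT' P Q α ⟨fun X => LinearMap.snd R _ _ ∘ₗ g.app X,
    fun k x => congrArg Prod.snd (g.naturality k x)⟩ fun m hm x hx => congrArg Prod.snd (hg m hm x hx)
  exact ⟨⟨fun X => (a.app X).prod (b.app X), fun k x => Prod.ext (a.naturality k x) (b.naturality k x)⟩,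
    fun X x => Prod.ext (ha X x) (hb X x)⟩

lemma IsModelInjective.pi {ι : Type} {T : ι → LinearPresheaf.{u, v, w, w'} R C}
    (hT : ∀ i, IsModelInjective M (T i)) : IsModelInjective M (pi T) := by
  intro P Q α g hg
  let gi (i : ι) : Hom P (T i) :=
    ⟨fun X => (LinearMap.proj i : (∀ i, (T i).obj X) →ₗ[R] (T i).obj X) ∘ₗ g.app X,
      fun k x => congrFun (g.naturality k x) i⟩
  choose a ha using fun i => hT i P Q α (gi i) fun m hm x hx => congrFun (hg m hm x hx) i
  exact ⟨⟨fun X => LinearMap.pi fun i => (a i).app X,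
    fun k x => funext fun i => (a i).naturality k x⟩, fun X x => funext fun i => ha i X x⟩

/-- A presheaf whose sections are families of values at the maps from the models is injective
relative to these models. -/
lemma isModelInjective_of_bijective {k : Type v} [Field k]
    {T : LinearPresheaf.{u, v, w, w'} k C} {J : Type*} (m : J → C) (hm : ∀ j, M (m j))
    (W : J → Type*) [∀ j, AddCommGroup (W j)] [∀ j, Module k (W j)]
    (e : ∀ j, T.obj (m j) →ₗ[k] W j)
    (he : ∀ X, Function.Bijective fun (t : T.obj X) (j : J) (a : m j ⟶ X) => e j (T.res a t)) :
    IsModelInjective M T := by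
  intro P Q α g hg
  -- Over a field, the kernel condition suffices to extend the value functional from the image of
  -- `α` at each model. No compatibility between models is needed.
  have hl : ∀ j, ∃ l : Q.obj (m j) →ₗ[k] W j, ∀ x, l (α.app (m j) x) = e j (g.app (m j) x) :=
    fun j => exists_comp_eq_of_ker_le (α.app (m j)) (e j ∘ₗ g.app (m j)) fun x hx => by
      rw [LinearMap.mem_ker] at hx ⊢
      rw [LinearMap.comp_apply, hg _ (hm j) x hx, map_zero]
  choose l hl using hl
  have hs : ∀ X (q : Q.obj X), ∃ t : T.obj X, ∀ j (a : m j ⟶ X), e j (T.res a t) = l j (Q.res a q) :=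
    fun X q => by
      obtain ⟨t, ht⟩ := (he X).2 fun j a => l j (Q.res a q)
      exact ⟨t, fun j a => congrFun (congrFun ht j) a⟩
  choose s hs using hs
  have hinj : ∀ X (t t' : T.obj X), (∀ j (a : m j ⟶ X), e j (T.res a t) = e j (T.res a t')) → t = t' :=
    fun X t t' h => (he X).1 (funext fun j => funext fun a => h j a)
  -- A section is determined by its values at maps from models, so linearity, naturality and the
  -- extension property can all be checked there.
  refine ⟨⟨fun X => ⟨⟨s X, fun x y => ?_⟩, fun c x => ?_⟩, fun {X Y} f x => ?_⟩, fun X x => ?_⟩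
  · refine hinj _ _ _ fun j a => ?_
    simp only [hs, map_add]
  · refine hinj _ _ _ fun j a => ?_
    simp only [hs, map_smul, RingHom.id_apply]
  · refine hinj _ _ _ fun j a => ?_
    change e j (T.res a (T.res f (s X x))) = e j (T.res a (s Y (Q.res f x)))
    rw [T.res_res, hs, hs, Q.res_res]
  · refine hinj _ _ _ fun j a => ?_
    change e j (T.res a (s X (α.app X x))) = _
    rw [hs, α.naturality, hl, g.naturality]

/-- Cocycles of a complex of presheaves that come from the previous degree. -/
def boundary {P : ℕ → LinearPresheaf.{u, v, w, w'} R C} (d : ∀ n, Hom (P n) (P (n + 1))) (X : C) :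
    ∀ n, Submodule R ((P n).obj X)
  | 0 => ⊥
  | n + 1 => LinearMap.range ((d n).app X)

/-- The method of acyclic models. -/
theorem acyclic_models {P T : ℕ → LinearPresheaf.{u, v, w, w'} R C}
    (dP : ∀ n, Hom (P n) (P (n + 1))) (dT : ∀ n, Hom (T n) (T (n + 1)))
    (dT_dT : ∀ n X x, (dT (n + 1)).app X ((dT n).app X x) = 0)
    (φ : ∀ n, Hom (P n) (T n))
    (comm : ∀ n X x, (φ (n + 1)).app X ((dP n).app X x) = (dT n).app X ((φ n).app X x))
    (hT : ∀ n, IsModelInjective M (T n))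
    (hzero : ∀ m, M m → ∀ x, (dP 0).app m x = 0 → (φ 0).app m x = 0)
    (hexact : ∀ m, M m → ∀ n x, (dP (n + 1)).app m x = 0 → ∃ y, (dP n).app m y = x)
    (X : C) (n : ℕ) (x : (P n).obj X) (hx : (dP n).app X x = 0) :
    (φ n).app X x ∈ boundary dT X n := by
  obtain ⟨h0, hh0⟩ := hT 0 (P 0) (P 1) (dP 0) (φ 0) hzero
  -- One step of a null-homotopy φ = dh + hd. The weak invariant dhd = dφ is enough: at a model a
  -- cocycle is some dy, so φ - dh vanishes on it, and relative injectivity extends φ - dh along d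
  -- to the next h.
  have step : ∀ (n : ℕ) (h : Hom (P (n + 1)) (T n)),
      (∀ X x, (dT n).app X (h.app X ((dP n).app X x)) = (dT n).app X ((φ n).app X x)) →
      ∃ h' : Hom (P (n + 2)) (T (n + 1)), ∀ X x, h'.app X ((dP (n + 1)).app X x) =
        (φ (n + 1)).app X x - (dT n).app X (h.app X x) := by
    intro n h hh
    refine hT (n + 1) (P (n + 1)) (P (n + 2)) (dP (n + 1))
      ⟨fun X => (φ (n + 1)).app X - (dT n).app X ∘ₗ h.app X, fun g x => ?_⟩ ?_
    · simp only [LinearMap.sub_apply, LinearMap.comp_apply, map_sub, Hom.naturality]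
    · intro m hm x hx
      obtain ⟨y, rfl⟩ := hexact m hm n x hx
      simp only [LinearMap.sub_apply, LinearMap.comp_apply, comm, hh, sub_self]
  have key : ∀ n, ∃ h : Hom (P (n + 1)) (T n),
      ∀ X x, (dT n).app X (h.app X ((dP n).app X x)) = (dT n).app X ((φ n).app X x) := by
    intro n
    induction n with
    | zero => exact ⟨h0, fun X x => by rw [hh0]⟩
    | succ n ih =>
      obtain ⟨h, hh⟩ := ih
      obtain ⟨h', hh'⟩ := step n h hh
      exact ⟨h', fun X x => by rw [hh', map_sub, dT_dT, sub_zero]⟩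
  -- On a cocycle the term hd vanishes, which leaves φ = dh; in degree 0 it leaves φ = 0.
  cases n with
  | zero =>
    change _ = _
    rw [← hh0, hx, map_zero]
  | succ n =>
    obtain ⟨h, hh⟩ := key n
    obtain ⟨h', hh'⟩ := step n h hh
    refine ⟨h.app X x, ?_⟩
    have := hh' X x
    rw [hx, map_zero] at this
    exact (sub_eq_zero.1 this.symm).symm

section Cone

variable {F G : ℕ → LinearPresheaf.{u, v, w, w'} R C}
  (dF : ∀ n, Hom (F n) (F (n + 1))) (dG : ∀ n, Hom (G n) (G (n + 1))) (φ : ∀ n, Hom (F n) (G n))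

/-- The mapping cone of a map of complexes of presheaves. -/
def cone (F G : ℕ → LinearPresheaf.{u, v, w, w'} R C) : ℕ → LinearPresheaf.{u, v, w, w'} R C
  | 0 => F 0
  | n + 1 => (F (n + 1)).prod (G n)

/-- The differential of the mapping cone. -/
def coneD : ∀ n, Hom (cone F G n) (cone F G (n + 1))
  | 0 => ⟨fun X => ((dF 0).app X).prod ((φ 0).app X),
      fun g x => Prod.ext ((dF 0).naturality g x) ((φ 0).naturality g x)⟩
  | n + 1 => ⟨fun X => ((dF (n + 1)).app X ∘ₗ LinearMap.fst R _ _).prod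
        ((φ (n + 1)).app X ∘ₗ LinearMap.fst R _ _ - (dG n).app X ∘ₗ LinearMap.snd R _ _),
      fun g x => Prod.ext ((dF (n + 1)).naturality g x.1) (by
        change (G (n + 1)).res g ((φ (n + 1)).app _ x.1 - (dG n).app _ x.2) =
          (φ (n + 1)).app _ ((F (n + 1)).res g x.1) - (dG n).app _ ((G n).res g x.2)
        rw [map_sub, (φ _).naturality, (dG _).naturality])⟩

/-- A map of complexes is injective and surjective in cohomology at `X`. -/
structure IsQuasiIsoAt (X : C) : Prop where
  inj : ∀ n x, (dF n).app X x = 0 → (φ n).app X x ∈ boundary dG X n → x ∈ boundary dF X n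
  surj : ∀ n y, (dG n).app X y = 0 →
    ∃ x, (dF n).app X x = 0 ∧ y - (φ n).app X x ∈ boundary dG X n

/-- A map of complexes of relatively injective presheaves that is a quasi-isomorphism at all models
is a quasi-isomorphism. -/
theorem isQuasiIsoAt_of_models
    (dF_dF : ∀ n X x, (dF (n + 1)).app X ((dF n).app X x) = 0)
    (dG_dG : ∀ n X x, (dG (n + 1)).app X ((dG n).app X x) = 0)
    (comm : ∀ n X x, (φ (n + 1)).app X ((dF n).app X x) = (dG n).app X ((φ n).app X x))
    (hF : ∀ n, IsModelInjective M (F n)) (hG : ∀ n, IsModelInjective M (G n))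
    (h : ∀ m, M m → IsQuasiIsoAt dF dG φ m) (X : C) : IsQuasiIsoAt dF dG φ X := by
  have hdd : ∀ n X x, (coneD dF dG φ (n + 1)).app X ((coneD dF dG φ n).app X x) = 0 := by
    intro n X x
    cases n with
    | zero => exact Prod.ext (dF_dF 0 X x) (by
        exact sub_eq_zero.2 (comm 0 X x))
    | succ n => exact Prod.ext (dF_dF (n + 1) X x.1) (by
        change (φ (n + 2)).app X ((dF (n + 1)).app X x.1) -
          (dG (n + 1)).app X ((φ (n + 1)).app X x.1 - (dG n).app X x.2) = 0
        rw [comm, map_sub, dG_dG, sub_zero, sub_self])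
  -- At a model the cone is exact: injectivity makes the first entry a coboundary, and surjectivity
  -- corrects the primitive so that the second entry matches too.
  have hex : ∀ m, M m → ∀ n x, (coneD dF dG φ (n + 1)).app m x = 0 →
      ∃ y, (coneD dF dG φ n).app m y = x := by
    rintro m hm n ⟨x, y⟩ hxy
    have h1 : (dF (n + 1)).app m x = 0 := congrArg Prod.fst hxy
    have h2 : (φ (n + 1)).app m x = (dG n).app m y := sub_eq_zero.1 (congrArg Prod.snd hxy)
    obtain ⟨x₁, rfl⟩ := (h m hm).inj (n + 1) x h1 ⟨y, h2.symm⟩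
    obtain ⟨x₂, h3, h4⟩ := (h m hm).surj n (y - (φ n).app m x₁) (by
      rw [map_sub, ← h2, comm, sub_self])
    cases n with
    | zero =>
      refine ⟨(x₁ + x₂ : (F 0).obj m), Prod.ext ?_ ?_⟩
      · change (dF 0).app m (x₁ + x₂) = _
        rw [map_add, h3, add_zero]
      · change (φ 0).app m (x₁ + x₂) = y
        rw [map_add]
        have h5 : y - (φ 0).app m x₁ - (φ 0).app m x₂ = 0 := h4
        rw [sub_sub] at h5
        exact (sub_eq_zero.1 h5).symm
    | succ n =>
      obtain ⟨t, ht⟩ := h4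
      refine ⟨((x₁ + x₂, -t) : (F (n + 1)).obj m × (G n).obj m), Prod.ext ?_ ?_⟩
      · change (dF (n + 1)).app m (x₁ + x₂) = _
        rw [map_add, h3, add_zero]
      · change (φ (n + 1)).app m (x₁ + x₂) - (dG n).app m (-t) = y
        rw [map_add, map_neg, ht]
        abel
  -- Acyclic models for the identity of the cone: the cone is exact at every object, and not only at
  -- the models.
  have main := acyclic_models (M := M) (coneD dF dG φ) (coneD dF dG φ) hdd
    (fun n => ⟨fun X => LinearMap.id, fun _ _ => rfl⟩) (fun _ _ _ => rfl)
    (fun n => by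
      cases n with
      | zero => exact hF 0
      | succ n => exact (hF (n + 1)).prod (hG n))
    (fun m hm x hx => (h m hm).inj 0 x (congrArg Prod.fst hx) (congrArg Prod.snd hx))
    hex X
  -- Injectivity comes from the cone cocycles (x, y) with φx = dy, surjectivity from the cone
  -- cocycles (0, y).
  constructor
  · intro n x hx hφ
    cases n with
    | zero => exact main 0 x (Prod.ext hx hφ)
    | succ n =>
      obtain ⟨y, hy⟩ := hφ
      obtain ⟨z, hz⟩ := main (n + 1) ((x, y) : (F (n + 1)).obj X × (G n).obj X)
        (Prod.ext hx (sub_eq_zero.2 hy.symm))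
      cases n with
      | zero => exact ⟨z, congrArg Prod.fst hz⟩
      | succ n => exact ⟨z.1, congrArg Prod.fst hz⟩
  · intro n y hy
    obtain ⟨z, hz⟩ := main (n + 1) ((0, y) : (F (n + 1)).obj X × (G n).obj X) (Prod.ext (map_zero ((dF (n + 1)).app X)) (by
      change (φ (n + 1)).app X 0 - (dG n).app X y = 0
      rw [hy, map_zero, sub_zero]))
    cases n with
    | zero =>
      refine ⟨z, congrArg Prod.fst hz, ?_⟩
      rw [show (φ 0).app X z = y from congrArg Prod.snd hz, sub_self]
      exact Submodule.zero_mem _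
    | succ n =>
      refine ⟨z.1, congrArg Prod.fst hz, -z.2, ?_⟩
      have h1 : (φ (n + 1)).app X z.1 - (dG n).app X z.2 = y := congrArg Prod.snd hz
      rw [map_neg, ← h1]
      abel

end Cone

end LinearPresheaf

end AcyclicModels

end Halving

namespace Halving

open CategoryTheory Simplicial Opposite

/-! ### Vector-valued cochains and contractions of simplices -/

section VectorCochains

variable (R : Type v) [CommRing R] (S : SSet.{u}) (V : Type w) [AddCommGroup V] [Module R V]

/-- The coboundary of cochains with values in a module. -/
def vcoboundary (n : ℕ) : (S _⦋n⦌ → V) →ₗ[R] (S _⦋n + 1⦌ → V) where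
  toFun f := fun s => ∑ i : Fin (n + 2), (-1 : R) ^ (i : ℕ) • f (S.δ i s)
  map_add' f g := by
    funext s
    simp [Finset.sum_add_distrib]
  map_smul' c f := by
    funext s
    simp [Finset.smul_sum, smul_comm c]

variable {R S V}

lemma vcoboundary_apply {n : ℕ} (f : S _⦋n⦌ → V) (s : S _⦋n + 1⦌) :
    vcoboundary R S V n f s = ∑ i : Fin (n + 2), (-1 : R) ^ (i : ℕ) • f (S.δ i s) := rfl

/-- The faces indexed by (i, j) with i ≤ j cancel against those indexed by (j + 1, i), by the
simplicial identity. -/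
lemma vcoboundary_vcoboundary {n : ℕ} (f : S _⦋n⦌ → V) :
    vcoboundary R S V (n + 1) (vcoboundary R S V n f) = 0 := by
  funext s
  simp only [vcoboundary_apply, Finset.smul_sum, ← Finset.sum_product', smul_smul]
  change _ = (0 : V)
  let P := Fin (n + 3) × Fin (n + 2)
  let A : Finset P := Finset.univ.filter fun ij => (ij.1 : ℕ) ≤ (ij.2 : ℕ)
  rw [Finset.univ_product_univ, ← Finset.sum_add_sum_compl A, ← eq_neg_iff_add_eq_zero,
    ← Finset.sum_neg_distrib]
  let φ : ∀ ij : P, ij ∈ A → P := fun ij hij =>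
    (ij.2.succ, Fin.castLT ij.1 (lt_of_le_of_lt (Finset.mem_filter.mp hij).right (Fin.is_lt ij.2)))
  apply Finset.sum_bij φ
  · intro ij hij
    simp_rw [A, φ, Finset.compl_filter, Finset.mem_filter_univ, Fin.val_succ,
      Fin.val_castLT] at hij ⊢
    omega
  · rintro ⟨i, j⟩ hij ⟨i', j'⟩ hij' h
    rw [Prod.mk_inj]
    exact ⟨by simpa [φ, Fin.castSucc_castLT] using! congr_arg Fin.castSucc (congr_arg Prod.snd h),
      by simpa [φ] using! congr_arg Prod.fst h⟩
  · rintro ⟨i', j'⟩ hij'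
    simp_rw [A, Finset.compl_filter, Finset.mem_filter_univ, not_le] at hij'
    refine ⟨(Fin.castSucc j', i'.pred <| ?_), ?_, ?_⟩
    · rintro rfl
      simp only [Fin.val_zero, not_lt_zero] at hij'
    · simpa [A] using! Nat.le_sub_one_of_lt hij'
    · simp only [φ, Fin.castLT_castSucc, Fin.succ_pred]
  · rintro ⟨i, j⟩ hij
    have hij' : i ≤ Fin.castSucc j := by simpa [A] using! hij
    dsimp only [φ]
    rw [← neg_smul]
    congr 1
    · simp only [Fin.val_succ, Fin.val_castLT]
      ring
    · rw [SSet.δ_comp_δ''_apply hij']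

lemma coboundary_coboundary {n : ℕ} (f : Cochain R S n) :
    coboundary R S (n + 1) (coboundary R S n f) = 0 :=
  vcoboundary_vcoboundary f

/-- An extra degeneracy: a cone operator on a simplicial set. -/
structure ConeOperator (S : SSet.{u}) where
  pt : S _⦋0⦌
  cone : ∀ n, S _⦋n⦌ → S _⦋n + 1⦌
  δ_castSucc : ∀ n (i : Fin (n + 2)) (s : S _⦋n + 1⦌),
    S.δ i.castSucc (cone (n + 1) s) = cone n (S.δ i s)
  δ_last : ∀ n (s : S _⦋n⦌), S.δ (Fin.last (n + 1)) (cone n s) = s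
  δ_zero : ∀ s : S _⦋0⦌, S.δ 0 (cone 0 s) = pt

/-- The edge `c.cone 0 s` joins the cone point to `s`, and a closed cochain has equal values at its
two ends. -/
lemma ConeOperator.eq_of_vcoboundary_eq_zero (c : ConeOperator S) (f : S _⦋0⦌ → V)
    (hf : vcoboundary R S V 0 f = 0) (s : S _⦋0⦌) : f s = f c.pt := by
  have h := congrFun hf (c.cone 0 s)
  rw [vcoboundary_apply, Fin.sum_univ_two] at h
  have h1 : S.δ 1 (c.cone 0 s) = s := c.δ_last 0 s
  rw [h1, c.δ_zero] at h
  simp only [Fin.val_zero, pow_zero, one_smul, Fin.val_one, pow_one, neg_smul] at h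
  exact (sub_eq_zero.1 ((sub_eq_add_neg _ _).trans h)).symm

/-- Composition with the cone is a contraction, since all faces of a cone but the last are cones of
faces. The last face, of index n + 2, is the simplex itself; the sign compensates for this. -/
lemma ConeOperator.exists_vcoboundary_eq (c : ConeOperator S) {n : ℕ} (f : S _⦋n + 1⦌ → V)
    (hf : vcoboundary R S V (n + 1) f = 0) : ∃ g, vcoboundary R S V n g = f := by
  refine ⟨fun s => (-1 : R) ^ (n + 1) • f (c.cone n s), ?_⟩
  funext s
  have h := congrFun hf (c.cone (n + 1) s)
  rw [vcoboundary_apply, Fin.sum_univ_castSucc, c.δ_last] at h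
  simp only [c.δ_castSucc, Fin.val_castSucc, Fin.val_last] at h
  rw [vcoboundary_apply]
  simp only [smul_comm _ ((-1 : R) ^ (n + 1))]
  rw [← Finset.smul_sum, eq_neg_of_add_eq_zero_left h, ← smul_neg, smul_smul, ← pow_add,
    show n + 1 + (n + 1 + 1) = 2 * (n + 1) + 1 by ring, pow_succ, pow_mul]
  simp

/-- Extension of a simplex of `Δ[m]` by the last vertex. -/
def coneHom {n : ℕ} (m : ℕ) (θ : ⦋n⦌ ⟶ ⦋m⦌) : ⦋n + 1⦌ ⟶ ⦋m⦌ :=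
  SimplexCategory.mkHom
    { toFun := Fin.snoc (α := fun _ => Fin (m + 1)) (fun i => θ i) (Fin.last m)
      monotone' := by
        intro i j hij
        induction j using Fin.lastCases with
        | last => simpa using! Fin.le_last _
        | cast j =>
          induction i using Fin.lastCases with
          | last =>
            have := Fin.le_def.1 hij
            simp at this
            omega
          | cast i =>
            simpa using! θ.toOrderHom.monotone (Fin.castSucc_le_castSucc_iff.1 hij) }

lemma coneHom_castSucc {n m : ℕ} (θ : ⦋n⦌ ⟶ ⦋m⦌) (i : Fin (n + 1)) :
    coneHom m θ i.castSucc = θ i :=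
  Fin.snoc_castSucc (α := fun _ => Fin (m + 1)) _ _ _

lemma coneHom_last {n m : ℕ} (θ : ⦋n⦌ ⟶ ⦋m⦌) : coneHom m θ (Fin.last (n + 1)) = Fin.last m :=
  Fin.snoc_last (α := fun _ => Fin (m + 1)) _ _

lemma δ_coneHom_castSucc {n m : ℕ} (i : Fin (n + 2)) (θ : ⦋n + 1⦌ ⟶ ⦋m⦌) :
    SimplexCategory.δ i.castSucc ≫ coneHom m θ = coneHom m (SimplexCategory.δ i ≫ θ) := by
  refine hom_ext_val fun x => congrArg Fin.val ?_
  change coneHom m θ (i.castSucc.succAbove x) = _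
  induction x using Fin.lastCases with
  | last =>
    rw [coneHom_last, Fin.succAbove_ne_last_last (Fin.castSucc_lt_last i).ne, coneHom_last]
  | cast x =>
    rw [coneHom_castSucc, Fin.castSucc_succAbove_castSucc, coneHom_castSucc]
    rfl

lemma δ_coneHom_last {n m : ℕ} (θ : ⦋n⦌ ⟶ ⦋m⦌) :
    SimplexCategory.δ (Fin.last (n + 1)) ≫ coneHom m θ = θ := by
  refine hom_ext_val fun x => congrArg Fin.val ?_
  change coneHom m θ ((Fin.last (n + 1)).succAbove x) = _
  rw [Fin.succAbove_last, coneHom_castSucc]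

/-- Both sides are the last vertex. This is why the vertex used for `pt` in `simplexCone` may be
arbitrary. -/
lemma δ_zero_coneHom {m : ℕ} (θ θ' : ⦋0⦌ ⟶ ⦋m⦌) :
    SimplexCategory.δ 0 ≫ coneHom m θ = SimplexCategory.δ 0 ≫ coneHom m θ' := by
  refine hom_ext_val fun x => congrArg Fin.val ?_
  obtain rfl : x = 0 := Fin.fin_one_eq_zero x
  exact (coneHom_last θ).trans (coneHom_last θ').symm

/-- The cone operator of a simplex with respect to its last vertex. -/
def simplexCone (m : ℕ) : ConeOperator (Δ[m] : SSet.{u}) where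
  pt := SSet.stdSimplex.objEquiv.symm (SimplexCategory.δ 0 ≫ coneHom m (SimplexCategory.const _ _ 0))
  cone _ s := SSet.stdSimplex.objEquiv.symm (coneHom m (SSet.stdSimplex.objEquiv s))
  δ_castSucc _ i _ := congrArg SSet.stdSimplex.objEquiv.symm (δ_coneHom_castSucc i _)
  δ_last _ _ := congrArg SSet.stdSimplex.objEquiv.symm (δ_coneHom_last _)
  δ_zero _ := congrArg SSet.stdSimplex.objEquiv.symm (δ_zero_coneHom _ _)

end VectorCochains

/-! ### Cochains as relatively injective presheaves over a base -/

section Presheaves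

variable (R : Type v) [CommRing R] {C : Type w'} [Category.{u} C]

/-- The presheaf of `V`-valued `n`-cochains. -/
def cochainPresheaf (Φ : C ⥤ SSet.{u}) (V : Type w) [AddCommGroup V] [Module R V] (n : ℕ) :
    LinearPresheaf.{u, v, max u w, w'} R C where
  obj X := (Φ.obj X) _⦋n⦌ → V
  res g := LinearMap.funLeft R V ((Φ.map g).app (op ⦋n⦌))
  res_res g h x := by
    funext s
    change x ((Φ.map g).app _ ((Φ.map h).app _ s)) = x ((Φ.map (h ≫ g)).app _ s)
    rw [Φ.map_comp]
    rfl

/-- The coboundary as a map of presheaves. -/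
def cochainD (Φ : C ⥤ SSet.{u}) (V : Type w) [AddCommGroup V] [Module R V] (n : ℕ) :
    LinearPresheaf.Hom (cochainPresheaf R Φ V n) (cochainPresheaf R Φ V (n + 1)) where
  app X := vcoboundary R (Φ.obj X) V n
  naturality {X Y} g x := by
    funext s
    change ∑ i : Fin (n + 2), (-1 : R) ^ (i : ℕ) • x ((Φ.obj X).δ i ((Φ.map g).app _ s)) =
      ∑ i : Fin (n + 2), (-1 : R) ^ (i : ℕ) • x ((Φ.map g).app _ ((Φ.obj Y).δ i s))
    refine Finset.sum_congr rfl fun i _ => ?_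
    congr 2
    exact (app_map (Φ.map g) _ s).symm

/-- If the n-simplices are freely generated by universal simplices `ε j` on models, a cochain is the
same as a family of values at the maps from these models. -/
lemma isModelInjective_cochainPresheaf {k : Type v} [Field k] {M : C → Prop} {Φ : C ⥤ SSet.{u}}
    {V : Type w} [AddCommGroup V] [Module k V] {n : ℕ} {J : Type*} (m : J → C)
    (hm : ∀ j, M (m j)) (ε : ∀ j, (Φ.obj (m j)) _⦋n⦌)
    (h : ∀ X, Function.Bijective
      fun a : Σ j, m j ⟶ X => (Φ.map a.2).app (op ⦋n⦌) (ε a.1)) :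
    LinearPresheaf.IsModelInjective M (cochainPresheaf k Φ V n) := by
  refine LinearPresheaf.isModelInjective_of_bijective m hm (fun _ => V)
    (fun j => LinearMap.proj (ε j)) fun X => ⟨fun t t' ht => ?_, fun s => ?_⟩
  · funext x
    obtain ⟨⟨j, a⟩, rfl⟩ := (h X).2 x
    exact congrFun (congrFun ht j) a
  · let e := Equiv.ofBijective _ (h X)
    refine ⟨fun x => s (e.symm x).1 (e.symm x).2, ?_⟩
    funext j a
    have : e.symm ((Φ.map a).app (op ⦋n⦌) (ε j)) = ⟨j, a⟩ := (e.symm_apply_eq).2 rfl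
    change s (e.symm ((Φ.map a).app (op ⦋n⦌) (ε j))).1 (e.symm ((Φ.map a).app (op ⦋n⦌) (ε j))).2 = _
    rw [this]

end Presheaves

section Pullback

variable {B E : SSet.{u}}

/-- The pullback of `p : E ⟶ B` along maps to `B`. -/
def pullbackFunctor (p : E ⟶ B) : Over B ⥤ SSet.{u} where
  obj X :=
    { obj := fun n => {x : X.left.obj n × E.obj n // X.hom.app n x.1 = p.app n x.2}
      map := fun {n n'} f => ↾ fun x => ⟨(X.left.map f x.1.1, E.map f x.1.2), by
        have h1 := app_map X.hom f.unop x.1.1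
        have h2 := app_map p f.unop x.1.2
        exact h1.trans ((congrArg _ x.2).trans h2.symm)⟩
      map_id := fun n => by
        refine ConcreteCategory.hom_ext _ _ fun x => Subtype.ext (Prod.ext ?_ ?_) <;> simp
      map_comp := fun f g => by
        refine ConcreteCategory.hom_ext _ _ fun x => Subtype.ext (Prod.ext ?_ ?_) <;> simp }
  map {X Y} g :=
    { app := fun n => ↾ fun x => ⟨(g.left.app n x.1.1, x.1.2), by
        exact (congrArg (fun f : X.left ⟶ B => f.app n x.1.1) (Over.w g)).trans x.2⟩
      naturality := fun n n' f => by
        refine ConcreteCategory.hom_ext _ _ fun x => ?_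
        apply Subtype.ext
        exact Prod.ext (app_map g.left f.unop x.1.1) rfl }
  map_id X := rfl
  map_comp f g := rfl

/-- The projection of the pullback to `E`. -/
def pullbackSnd (p : E ⟶ B) (X : Over B) : (pullbackFunctor p).obj X ⟶ E where
  app _ := ↾ fun x => x.1.2
  naturality _ _ _ := rfl

/-- The projection of the pullback to the base. -/
def pullbackFst (p : E ⟶ B) (X : Over B) : (pullbackFunctor p).obj X ⟶ X.left where
  app _ := ↾ fun x => x.1.1
  naturality _ _ _ := rfl

/-- A simplex of `B` as an object over `B`. -/
def simplexOver {n : ℕ} (b : B _⦋n⦌) : Over B := Over.mk (SSet.yonedaEquiv.symm b : Δ[n] ⟶ B)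

/-- The simplices of `B` among the objects over `B`. -/
def IsSimplex (X : Over B) : Prop := ∃ (n : ℕ) (b : B _⦋n⦌), X = simplexOver b

/-- A simplex of an object over `B` as a map over `B`. -/
def simplexHom {n : ℕ} {b : B _⦋n⦌} {X : Over B} (a : X.left _⦋n⦌) (h : X.hom.app _ a = b) :
    simplexOver b ⟶ X :=
  Over.homMk (SSet.yonedaEquiv.symm a) (by
    subst h
    exact SSet.yonedaEquiv_symm_comp _ _)

/-- The identity of `⦋n⦌` as a simplex of `Δ[n]`. -/
def topSimplex (n : ℕ) : (Δ[n] : SSet.{u}) _⦋n⦌ := SSet.stdSimplex.objEquiv.symm (𝟙 _)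

lemma simplexHom_topSimplex {n : ℕ} {b : B _⦋n⦌} {X : Over B} (a : X.left _⦋n⦌)
    (h : X.hom.app _ a = b) : (simplexHom a h).left.app _ (topSimplex n) = a := by
  change X.left.map (𝟙 _) a = a
  simp

lemma eq_simplexHom {n : ℕ} {b : B _⦋n⦌} {X : Over B} (f : simplexOver b ⟶ X) :
    ∃ h, f = simplexHom (f.left.app _ (topSimplex n)) h := by
  have h : X.hom.app _ (f.left.app _ (topSimplex n)) = b := by
    have := Over.w f
    change (f.left ≫ X.hom).app _ (topSimplex n) = b
    rw [this]
    change B.map (𝟙 _) b = b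
    simp
  refine ⟨h, ?_⟩
  ext1
  exact (SSet.yonedaEquiv.symm_apply_apply f.left).symm

lemma simplexOver_hom_topSimplex {n : ℕ} (b : B _⦋n⦌) :
    (simplexOver b).hom.app _ (topSimplex n) = b := by
  change B.map (𝟙 _) b = b
  simp

variable {k : Type v} [Field k]

/-- By the Yoneda lemma an n-simplex of X over B is an n-simplex b of B together with a map from b
to X over B. -/
lemma isModelInjective_forget {V : Type w} [AddCommGroup V] [Module k V] (n : ℕ) :
    LinearPresheaf.IsModelInjective IsSimplex
      (cochainPresheaf k (Over.forget B) V n) := by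
  refine isModelInjective_cochainPresheaf (J := B _⦋n⦌) simplexOver (fun b => ⟨n, b, rfl⟩)
    (fun _ => topSimplex n) fun X => ⟨?_, fun a => ?_⟩
  · rintro ⟨b, f⟩ ⟨b', f'⟩ h
    change f.left.app _ (topSimplex n) = f'.left.app _ (topSimplex n) at h
    obtain ⟨h1, h2⟩ := eq_simplexHom f
    obtain ⟨h3, h4⟩ := eq_simplexHom f'
    obtain rfl : b = b' := by rw [← h1, ← h3, h]
    congr 1
    rw [h2, h4]
    congr 1
  · exact ⟨⟨X.hom.app _ a, simplexHom a rfl⟩, simplexHom_topSimplex a rfl⟩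

/-- An n-simplex of the pullback of E to X is an n-simplex e of E together with a map over B from
the simplex p(e) to X. So the simplices of B are also models for cochains of the total space, and p
need not be a fibration. -/
lemma isModelInjective_pullback (p : E ⟶ B) {V : Type w} [AddCommGroup V] [Module k V]
    (n : ℕ) :
    LinearPresheaf.IsModelInjective IsSimplex (cochainPresheaf k (pullbackFunctor p) V n) := by
  refine isModelInjective_cochainPresheaf (J := E _⦋n⦌) (fun e => simplexOver (p.app _ e))
    (fun b => ⟨n, _, rfl⟩) (fun e => ⟨(topSimplex n, e), simplexOver_hom_topSimplex _⟩)
    fun X => ⟨?_, fun a => ?_⟩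
  · rintro ⟨e, f⟩ ⟨e', f'⟩ h
    have h5 : e = e' := congrArg (fun x => x.1.2) h
    subst h5
    have h6 : f.left.app _ (topSimplex n) = f'.left.app _ (topSimplex n) :=
      congrArg (fun x => x.1.1) h
    obtain ⟨h1, h2⟩ := eq_simplexHom f
    obtain ⟨h3, h4⟩ := eq_simplexHom f'
    congr 1
    rw [h2, h4]
    congr 1
  · exact ⟨⟨a.1.2, simplexHom a.1.1 a.2⟩,
      Subtype.ext (Prod.ext (simplexHom_topSimplex a.1.1 a.2) rfl)⟩

end Pullback

end Halving

namespace Halving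

open CategoryTheory Simplicial Opposite

section Functoriality

variable {R : Type v} [CommRing R] {S T U : SSet.{u}}

lemma cochainMap_comp (f : S ⟶ T) (g : T ⟶ U) (n : ℕ) (x : Cochain R U n) :
    cochainMap (f ≫ g) n x = cochainMap f n (cochainMap g n x) := rfl

lemma scohomologyMap_comp (f : S ⟶ T) (g : T ⟶ U) (n : ℕ) (x : SCohomology R U n) :
    scohomologyMap R (f ≫ g) n x = scohomologyMap R f n (scohomologyMap R g n x) := by
  obtain ⟨x, rfl⟩ := cls_surjective n x
  rfl

lemma scohomologyMap_id (n : ℕ) (x : SCohomology R S n) : scohomologyMap R (𝟙 S) n x = x := by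
  obtain ⟨x, rfl⟩ := cls_surjective n x
  rfl

lemma scohomologyMap_bijective_of_isIso (f : S ⟶ T) [IsIso f] (n : ℕ) :
    Function.Bijective (scohomologyMap R f n) := by
  refine Function.bijective_iff_has_inverse.2 ⟨scohomologyMap R (inv f) n, fun x => ?_, fun x => ?_⟩
  · rw [← scohomologyMap_comp, IsIso.inv_hom_id, scohomologyMap_id]
  · rw [← scohomologyMap_comp, IsIso.hom_inv_id, scohomologyMap_id]

lemma cls_eq_iff {n : ℕ} (a b : cocycles R S n) :
    cls R S n a = cls R S n b ↔ (a : Cochain R S n) - b ∈ coboundaries R S n := by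
  rw [← sub_eq_zero, ← map_sub, cls_eq_zero]
  rfl

/-- A map between simplicial sets with cone operators is a quasi-isomorphism. -/
lemma ConeOperator.mem_coboundaries_of_map (c : ConeOperator S) (f : T ⟶ S) (t : T _⦋0⦌) (n : ℕ)
    (x : Cochain R S n) (hx : coboundary R S n x = 0)
    (hf : cochainMap f n x ∈ coboundaries R T n) : x ∈ coboundaries R S n := by
  cases n with
  | zero =>
    have h0 : ∀ s, x s = x c.pt := c.eq_of_vcoboundary_eq_zero x hx
    have h1 : x (f.app _ t) = 0 := congrFun (show cochainMap f 0 x = 0 from hf) t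
    change x = 0
    funext s
    rw [h0, ← h0 (f.app _ t), h1]
    rfl
  | succ n => exact c.exists_vcoboundary_eq x hx

/-- A 0-cocycle on `T` is constant, hence pulled back from a constant; in positive degrees every
cocycle is a coboundary and the witness is 0. -/
lemma ConeOperator.exists_cocycle (c : ConeOperator T) (f : T ⟶ S) (n : ℕ)
    (y : Cochain R T n) (hy : coboundary R T n y = 0) :
    ∃ x, coboundary R S n x = 0 ∧ y - cochainMap f n x ∈ coboundaries R T n := by
  cases n with
  | zero =>
    refine ⟨fun _ => y c.pt, ?_, ?_⟩
    · have := coboundary_cocycle (y c.pt • oneCocycle R S)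
      convert! this using 2
      funext s
      exact (mul_one _).symm
    · change _ = _
      funext s
      exact sub_eq_zero.2 (c.eq_of_vcoboundary_eq_zero y hy s)
  | succ n =>
    refine ⟨0, map_zero _, ?_⟩
    rw [map_zero, sub_zero]
    exact c.exists_vcoboundary_eq y hy

end Functoriality

/-! ### Graded commutativity of the cup product -/

section Commutativity

variable {R : Type v} [Field R] {S : SSet.{u}}

/-- The graded commutator with a cochain. -/
def commutatorCochain {T : SSet.{u}} {q : ℕ} (b : Cochain R T q) (n : ℕ) :
    Cochain R T n →ₗ[R] Cochain R T (q + n) :=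
  (cupCochain (add_comm n q)).flip b - (-1 : R) ^ (n * q) • cupCochain rfl b

lemma commutatorCochain_apply {T : SSet.{u}} {q : ℕ} (b : Cochain R T q) {n : ℕ}
    (x : Cochain R T n) : commutatorCochain b n x =
      cupCochain (add_comm n q) x b - (-1 : R) ^ (n * q) • cupCochain rfl b x := rfl

lemma cupCochain_cochainMap {T U : SSet.{u}} (f : T ⟶ U) {p q n : ℕ} (h : p + q = n)
    (a : Cochain R U p) (b : Cochain R U q) :
    cupCochain h (cochainMap f p a) (cochainMap f q b) = cochainMap f n (cupCochain h a b) := by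
  funext s
  change a (f.app _ (front p _ s)) * b (f.app _ (back p q _ s)) =
    a (front p _ (f.app _ s)) * b (back p q _ (f.app _ s))
  rw [front, back, front, back, app_map, app_map]

lemma commutatorCochain_cochainMap {T U : SSet.{u}} (f : T ⟶ U) {q : ℕ} (b : Cochain R U q)
    {n : ℕ} (x : Cochain R U n) :
    cochainMap f (q + n) (commutatorCochain b n x) =
      commutatorCochain (cochainMap f q b) n (cochainMap f n x) := by
  simp only [commutatorCochain_apply, map_sub, map_smul, cupCochain_cochainMap]

/-- The Leibniz sign (-1)^q is absorbed by passing from nq to (n+1)q in the commutator, so this is a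
cochain map without signs. The degree is written `q + n` so that `q + (n + 1)` is its successor by
definition. -/
lemma coboundary_commutatorCochain {T : SSet.{u}} {q : ℕ} (b : Cochain R T q)
    (hb : coboundary R T q b = 0) {n : ℕ} (x : Cochain R T n) :
    commutatorCochain b (n + 1) (coboundary R T n x) =
      coboundary R T (q + n) (commutatorCochain b n x) := by
  have h1 := coboundary_cup (add_comm n q) x b
  have h2 := coboundary_cup (rfl : q + n = q + n) b x
  rw [hb, map_zero, smul_zero, add_zero] at h1
  rw [hb, map_zero, LinearMap.zero_apply, zero_add] at h2
  rw [commutatorCochain_apply, commutatorCochain_apply, map_sub, map_smul, h1, h2, smul_smul,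
    ← pow_add, add_mul, one_mul]

/-- The initial condition of acyclic models: on a simplex a 0-cocycle is constant, and constants
commute with every cochain. -/
lemma commutatorCochain_const {T : SSet.{u}} {q : ℕ} (b : Cochain R T q) (x : Cochain R T 0)
    (r : R) (hx : ∀ t, x t = r) : commutatorCochain b 0 x = 0 := by
  funext t
  change x (front 0 _ t) * b (back 0 q (by omega) t) -
    (-1 : R) ^ (0 * q) * (b (front q le_rfl t) * x (back q 0 _ t)) = (0 : R)
  rw [hx, hx, front_self, show back 0 q (by omega) t = t from back_self (n := q) t]
  ring

/-- The commutator with a cocycle, as a map of presheaves on the simplicial sets over `S`. -/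
def commutator {q : ℕ} (b : cocycles R S q) (n : ℕ) :
    LinearPresheaf.Hom (cochainPresheaf R (Over.forget S) R n)
      (cochainPresheaf R (Over.forget S) R (q + n)) where
  app X := commutatorCochain (T := X.left) (cochainMap X.hom q b) n
  naturality {X Y} g x := by
    have hb : cochainMap Y.hom q (b : Cochain R S q) =
        cochainMap g.left q (cochainMap X.hom q (b : Cochain R S q)) := by
      rw [← cochainMap_comp, Over.w]
    rw [hb]
    exact commutatorCochain_cochainMap g.left _ x

/-- Graded commutativity of the cup product. -/
theorem cup_graded_comm {p q n : ℕ} (h : p + q = n) (h' : q + p = n) (a : SCohomology R S p)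
    (b : SCohomology R S q) : cup h a b = (-1 : R) ^ (p * q) • cup h' b a := by
  obtain ⟨a, rfl⟩ := cls_surjective p a
  obtain ⟨b, rfl⟩ := cls_surjective q b
  subst h'
  rw [cup_cls, cup_cls, ← map_smul, cls_eq_iff]
  -- With b fixed, the commutator is natural over S in the other argument. Acyclic models provide
  -- the homotopy, so no explicit formula for it is needed; the result is read off at the identity
  -- of S.
  have key := LinearPresheaf.acyclic_models (M := IsSimplex)
    (P := fun n => cochainPresheaf R (Over.forget S) R n)
    (T := fun n => cochainPresheaf R (Over.forget S) R (q + n))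
    (fun n => cochainD R (Over.forget S) R n) (fun n => cochainD R (Over.forget S) R (q + n))
    (fun n X x => coboundary_coboundary x) (commutator b)
    (fun n X x => coboundary_commutatorCochain _
      ((coboundary_cochainMap X.hom q b.1).trans
        ((congrArg _ (coboundary_cocycle b)).trans (map_zero _))) x)
    (fun n => isModelInjective_forget _)
    (by
      rintro _ ⟨m, s, rfl⟩ x hx
      exact commutatorCochain_const _ x _ ((simplexCone m).eq_of_vcoboundary_eq_zero x hx))
    (by
      rintro _ ⟨m, s, rfl⟩ n x hx
      exact (simplexCone m).exists_vcoboundary_eq x hx)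
    (Over.mk (𝟙 S)) p a.1 a.2
  cases p with
  -- The target complex starts in degree q, so for p = 0 the result is that the commutator is zero
  -- as a cochain.
  | zero =>
    convert! Submodule.zero_mem _
  | succ p => exact key

end Commutativity

/-! ### Products with a simplex -/

section Product

open MonoidalCategory CartesianMonoidalCategory

variable {R : Type v} [Field R]

/-- The cone operator of the pullback of the projection of a product with a simplex. -/
def productCone (m : ℕ) (S : SSet.{u}) {l : ℕ} (b : S _⦋l⦌) :
    ConeOperator ((pullbackFunctor (snd (Δ[m] : SSet.{u}) S)).obj (simplexOver b)) where
  pt := ⟨((simplexCone l).pt, ((simplexCone m).pt, (simplexOver b).hom.app _ (simplexCone l).pt)), rfl⟩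
  cone n s := ⟨((simplexCone l).cone n s.1.1, ((simplexCone m).cone n s.1.2.1,
    (simplexOver b).hom.app _ ((simplexCone l).cone n s.1.1))), rfl⟩
  δ_castSucc n i s := by
    have h := (simplexCone l).δ_castSucc n i s.1.1
    refine Subtype.ext (Prod.ext h (Prod.ext ((simplexCone m).δ_castSucc n i s.1.2.1) ?_))
    exact (app_map (simplexOver b).hom _ _).symm.trans (congrArg _ h)
  δ_last n s := by
    have h := (simplexCone l).δ_last n s.1.1
    refine Subtype.ext (Prod.ext h (Prod.ext ((simplexCone m).δ_last n s.1.2.1) ?_))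
    exact (app_map (simplexOver b).hom _ _).symm.trans ((congrArg _ h).trans s.2)
  δ_zero s := by
    have h := (simplexCone l).δ_zero s.1.1
    refine Subtype.ext (Prod.ext h (Prod.ext ((simplexCone m).δ_zero s.1.2.1) ?_))
    exact (app_map (simplexOver b).hom _ _).symm.trans (congrArg _ h)

/-- The section of the pullback along the identity. -/
def toPullback {E B : SSet.{u}} (p : E ⟶ B) : E ⟶ (pullbackFunctor p).obj (Over.mk (𝟙 B)) where
  app n := ↾ fun e => ⟨(p.app n e, e), rfl⟩
  naturality n n' f := by
    refine ConcreteCategory.hom_ext _ _ fun x => ?_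
    apply Subtype.ext
    exact Prod.ext (app_map p f.unop x) rfl

/-- Over a simplex of S the pullback of the product is a product of two simplices, which is
contractible by `productCone`. Hence the projection is a quasi-isomorphism at all models, and so
over the identity of S. This is the only form of homotopy invariance needed. -/
lemma scohomologyMap_snd_bijective (m : ℕ) (S : SSet.{u}) (n : ℕ) :
    Function.Bijective (scohomologyMap R (snd (Δ[m] : SSet.{u}) S) n) := by
  set p := snd (Δ[m] : SSet.{u}) S with hp
  have key := LinearPresheaf.isQuasiIsoAt_of_models (M := IsSimplex)
    (F := fun n => cochainPresheaf R (Over.forget S) R n)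
    (G := fun n => cochainPresheaf R (pullbackFunctor p) R n)
    (fun n => cochainD R (Over.forget S) R n) (fun n => cochainD R (pullbackFunctor p) R n)
    (fun n => ⟨fun X => cochainMap (pullbackFst p X) n, fun g x => rfl⟩)
    (fun n X x => coboundary_coboundary x) (fun n X x => coboundary_coboundary x)
    (fun n X x => (coboundary_cochainMap (pullbackFst p X) n x).symm)
    (fun n => isModelInjective_forget _) (fun n => isModelInjective_pullback p _)
    (by
      rintro _ ⟨l, b, rfl⟩
      constructor
      · intro n x hx h
        have := (simplexCone l).mem_coboundaries_of_map (pullbackFst p (simplexOver b))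
          (productCone m S b).pt n x hx (by cases n <;> exact h)
        cases n <;> exact this
      · intro n y hy
        obtain ⟨x, hx, h⟩ := (productCone m S b).exists_cocycle (pullbackFst p (simplexOver b)) n y hy
        exact ⟨x, hx, by cases n <;> exact h⟩)
    (Over.mk (𝟙 S))
  have hfst : toPullback p ≫ pullbackFst p (Over.mk (𝟙 S)) = p := rfl
  have hfst' : pullbackSnd p (Over.mk (𝟙 S)) ≫ p = pullbackFst p (Over.mk (𝟙 S)) := by
    ext n x
    exact x.2.symm
  constructor
  · rw [injective_iff_map_eq_zero]
    intro x hx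
    obtain ⟨x, rfl⟩ := cls_surjective n x
    rw [scohomologyMap_cls, cls_eq_zero] at hx
    have h1 := cochainMap_mem (pullbackSnd p (Over.mk (𝟙 S))) n _ hx
    change cochainMap _ n (cochainMap p n x.1) ∈ _ at h1
    rw [← cochainMap_comp, hfst'] at h1
    have h2 := key.inj n x.1 x.2 (by cases n <;> exact h1)
    rw [cls_eq_zero]
    cases n <;> exact h2
  · intro y
    obtain ⟨y, rfl⟩ := cls_surjective n y
    obtain ⟨x, hx, h⟩ := key.surj n (cochainMap (pullbackSnd p (Over.mk (𝟙 S))) n y.1)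
      ((coboundary_cochainMap _ n _).trans
        ((congrArg _ (coboundary_cocycle y)).trans (map_zero _)))
    refine ⟨cls R S n ⟨x, hx⟩, ?_⟩
    rw [scohomologyMap_cls, eq_comm, cls_eq_iff]
    refine cochainMap_mem (toPullback p) n (cochainMap (pullbackSnd p (Over.mk (𝟙 S))) n y.1 -
      cochainMap (pullbackFst p (Over.mk (𝟙 S))) n x) ?_
    cases n <;> exact h

end Product

end Halving

namespace Halving

open CategoryTheory Simplicial Opposite

/-! ### The Leray–Hirsch comparison map on cochains -/

section TwistedCup

variable {R : Type v} [CommRing R] {S T A : SSet.{u}} {V : Type w} [AddCommGroup V] [Module R V]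

/-- The cup product of a `V`-valued cochain with a family of cochains parametrised by `V`. -/
def vcup {p q n : ℕ} (h : p + q = n) (g : V →ₗ[R] Cochain R S q) :
    (S _⦋p⦌ → V) →ₗ[R] Cochain R S n where
  toFun c := fun s => g (c (front p (by omega) s)) (back p q h s)
  map_add' c c' := by
    funext s
    simp
  map_smul' r c := by
    funext s
    simp

lemma vcup_apply {p q n : ℕ} (h : p + q = n) (g : V →ₗ[R] Cochain R S q) (c : S _⦋p⦌ → V)
    (s : S _⦋n⦌) : vcup h g c s = g (c (front p (by omega) s)) (back p q h s) := rfl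

/-- The Leibniz rule for coefficients in cocycles: only the coboundary of `c` remains. -/
lemma coboundary_vcup {p q n : ℕ} (h : p + q = n) (g : V →ₗ[R] Cochain R S q)
    (hg : ∀ v, coboundary R S q (g v) = 0) (c : S _⦋p⦌ → V) :
    coboundary R S n (vcup h g c) =
      vcup (by omega : p + 1 + q = n + 1) g (vcoboundary R S V p c) := by
  funext s
  subst h
  change ∑ i : Fin (p + q + 2), (-1 : R) ^ (i : ℕ) *
      g (c (front p _ (S.δ i s))) (back p q _ (S.δ i s)) =
    g (∑ i : Fin (p + 2), (-1 : R) ^ (i : ℕ) • c (S.δ i (front (p + 1) _ s)))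
      (back (p + 1) q _ s)
  have e : p + 1 + (q + 1) = p + q + 2 := by omega
  rw [← (finCongr e).sum_comp, Fin.sum_univ_add, Fin.sum_univ_castSucc (n := p + 1)]
  have h1 : ∀ i : Fin (p + 1), (-1 : R) ^ ((finCongr e (Fin.castAdd (q + 1) i) : Fin _) : ℕ) *
      g (c (front p (by omega) (S.δ (finCongr e (Fin.castAdd (q + 1) i)) s)))
        (back p q rfl (S.δ (finCongr e (Fin.castAdd (q + 1) i)) s)) =
      (-1 : R) ^ (i.castSucc : ℕ) * g (c (S.δ i.castSucc (front (p + 1) (by omega) s)))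
        (back (p + 1) q (by omega) s) := by
    intro i
    have a := front_delta_low (S := S) (rfl : p + q = p + q) i (by omega) s
    have b := back_delta_low (S := S) (rfl : p + q = p + q) i (by omega) s
    have c : finCongr e (Fin.castAdd (q + 1) i) = (⟨i, by omega⟩ : Fin (p + q + 2)) := rfl
    have d : i.castSucc = (⟨i, by omega⟩ : Fin (p + 2)) := rfl
    rw [c, d, a, b]
  have h2 : ∀ j : Fin (q + 1), (-1 : R) ^ ((finCongr e (Fin.natAdd (p + 1) j) : Fin _) : ℕ) *
      g (c (front p (by omega) (S.δ (finCongr e (Fin.natAdd (p + 1) j)) s)))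
        (back p q rfl (S.δ (finCongr e (Fin.natAdd (p + 1) j)) s)) =
      (-1 : R) ^ p * ((-1 : R) ^ (j.succ : ℕ) * g (c (front p (by omega) s))
        (S.δ j.succ (back p (q + 1) (by omega) s))) := by
    intro j
    have a := front_delta_high (S := S) (rfl : p + q = p + q) (p + (j + 1)) (by omega)
      (by omega) s
    have b := back_delta_high (S := S) (rfl : p + q = p + q) (j + 1) (by omega) s
    have c : finCongr e (Fin.natAdd (p + 1) j) = (⟨p + (j + 1), by omega⟩ : Fin (p + q + 2)) := by
      ext
      simp
      try omega
    have d : j.succ = (⟨j + 1, by omega⟩ : Fin (q + 2)) := rfl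
    rw [c, d, a, b]
    simp only [pow_add]
    ring
  have h3 : front p (by omega) s =
      S.δ (Fin.last (p + 1)) (front (p + 1) (by omega : p + 1 ≤ p + q + 1) s) := by
    rw [← front_delta_high (S := S) (rfl : p + q = p + q) (p + 1) (by omega) (by omega) s]
    exact (front_delta_low (S := S) (rfl : p + q = p + q) (p + 1) (by omega) s).symm
  have h4 : S.δ (0 : Fin (q + 2)) (back p (q + 1) (by omega : p + (q + 1) = p + q + 1) s) =
      back (p + 1) q (by omega) s := by
    rw [← back_delta_low (S := S) (rfl : p + q = p + q) p (by omega) s]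
    exact back_delta_high (S := S) (rfl : p + q = p + q) 0 (by omega) s
  -- The cocycle condition for the single vector c(front face) expresses the remaining faces of the
  -- back face through its 0-th face; the result is the missing last face term of the coboundary of
  -- `c`.
  have h5 := congrFun (hg (c (front p (by omega) s))) (back p (q + 1) (by omega) s)
  change ∑ j : Fin (q + 2), (-1 : R) ^ (j : ℕ) * g (c (front p (by omega) s)) (S.δ j _) = 0 at h5
  rw [Fin.sum_univ_succ, h4, add_comm] at h5
  simp only [h1, h2, ← Finset.mul_sum]
  rw [eq_neg_of_add_eq_zero_left h5, ← h3, map_add, map_sum, Pi.add_apply, Finset.sum_apply]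
  simp only [map_smul, Pi.smul_apply, smul_eq_mul, Fin.val_last, Fin.val_zero, pow_zero, pow_succ]
  ring

lemma vcup_cochainMap (f : T ⟶ S) {p q n : ℕ} (h : p + q = n) (g : V →ₗ[R] Cochain R S q)
    (c : S _⦋p⦌ → V) :
    cochainMap f n (vcup h g c) = vcup h (cochainMap f q ∘ₗ g) fun s => c (f.app _ s) := by
  funext s
  change g (c (front p _ (f.app _ s))) (back p q _ (f.app _ s)) =
    g (c (f.app _ (front p _ s))) (f.app _ (back p q _ s))
  rw [front, back, front, back, app_map, app_map]

lemma vcup_const {n : ℕ} (h : 0 + n = n) (g : V →ₗ[R] Cochain R S n) (v : V) :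
    vcup h g (fun _ => v) = g v := by
  funext s
  rw [vcup_apply, back_self]

end TwistedCup

section LerayHirsch

variable (R : Type v) [Field R] {B E : SSet.{u}} (V : ℕ → Type w)
  [∀ q, AddCommGroup (V q)] [∀ q, Module R (V q)]

/-- The pairs of natural numbers of sum `n`. -/
abbrev Bidegree (n : ℕ) : Type := {x : ℕ × ℕ // x.1 + x.2 = n}

instance (n : ℕ) : Fintype (Bidegree n) :=
  Fintype.subtype (Finset.HasAntidiagonal.antidiagonal n) fun _ =>
    Finset.HasAntidiagonal.mem_antidiagonal

/-- The total complex of cochains on the base with values in a graded vector space. -/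
abbrev totalCochains (A : SSet.{u}) (n : ℕ) : Type (max u w) :=
  ∀ i : Bidegree n, A _⦋i.1.1⦌ → V i.1.2

/-- The components of the differential of the total complex. -/
def totalDComponent (A : SSet.{u}) (n : ℕ) :
    ∀ i : Bidegree (n + 1), totalCochains V A n →ₗ[R] (A _⦋i.1.1⦌ → V i.1.2) := fun i =>
  match i with
  | ⟨(0, _), _⟩ => 0
  | ⟨(p + 1, q), h⟩ => vcoboundary R A (V q) p ∘ₗ
      LinearMap.proj (⟨(p, q), by simp only at h ⊢; omega⟩ : Bidegree n)

/-- The differential of the total complex. -/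
def totalD (A : SSet.{u}) (n : ℕ) : totalCochains V A n →ₗ[R] totalCochains V A (n + 1) :=
  LinearMap.pi (totalDComponent R V A n)

variable {V}

lemma totalD_zero {A : SSet.{u}} {n : ℕ} (c : totalCochains V A n) (q : ℕ) (h : 0 + q = n + 1) :
    totalD R V A n c ⟨(0, q), h⟩ = 0 := rfl

lemma totalD_succ {A : SSet.{u}} {n : ℕ} (c : totalCochains V A n) (p q : ℕ)
    (h : p + 1 + q = n + 1) :
    totalD R V A n c ⟨(p + 1, q), h⟩ =
      vcoboundary R A (V q) p (c ⟨(p, q), by simp only at h ⊢; omega⟩) := rfl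

lemma totalD_totalD {A : SSet.{u}} {n : ℕ} (c : totalCochains V A n) :
    totalD R V A (n + 1) (totalD R V A n c) = 0 := by
  funext ⟨⟨p, q⟩, h⟩
  match p with
  | 0 => rfl
  | 1 =>
    rw [totalD_succ, totalD_zero, map_zero]
    rfl
  | p + 2 =>
    rw [totalD_succ, totalD_succ, vcoboundary_vcoboundary]
    rfl

lemma totalD_single {A : SSet.{u}} {n p q : ℕ} (h : p + q = n) (c : A _⦋p⦌ → V q) :
    totalD R V A n (Pi.single (⟨(p, q), h⟩ : Bidegree n) c) =
      Pi.single (⟨(p + 1, q), by simp only; omega⟩ : Bidegree (n + 1)) (vcoboundary R A (V q) p c) := by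
  funext ⟨⟨p', q'⟩, h'⟩
  match p' with
  | 0 =>
    rw [totalD_zero, Pi.single_eq_of_ne]
    simp
  | p' + 1 =>
    rw [totalD_succ]
    by_cases hp : p' = p
    · subst hp
      obtain rfl : q' = q := by simp only at h'; omega
      rw [Pi.single_eq_same, Pi.single_eq_same]
    · rw [Pi.single_eq_of_ne, Pi.single_eq_of_ne, map_zero]
      · simp [hp]
      · simp [hp]

variable {R}

/-- The comparison map from the total complex to the cochains of a space over the base. -/
def twist {A S : SSet.{u}} (π : S ⟶ A) (g : ∀ q, V q →ₗ[R] Cochain R S q) (n : ℕ) :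
    totalCochains V A n →ₗ[R] Cochain R S n :=
  ∑ i : Bidegree n, vcup i.2 (g i.1.2) ∘ₗ LinearMap.funLeft R _ (π.app (op ⦋i.1.1⦌)) ∘ₗ
    LinearMap.proj i

lemma twist_apply {A S : SSet.{u}} (π : S ⟶ A) (g : ∀ q, V q →ₗ[R] Cochain R S q) {n : ℕ}
    (c : totalCochains V A n) :
    twist π g n c = ∑ i : Bidegree n, vcup i.2 (g i.1.2) fun s => c i (π.app (op ⦋i.1.1⦌) s) := by
  simp only [twist, LinearMap.sum_apply]
  rfl

lemma twist_single {A S : SSet.{u}} (π : S ⟶ A) (g : ∀ q, V q →ₗ[R] Cochain R S q) {n : ℕ}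
    (i : Bidegree n) (c : A _⦋i.1.1⦌ → V i.1.2) :
    twist π g n (Pi.single i c) = vcup i.2 (g i.1.2) fun s => c (π.app (op ⦋i.1.1⦌) s) := by
  rw [twist_apply, Finset.sum_eq_single i]
  · rw [Pi.single_eq_same]
  · intro j _ hj
    rw [Pi.single_eq_of_ne hj]
    have h : (vcup j.2 (g j.1.2) fun _ : S _⦋j.1.1⦌ => (0 : V j.1.2)) = 0 :=
      (vcup j.2 (g j.1.2)).map_zero
    exact h
  · simp

lemma vcoboundary_comp {A S : SSet.{u}} (π : S ⟶ A) {W : Type w} [AddCommGroup W] [Module R W]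
    {n : ℕ} (c : A _⦋n⦌ → W) :
    (vcoboundary R S W n fun s => c (π.app _ s)) =
      fun s => vcoboundary R A W n c (π.app _ s) := by
  funext s
  rw [vcoboundary_apply, vcoboundary_apply]
  refine Finset.sum_congr rfl fun i _ => ?_
  congr 2
  exact app_map π _ s

/-- The total complex has no differential in the fibre direction; this is compatible with the
cochains of the total space because the values of `g` are cocycles. -/
lemma coboundary_twist {A S : SSet.{u}} (π : S ⟶ A) (g : ∀ q, V q →ₗ[R] Cochain R S q)
    (hg : ∀ q v, coboundary R S q (g q v) = 0) {n : ℕ} (c : totalCochains V A n) :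
    twist π g (n + 1) (totalD R V A n c) = coboundary R S n (twist π g n c) := by
  have : twist π g (n + 1) ∘ₗ totalD R V A n = coboundary R S n ∘ₗ twist π g n := by
    refine LinearMap.pi_ext' fun ⟨⟨p, q⟩, h⟩ => LinearMap.ext fun c => ?_
    change twist π g (n + 1) (totalD R V A n (Pi.single _ c)) =
      coboundary R S n (twist π g n (Pi.single _ c))
    rw [totalD_single, twist_single, twist_single, coboundary_vcup _ _ (hg q), vcoboundary_comp]
  exact LinearMap.congr_fun this c

lemma twist_cochainMap {A A' S S' : SSet.{u}} (π : S ⟶ A) (π' : S' ⟶ A') (f : S' ⟶ S) (f' : A' ⟶ A)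
    (hf : π' ≫ f' = f ≫ π) (g : ∀ q, V q →ₗ[R] Cochain R S q) {n : ℕ} (c : totalCochains V A n) :
    cochainMap f n (twist π g n c) =
      twist π' (fun q => cochainMap f q ∘ₗ g q) n fun i a => c i (f'.app _ a) := by
  rw [twist_apply, twist_apply, map_sum]
  refine Finset.sum_congr rfl fun i _ => ?_
  rw [vcup_cochainMap]
  congr 1
  funext s
  have := congrArg (fun h : S' ⟶ A => h.app _ s) hf
  exact congrArg _ this.symm

/-- Coboundaries in the total complex. -/
def totalBoundaries (R : Type v) [Field R] (V : ℕ → Type w)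
    [∀ q, AddCommGroup (V q)] [∀ q, Module R (V q)] (A : SSet.{u}) (n : ℕ) :
    Submodule R (totalCochains V A n) :=
  match n with
  | 0 => ⊥
  | n + 1 => LinearMap.range (totalD R V A n)

/-- On a simplicial set with a cone operator, all total cocycles are cohomologous to constants. -/
lemma ConeOperator.exists_const {A : SSet.{u}} (a : ConeOperator A) {n : ℕ}
    (c : totalCochains V A n) (hc : totalD R V A n c = 0) :
    ∃ v : V n, c - Pi.single (⟨(0, n), zero_add n⟩ : Bidegree n) (fun _ => v) ∈
      totalBoundaries R V A n := by
  have h0 : vcoboundary R A (V n) 0 (c ⟨(0, n), zero_add n⟩) = 0 :=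
    (totalD_succ R c 0 n (by omega)).symm.trans (congrFun hc _)
  have h1 := a.eq_of_vcoboundary_eq_zero _ h0
  refine ⟨c ⟨(0, n), zero_add n⟩ a.pt, ?_⟩
  cases n with
  | zero =>
    refine sub_eq_zero.2 ?_
    funext ⟨⟨p, q⟩, h⟩
    obtain rfl : p = 0 := by simp only at h; omega
    obtain rfl : q = 0 := by simp only at h; omega
    rw [Pi.single_eq_same]
    funext s
    exact h1 s
  | succ n =>
    -- Components of positive base degree are exact by the contraction; only the component of base
    -- degree 0 leaves a constant.
    have h2 : ∀ i : Bidegree n, ∃ e, vcoboundary R A (V i.1.2) i.1.1 e =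
        c ⟨(i.1.1 + 1, i.1.2), by have := i.2; simp only; omega⟩ := fun i =>
      a.exists_vcoboundary_eq _
        ((totalD_succ R c _ _ (by have := i.2; omega)).symm.trans (congrFun hc _))
    choose e he using h2
    refine ⟨e, ?_⟩
    funext ⟨⟨p, q⟩, h⟩
    cases p with
    | zero =>
      obtain rfl : q = n + 1 := by simp only at h; omega
      rw [totalD_zero, Pi.sub_apply, Pi.single_eq_same, eq_comm, sub_eq_zero]
      funext s
      exact h1 s
    | succ p =>
      rw [totalD_succ, Pi.sub_apply, Pi.single_eq_of_ne, sub_zero]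
      · exact he ⟨(p, q), _⟩
      · simp

/-- The presheaf of total cochains. -/
def totalPresheaf (R : Type v) [Field R] (B : SSet.{u}) (V : ℕ → Type w)
    [∀ q, AddCommGroup (V q)] [∀ q, Module R (V q)] (n : ℕ) :
    LinearPresheaf.{u, v, max u w, u + 1} R (Over B) :=
  LinearPresheaf.pi fun i : Bidegree n => cochainPresheaf R (Over.forget B) (V i.1.2) i.1.1

/-- The differential of the presheaf of total cochains. -/
def totalPresheafD (R : Type v) [Field R] (B : SSet.{u}) (V : ℕ → Type w)
    [∀ q, AddCommGroup (V q)] [∀ q, Module R (V q)] (n : ℕ) :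
    LinearPresheaf.Hom (totalPresheaf R B V n) (totalPresheaf R B V (n + 1)) where
  app X := totalD R V X.left n
  naturality {X Y} g c := by
    funext ⟨⟨p, q⟩, h⟩
    match p with
    | 0 => rfl
    | p + 1 => exact (vcoboundary_comp g.left _).symm

lemma vcoboundary_const {A : SSet.{u}} {W : Type w} [AddCommGroup W] [Module R W] (v : W) :
    vcoboundary R A W 0 (fun _ => v) = 0 := by
  funext s
  simp [vcoboundary_apply, Fin.sum_univ_two]

end LerayHirsch

/-! ### The Leray–Hirsch theorem on cochains -/

section Main

variable {R : Type v} [Field R] {B E : SSet.{u}} {V : ℕ → Type (max u v)}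
  [∀ q, AddCommGroup (V q)] [∀ q, Module R (V q)] (p : E ⟶ B)
  (g : ∀ q, V q →ₗ[R] cocycles R E q)

/-- The comparison map over a simplicial set over the base, as a linear map. -/
def twistOver (X : Over B) (n : ℕ) :
    totalCochains V X.left n →ₗ[R] Cochain R ((pullbackFunctor p).obj X) n :=
  twist (pullbackFst p X)
    (fun q => cochainMap (pullbackSnd p X) q ∘ₗ (cocycles R E q).subtype ∘ₗ g q) n

/-- The comparison map over a simplicial set over the base. -/
def twistHom (n : ℕ) : LinearPresheaf.Hom (totalPresheaf R B V n)
    (cochainPresheaf.{u, v, v, u + 1} R (pullbackFunctor p) R n) where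
  app X := twistOver p g X n
  naturality {X Y} f c := twist_cochainMap (pullbackFst p X) (pullbackFst p Y)
    ((pullbackFunctor p).map f) f.left rfl
    (fun q => cochainMap (pullbackSnd p X) q ∘ₗ (cocycles R E q).subtype ∘ₗ g q) c

lemma mem_boundary_totalPresheafD {A : Over B} {n : ℕ} {c : totalCochains V A.left n} :
    c ∈ LinearPresheaf.boundary (totalPresheafD R B V) A n ↔ c ∈ totalBoundaries R V A.left n := by
  cases n <;> rfl

lemma mem_boundary_cochainD {A : Over B} {n : ℕ} {c : Cochain R ((pullbackFunctor p).obj A) n} :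
    c ∈ LinearPresheaf.boundary (fun n => cochainD R (pullbackFunctor p) R n) A n ↔
      c ∈ coboundaries R ((pullbackFunctor p).obj A) n := by
  cases n <;> rfl

lemma coboundary_cochainMap_cocycle {S T : SSet.{u}} (f : S ⟶ T) {n : ℕ} (a : cocycles R T n) :
    coboundary R S n (cochainMap f n a) = 0 :=
  coboundary_cocycle (cocycleMap f n a)

/-- The Leray-Hirsch theorem on the level of cochains: if the classes of the cocycles `g v` restrict
to bases of the cohomology over all simplices, the cochains of the base with values in the fibre
cohomology compute the cohomology of the total space. -/
theorem isQuasiIsoAt_twist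
    (hg : ∀ (m : ℕ) (b : B _⦋m⦌) (q : ℕ), Function.Bijective fun v : V q =>
      scohomologyMap R (pullbackSnd p (simplexOver b)) q (cls R E q (g q v))) (X : Over B) :
    LinearPresheaf.IsQuasiIsoAt (totalPresheafD R B V)
      (fun n => cochainD R (pullbackFunctor p) R n) (twistHom p g) X := by
  have hcomm : ∀ (n : ℕ) (X : Over B) (c : totalCochains V X.left n),
      twistOver p g X (n + 1) (totalD R V X.left n c) =
        coboundary R ((pullbackFunctor p).obj X) n (twistOver p g X n c) := fun n X c =>
    coboundary_twist (pullbackFst p X)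
      (fun q => cochainMap (pullbackSnd p X) q ∘ₗ (cocycles R E q).subtype ∘ₗ g q)
      (fun q v => coboundary_cochainMap_cocycle (pullbackSnd p X) (g q v)) c
  have hb : ∀ (n : ℕ) (X : Over B) (c : totalCochains V X.left n), c ∈ totalBoundaries R V X.left n →
      twistOver p g X n c ∈ coboundaries R ((pullbackFunctor p).obj X) n := by
    intro n X c hc
    cases n with
    | zero =>
      rw [show c = 0 from hc]
      rw [map_zero]
      exact Submodule.zero_mem _
    | succ n =>
      obtain ⟨e, rfl⟩ := hc
      exact ⟨_, (hcomm n X e).symm⟩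
  -- On a constant v the comparison map returns the cocycle g(v) itself, so over a simplex the
  -- comparison becomes the restriction map of the hypothesis.
  have hconst : ∀ (n : ℕ) (X : Over B) (v : V n), twistOver p g X n
      (Pi.single (⟨(0, n), zero_add n⟩ : Bidegree n) fun _ => v : totalCochains V X.left n) =
        cochainMap (pullbackSnd p X) n (g n v) := fun n X v =>
    (twist_single (pullbackFst p X)
      (fun q => cochainMap (pullbackSnd p X) q ∘ₗ (cocycles R E q).subtype ∘ₗ g q) _ _).trans
      (vcup_const _ _ v)
  refine LinearPresheaf.isQuasiIsoAt_of_models (M := IsSimplex) _ _ _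
    (fun n X c => totalD_totalD R c) (fun n X x => coboundary_coboundary x)
    hcomm
    (fun n => LinearPresheaf.IsModelInjective.pi fun i => isModelInjective_forget _)
    (fun n => isModelInjective_pullback p _) ?_ X
  rintro _ ⟨m, b, rfl⟩
  constructor
  · intro n (c : totalCochains V (simplexOver b).left n) hc h
    replace h : twistOver p g (simplexOver b) n c ∈ _ := (mem_boundary_cochainD p).1 h
    refine mem_boundary_totalPresheafD.2 ?_
    -- Up to a coboundary, `c` is a constant v. Then the class of g(v) restricts to zero, and v = 0
    -- by hypothesis.
    obtain ⟨v, hv⟩ := (show ConeOperator (simplexOver b).left from simplexCone m).exists_const c hc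
    have h1 := Submodule.sub_mem _ h (hb n (simplexOver b) _ hv)
    have h2 : twistOver p g (simplexOver b) n c - twistOver p g (simplexOver b) n
        (c - Pi.single (⟨(0, n), zero_add n⟩ : Bidegree n) fun _ => v : totalCochains V (simplexOver b).left n) =
        cochainMap (pullbackSnd p (simplexOver b)) n (g n v) := by
      rw [← hconst, ← map_sub]
      congr 1
      exact sub_sub_cancel c _
    rw [h2] at h1
    have h3 : v = 0 := by
      refine (hg m b n).1 ?_
      simp only [map_zero]
      exact (cls_eq_zero (cocycleMap (pullbackSnd p (simplexOver b)) n (g n v))).2 h1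
    subst h3
    convert! hv using 1
    rw [show (fun _ : (simplexOver b).left _⦋0⦌ => (0 : V n)) = 0 from rfl, Pi.single_zero, sub_zero]
  · intro n (y : Cochain R ((pullbackFunctor p).obj (simplexOver b)) n) hy
    obtain ⟨v, hv⟩ := (hg m b n).2 (cls R _ n ⟨y, hy⟩)
    refine ⟨(Pi.single (⟨(0, n), zero_add n⟩ : Bidegree n) fun _ => v : totalCochains V (simplexOver b).left n),
      ?_, ?_⟩
    · refine (totalD_single R _ _).trans ?_
      exact (congrArg _ (vcoboundary_const (A := (simplexOver b).left) v)).trans (Pi.single_zero _)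
    · refine (mem_boundary_cochainD p).2 ?_
      change y - twistOver p g (simplexOver b) n _ ∈ _
      rw [hconst]
      exact (cls_eq_iff ⟨y, hy⟩ (cocycleMap (pullbackSnd p (simplexOver b)) n (g n v))).1 hv.symm

/-- The injectivity over the identity of B, transported to E along the projection from the pullback.
-/
lemma twist_mem_coboundaries
    (hg : ∀ (m : ℕ) (b : B _⦋m⦌) (q : ℕ), Function.Bijective fun v : V q =>
      scohomologyMap R (pullbackSnd p (simplexOver b)) q (cls R E q (g q v)))
    {n : ℕ} (c : totalCochains V B n) (hc : totalD R V B n c = 0)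
    (h : twist p (fun q => (cocycles R E q).subtype ∘ₗ g q) n c ∈ coboundaries R E n) :
    c ∈ totalBoundaries R V B n := by
  refine mem_boundary_totalPresheafD.1
    ((isQuasiIsoAt_twist p g hg (Over.mk (𝟙 B))).inj n c hc ((mem_boundary_cochainD p).2 ?_))
  have h1 := cochainMap_mem (pullbackSnd p (Over.mk (𝟙 B))) n _ h
  rw [twist_cochainMap p (pullbackFst p (Over.mk (𝟙 B))) (pullbackSnd p (Over.mk (𝟙 B))) (𝟙 B)
    (by ext n x; exact x.2)] at h1
  exact h1

/-- The surjectivity over the identity of B, transported to E along the section `toPullback`. -/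
lemma exists_twist
    (hg : ∀ (m : ℕ) (b : B _⦋m⦌) (q : ℕ), Function.Bijective fun v : V q =>
      scohomologyMap R (pullbackSnd p (simplexOver b)) q (cls R E q (g q v)))
    {n : ℕ} (y : cocycles R E n) : ∃ c : totalCochains V B n, totalD R V B n c = 0 ∧
      y - twist p (fun q => (cocycles R E q).subtype ∘ₗ g q) n c ∈ coboundaries R E n := by
  obtain ⟨c, hc, h⟩ := (isQuasiIsoAt_twist p g hg (Over.mk (𝟙 B))).surj n
    (cochainMap (pullbackSnd p (Over.mk (𝟙 B))) n y) (coboundary_cochainMap_cocycle _ y)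
  refine ⟨c, hc, ?_⟩
  have h1 := cochainMap_mem (toPullback p) n _ ((mem_boundary_cochainD p).1 h)
  replace h1 := (congrArg (· ∈ coboundaries R E n) ((cochainMap (toPullback p) n).map_sub _ _)).mp h1
  convert! h1 using 2
  exact (twist_cochainMap (pullbackFst p (Over.mk (𝟙 B))) p (toPullback p) (𝟙 B) rfl
    (fun q => cochainMap (pullbackSnd p (Over.mk (𝟙 B))) q ∘ₗ (cocycles R E q).subtype ∘ₗ g q)
    c).symm

end Main

end Halving

namespace Halving

open CategoryTheory Simplicial Opposite

/-! ### Universal coefficients over a field -/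

section UniversalCoefficients

variable {R : Type v} [Field R] {S : SSet.{u}} {V : Type w} [AddCommGroup V] [Module R V]

lemma linearCombination_sub_apply {ι : Type*} (c c' : ι → V) (z : ι →₀ R) :
    Finsupp.linearCombination R (c - c') z =
      Finsupp.linearCombination R c z - Finsupp.linearCombination R c' z := by
  simp [Finsupp.linearCombination_apply, Finsupp.sum, smul_sub, Finset.sum_sub_distrib]

lemma linearCombination_smul_const {ι : Type*} (c : ι → R) (v : V) (z : ι →₀ R) :
    Finsupp.linearCombination R (fun s => c s • v) z = Finsupp.linearCombination R c z • v := by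
  simp [Finsupp.linearCombination_apply, Finsupp.sum, Finset.sum_smul, smul_smul]

/-- The boundary map of simplicial chains. -/
noncomputable def chainBoundary (R : Type v) [Field R] (S : SSet.{u}) (n : ℕ) :
    (S _⦋n + 1⦌ →₀ R) →ₗ[R] (S _⦋n⦌ →₀ R) :=
  Finsupp.linearCombination R fun s =>
    ∑ i : Fin (n + 2), (-1 : R) ^ (i : ℕ) • Finsupp.single (S.δ i s) 1

lemma linearCombination_chainBoundary {n : ℕ} (c : S _⦋n⦌ → V) (x : S _⦋n + 1⦌ →₀ R) :
    Finsupp.linearCombination R c (chainBoundary R S n x) =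
      Finsupp.linearCombination R (vcoboundary R S V n c) x := by
  have : Finsupp.linearCombination R c ∘ₗ chainBoundary R S n =
      Finsupp.linearCombination R (vcoboundary R S V n c) := by
    refine Finsupp.lhom_ext' fun s => LinearMap.ext_ring ?_
    simp [chainBoundary, vcoboundary_apply]
  exact LinearMap.congr_fun this x

/-- Simplicial cycles. -/
noncomputable def chainCycles (R : Type v) [Field R] (S : SSet.{u}) (n : ℕ) :
    Submodule R (S _⦋n⦌ →₀ R) :=
  match n with
  | 0 => ⊤
  | n + 1 => LinearMap.ker (chainBoundary R S n)

/-- Coboundaries of vector valued cochains. -/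
def vcoboundaries (R : Type v) [Field R] (S : SSet.{u}) (V : Type w) [AddCommGroup V] [Module R V]
    (n : ℕ) : Submodule R (S _⦋n⦌ → V) :=
  match n with
  | 0 => ⊥
  | n + 1 => LinearMap.range (vcoboundary R S V n)

lemma vcoboundaries_eq_coboundaries (n : ℕ) : vcoboundaries R S R n = coboundaries R S n := by
  cases n <;> rfl

/-- A cochain that vanishes on cycles factors through the boundary map, and over a field the factor
extends to all chains of the previous degree. In degree 0 all chains are cycles, which matches the
absence of coboundaries. -/
lemma mem_vcoboundaries_iff {n : ℕ} (c : S _⦋n⦌ → V) :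
    c ∈ vcoboundaries R S V n ↔ ∀ z ∈ chainCycles R S n, Finsupp.linearCombination R c z = 0 := by
  cases n with
  | zero =>
    constructor
    · intro h z _
      rw [show c = 0 from h]
      simp
    · intro h
      change c = 0
      funext s
      simpa using h (Finsupp.single s 1) trivial
  | succ n =>
    constructor
    · rintro ⟨e, rfl⟩ z hz
      rw [← linearCombination_chainBoundary, show chainBoundary R S n z = 0 from hz, map_zero]
    · intro h
      obtain ⟨l, hl⟩ := exists_comp_eq_of_ker_le (chainBoundary R S n)
        (Finsupp.linearCombination R c) h
      refine ⟨fun s => l (Finsupp.single s 1), ?_⟩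
      funext s
      have h1 := hl (Finsupp.single s 1)
      simp only [chainBoundary, Finsupp.linearCombination_single, one_smul, map_sum, map_smul] at h1
      exact h1

/-- If β spans H^n, then H_n has dimension at most 1, and a V-valued cocycle is determined up to
coboundaries by its value on a cycle dual to β. This value is v, so V may have infinite dimension.
-/
lemma exists_smul_sub_mem_vcoboundaries {n : ℕ} (β : cocycles R S n)
    (hβ : ∀ a : cocycles R S n, ∃ r : R, (a : Cochain R S n) - r • (β : Cochain R S n) ∈
      coboundaries R S n)
    (c : S _⦋n⦌ → V) (hc : vcoboundary R S V n c = 0) :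
    ∃ v : V, (c - fun s => β.1 s • v) ∈ vcoboundaries R S V n := by
  have hkill : ∀ {W : Type _} [AddCommGroup W] [Module R W] (c : S _⦋n⦌ → W),
      vcoboundary R S W n c = 0 → ∀ x, Finsupp.linearCombination R c (chainBoundary R S n x) = 0 := by
    intro W _ _ c hc x
    rw [linearCombination_chainBoundary, hc]
    simp
  -- The cycle z satisfies β(z) = 1, or z = 0 if β vanishes on all cycles.
  obtain ⟨z, hz, hβz⟩ : ∃ z ∈ chainCycles R S n, ∀ y ∈ chainCycles R S n,
      Finsupp.linearCombination R β.1 (y - Finsupp.linearCombination R β.1 y • z) = 0 := by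
    by_cases h : ∃ z ∈ chainCycles R S n, Finsupp.linearCombination R β.1 z ≠ 0
    · obtain ⟨z, hz, h⟩ := h
      refine ⟨(Finsupp.linearCombination R β.1 z)⁻¹ • z, Submodule.smul_mem _ _ hz, fun y _ => ?_⟩
      rw [map_sub, map_smul, map_smul, smul_eq_mul, smul_eq_mul, inv_mul_cancel₀ h, mul_one, sub_self]
    · push Not at h
      refine ⟨0, Submodule.zero_mem _, fun y hy => ?_⟩
      rw [smul_zero, sub_zero, h y hy]
  -- If y were no boundary, a functional that kills boundaries but not y would be a cocycle that is
  -- not a multiple of β modulo coboundaries.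
  have hmem : ∀ y ∈ chainCycles R S n, Finsupp.linearCombination R β.1 y = 0 →
      y ∈ LinearMap.range (chainBoundary R S n) := by
    intro y hy h
    by_contra hn
    obtain ⟨f, hf, hfy⟩ := Submodule.exists_le_ker_of_notMem hn
    have hL : Finsupp.linearCombination R (fun s => f (Finsupp.single s 1)) = f := by
      refine Finsupp.lhom_ext' fun s => LinearMap.ext_ring ?_
      simp
    have hcoc : coboundary R S n (fun s => f (Finsupp.single s 1)) = 0 := by
      funext s
      have h1 := linearCombination_chainBoundary (R := R) (fun s => f (Finsupp.single s 1))
        (Finsupp.single s 1)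
      rw [hL, Finsupp.linearCombination_single, one_smul] at h1
      exact h1.symm.trans (hfy ⟨_, rfl⟩)
    obtain ⟨r, hr⟩ := hβ ⟨_, hcoc⟩
    rw [← vcoboundaries_eq_coboundaries, mem_vcoboundaries_iff] at hr
    have h2 := hr y hy
    rw [show (r • (β : Cochain R S n)) = fun s => β.1 s • r from
      funext fun s => mul_comm _ _, linearCombination_sub_apply, linearCombination_smul_const, h,
      zero_smul, sub_zero, hL] at h2
    exact hf h2
  refine ⟨Finsupp.linearCombination R c z, ?_⟩
  rw [mem_vcoboundaries_iff]
  intro y hy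
  obtain ⟨x, hx⟩ := hmem (y - Finsupp.linearCombination R β.1 y • z)
    (Submodule.sub_mem _ hy (Submodule.smul_mem _ _ hz)) (hβz y hy)
  have h1 := hkill c hc x
  rw [hx, map_sub, map_smul] at h1
  rw [linearCombination_sub_apply, linearCombination_smul_const, h1]

/-- A functional that is nonzero on v reduces the claim to scalar coefficients. -/
lemma eq_zero_of_smul_mem_vcoboundaries {n : ℕ} (β : Cochain R S n)
    (hβ : β ∉ coboundaries R S n) (v : V) (h : (fun s => β s • v) ∈ vcoboundaries R S V n) :
    v = 0 := by
  by_contra hv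
  obtain ⟨f, hf⟩ := Module.Projective.exists_dual_ne_zero R hv
  apply hβ
  rw [← vcoboundaries_eq_coboundaries, mem_vcoboundaries_iff] at *
  intro z hz
  have h1 := h z hz
  rw [linearCombination_smul_const] at h1
  have h2 := congrArg f h1
  rw [map_smul, map_zero, smul_eq_mul] at h2
  exact (mul_eq_zero.1 h2).resolve_right hf

end UniversalCoefficients

/-! ### The Leray–Hirsch theorem in cohomology -/

section LerayHirsch

variable {R : Type v} [Field R] {B E : SSet.{u}} {V : ℕ → Type (max u v)}
  [∀ q, AddCommGroup (V q)] [∀ q, Module R (V q)] (p : E ⟶ B)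
  (τ : ∀ q, V q →ₗ[R] SCohomology R E q)

/-- Over a field representing cocycles can be chosen linearly, as the comparison map requires. -/
lemma exists_cocycle_lift (q : ℕ) :
    ∃ g : V q →ₗ[R] cocycles R E q, ∀ v, cls R E q (g v) = τ q v := by
  obtain ⟨s, hs⟩ := (cls R E q).exists_rightInverse_of_surjective
    (LinearMap.range_eq_top.2 (cls_surjective q))
  exact ⟨s ∘ₗ τ q, fun v => LinearMap.congr_fun hs (τ q v)⟩

/-- The total complex is a product of shifted base complexes, one for each fibre degree, so
primitives can be chosen componentwise. -/
lemma mem_totalBoundaries_of_forall {A : SSet.{u}} {n : ℕ} (c : totalCochains V A n)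
    (h : ∀ i, c i ∈ vcoboundaries R A (V i.1.2) i.1.1) : c ∈ totalBoundaries R V A n := by
  cases n with
  | zero =>
    change c = 0
    funext ⟨⟨p, q⟩, hi⟩
    obtain rfl : p = 0 := by simp only at hi; omega
    exact h ⟨(0, q), hi⟩
  | succ n =>
    have h2 : ∀ i : Bidegree n, ∃ e, vcoboundary R A (V i.1.2) i.1.1 e =
        c ⟨(i.1.1 + 1, i.1.2), by have := i.2; simp only; omega⟩ := fun i =>
      h ⟨(i.1.1 + 1, i.1.2), by have := i.2; simp only; omega⟩
    choose e he using h2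
    refine ⟨e, ?_⟩
    funext ⟨⟨p, q⟩, hi⟩
    cases p with
    | zero => exact (h ⟨(0, q), hi⟩).symm
    | succ p => exact he ⟨(p, q), _⟩

lemma mem_vcoboundaries_of_mem_totalBoundaries {A : SSet.{u}} {n : ℕ} (c : totalCochains V A n)
    (h : c ∈ totalBoundaries R V A n) (i : Bidegree n) :
    c i ∈ vcoboundaries R A (V i.1.2) i.1.1 := by
  cases n with
  | zero =>
    rw [show c = 0 from h]
    exact Submodule.zero_mem _
  | succ n =>
    obtain ⟨e, rfl⟩ := h
    obtain ⟨⟨p, q⟩, hi⟩ := i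
    cases p with
    | zero => exact Submodule.zero_mem _
    | succ p => exact ⟨_, rfl⟩

lemma vcoboundary_smul_const {A : SSet.{u}} {W : Type w} [AddCommGroup W] [Module R W] {n : ℕ}
    (β : cocycles R A n) (v : W) : vcoboundary R A W n (fun s => β.1 s • v) = 0 := by
  funext s
  simp only [vcoboundary_apply, smul_smul, ← Finset.sum_smul]
  exact (congrArg (· • v) (congrFun (coboundary_cocycle β) s)).trans (zero_smul R v)

lemma totalD_smul_const {A : SSet.{u}} (β : ∀ l, cocycles R A l) {n : ℕ}
    (v : ∀ i : Bidegree n, V i.1.2) :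
    totalD R V A n (fun i s => (β i.1.1).1 s • v i) = 0 := by
  funext ⟨⟨l, q⟩, hi⟩
  cases l with
  | zero => rfl
  | succ l => exact vcoboundary_smul_const _ _

/-- On elementary tensors β ⊗ v the comparison map is the cup product of the pulled-back β with
g(v). This links the cochain-level theorem to cohomology classes. -/
lemma twist_smul_const (g : ∀ q, V q →ₗ[R] cocycles R E q) (β : ∀ l, cocycles R B l) {n : ℕ}
    (v : ∀ i : Bidegree n, V i.1.2) :
    twist p (fun q => (cocycles R E q).subtype ∘ₗ g q) n (fun i s => (β i.1.1).1 s • v i) =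
      ((∑ i : Bidegree n, cupCocycle i.2 (cocycleMap p i.1.1 (β i.1.1)) (g i.1.2 (v i)) :
        cocycles R E n) : Cochain R E n) := by
  rw [twist_apply, AddSubmonoidClass.coe_finsetSum]
  refine Finset.sum_congr rfl fun i _ => ?_
  funext s
  rw [vcup_apply, map_smul]
  rfl

/-- Hypothesis of the Leray-Hirsch theorem: the classes `τ v` restrict to bases of the cohomology
over all simplices of the base. -/
def RestrictsToBases : Prop :=
  ∀ (m : ℕ) (b : B _⦋m⦌) (q : ℕ), Function.Bijective fun v : V q =>
      scohomologyMap R (pullbackSnd p (simplexOver b)) q (τ q v)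

variable {p τ}

/-- The Leray-Hirsch theorem, surjectivity. -/
theorem RestrictsToBases.exists_eq_sum (hτ : RestrictsToBases p τ) (b : ∀ l, SCohomology R B l)
    (hb : ∀ l (a : SCohomology R B l), ∃ r : R, a = r • b l) {n : ℕ} (y : SCohomology R E n) :
    ∃ v : ∀ i : Bidegree n, V i.1.2,
      y = ∑ i : Bidegree n, cup i.2 (scohomologyMap R p i.1.1 (b i.1.1)) (τ i.1.2 (v i)) := by
  choose g hg using exists_cocycle_lift τ
  choose β hβ using fun l => cls_surjective l (b l)
  obtain ⟨y, rfl⟩ := cls_surjective n y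
  obtain ⟨c, hc, hy⟩ := exists_twist p g (fun m b q => by simpa only [hg] using hτ m b q) y
  have hci : ∀ i : Bidegree n, vcoboundary R B (V i.1.2) i.1.1 (c i) = 0 := fun i =>
    (totalD_succ R c _ _ (by have := i.2; omega)).symm.trans (congrFun hc _)
  -- Each H^l(B) is spanned by the single class b_l, so every component is cohomologous to an
  -- elementary tensor.
  have hv : ∀ i : Bidegree n, ∃ v : V i.1.2,
      (c i - fun s => (β i.1.1).1 s • v) ∈ vcoboundaries R B (V i.1.2) i.1.1 := fun i =>
    exists_smul_sub_mem_vcoboundaries (β i.1.1) (fun a => by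
      obtain ⟨r, hr⟩ := hb i.1.1 (cls R B _ a)
      refine ⟨r, ?_⟩
      rw [← hβ, ← map_smul, cls_eq_iff] at hr
      exact hr) (c i) (hci i)
  choose v hv using hv
  refine ⟨v, ?_⟩
  have h1 : cls R E n y =
      cls R E n (∑ i : Bidegree n, cupCocycle i.2 (cocycleMap p i.1.1 (β i.1.1)) (g i.1.2 (v i))) := by
    rw [cls_eq_iff, ← twist_smul_const]
    have h2 : twist p (fun q => (cocycles R E q).subtype ∘ₗ g q) n
        (c - fun i s => (β i.1.1).1 s • v i) ∈ coboundaries R E n := by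
      have h3 := mem_totalBoundaries_of_forall (c - fun i s => (β i.1.1).1 s • v i) hv
      cases n with
      | zero =>
        rw [show (c - fun i s => (β i.1.1).1 s • v i) = 0 from h3, map_zero]
        exact Submodule.zero_mem _
      | succ n =>
        obtain ⟨e, he⟩ := h3
        rw [← he, coboundary_twist _ _ fun q v => coboundary_cocycle (g q v)]
        exact ⟨_, rfl⟩
    have h4 := Submodule.add_mem _ hy h2
    rwa [map_sub, sub_add_sub_cancel] at h4
  rw [h1, map_sum]
  refine Finset.sum_congr rfl fun i _ => ?_
  rw [← hβ, ← hg, scohomologyMap_cls, cup_cls]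

/-- The Leray-Hirsch theorem, injectivity. -/
theorem RestrictsToBases.eq_zero_of_sum_eq_zero (hτ : RestrictsToBases p τ)
    (b : ∀ l, SCohomology R B l) {n : ℕ} (v : ∀ i : Bidegree n, V i.1.2)
    (h : ∑ i : Bidegree n, cup i.2 (scohomologyMap R p i.1.1 (b i.1.1)) (τ i.1.2 (v i)) = 0)
    (i : Bidegree n) (hi : b i.1.1 ≠ 0) : v i = 0 := by
  choose g hg using exists_cocycle_lift τ
  choose β hβ using fun l => cls_surjective l (b l)
  have h1 : cls R E n
      (∑ i : Bidegree n, cupCocycle i.2 (cocycleMap p i.1.1 (β i.1.1)) (g i.1.2 (v i))) = 0 := by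
    rw [← h, map_sum]
    refine Finset.sum_congr rfl fun i _ => ?_
    rw [← hβ, ← hg, scohomologyMap_cls, cup_cls]
  rw [cls_eq_zero, ← twist_smul_const] at h1
  have h2 := twist_mem_coboundaries p g (fun m b q => by simpa only [hg] using hτ m b q) _ (totalD_smul_const β v) h1
  refine eq_zero_of_smul_mem_vcoboundaries (β i.1.1).1 (fun h3 => hi ?_) _
    (mem_vcoboundaries_of_mem_totalBoundaries _ h2 i)
  rw [← hβ, cls_eq_zero]
  exact h3

end LerayHirsch

end Halving

namespace Halving

open CategoryTheory Topology Set

/-! ### Milnor's universal bundle -/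

namespace MilnorE

variable {Γ : Type u} [Group Γ] [TopologicalSpace Γ]

lemma continuous_t (i : ℕ) : Continuous fun e : MilnorE Γ => e.t i := by
  refine continuous_def.2 fun V hV => ?_
  exact TopologicalSpace.isOpen_generateFrom_of_mem (Or.inl ⟨i, V, hV, rfl⟩)

lemma isOpen_t_ne_zero (i : ℕ) : IsOpen {e : MilnorE Γ | e.t i ≠ 0} :=
  isOpen_ne.preimage (continuous_t i)

open Classical in
/-- The `i`-th group coordinate, extended by `1`. -/
noncomputable def coord (i : ℕ) (e : MilnorE Γ) : Γ := if h : e.t i ≠ 0 then e.g i h else 1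

lemma coord_eq {i : ℕ} {e : MilnorE Γ} (h : e.t i ≠ 0) : coord i e = e.g i h := dif_pos h

/-- The value 1 outside {t i ≠ 0} is only a default; continuity holds on that open set, by the
definition of the topology. -/
lemma continuousAt_coord {i : ℕ} {e : MilnorE Γ} (h : e.t i ≠ 0) : ContinuousAt (coord i) e := by
  refine continuousAt_def.2 fun A hA => ?_
  obtain ⟨W, hWA, hW, he⟩ := mem_nhds_iff.1 hA
  have hopen : IsOpen {e : MilnorE Γ | ∃ h : e.t i ≠ 0, e.g i h ∈ W} :=
    TopologicalSpace.isOpen_generateFrom_of_mem (Or.inr ⟨i, W, hW, rfl⟩)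
  refine Filter.mem_of_superset (hopen.mem_nhds ⟨h, by rwa [coord_eq h] at he⟩) ?_
  rintro e' ⟨h', he'⟩
  apply hWA
  rwa [coord_eq h']

lemma coord_smul (γ : Γ) {i : ℕ} {e : MilnorE Γ} (h : e.t i ≠ 0) :
    coord i (γ • e) = γ * coord i e := by
  rw [coord_eq h, coord_eq (e := γ • e) h]
  rfl

lemma exists_ne_zero (e : MilnorE Γ) : ∃ i, e.t i ≠ 0 := by
  by_contra! h
  have h1 := e.t_sum
  rw [show e.t = 0 from Finsupp.ext h] at h1
  simp at h1

lemma eq_one_of_smul_eq {γ : Γ} {e : MilnorE Γ} (h : γ • e = e) : γ = 1 := by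
  obtain ⟨i, hi⟩ := exists_ne_zero e
  have h1 := coord_smul γ hi
  rw [h] at h1
  exact right_eq_mul.1 h1

instance [IsTopologicalGroup Γ] : ContinuousSMul Γ (MilnorE Γ) where
  continuous_smul := by
    refine continuous_generateFrom_iff.2 ?_
    rintro _ (⟨i, V, hV, rfl⟩ | ⟨i, W, hW, rfl⟩)
    · exact (hV.preimage (continuous_t i)).preimage continuous_snd
    · refine isOpen_iff_mem_nhds.2 ?_
      rintro ⟨γ, e⟩ ⟨h, he⟩
      have h1 : ContinuousAt (fun x : Γ × MilnorE Γ => x.1 * coord i x.2) (γ, e) :=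
        continuousAt_fst.mul (ContinuousAt.comp (f := Prod.snd) (x := (γ, e)) (continuousAt_coord h)
          continuousAt_snd)
      have h2 : W ∈ 𝓝 (γ * coord i e) := hW.mem_nhds (by rw [coord_eq (e := e) h]; exact he)
      filter_upwards [h1 h2, continuousAt_snd ((isOpen_t_ne_zero i).mem_nhds h)] with x hx hx'
      refine ⟨hx', ?_⟩
      have hx2 : x.1 * coord i x.2 ∈ W := hx
      rwa [coord_eq hx'] at hx2

end MilnorE

/-! ### Lifting singular simplices to EΓ -/

section Lifting

variable {Γ : Type u} [Group Γ] [TopologicalSpace Γ] [IsTopologicalGroup Γ]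

/-- The projection `EΓ → BΓ`. -/
def toClassifying (e : MilnorE Γ) : Classifying Γ := Quotient.mk'' e

lemma continuous_toClassifying : Continuous (toClassifying (Γ := Γ)) := continuous_quotient_mk'

lemma isOpenMap_toClassifying : IsOpenMap (toClassifying (Γ := Γ)) := isOpenMap_quotient_mk'_mul

lemma toClassifying_eq_iff {e e' : MilnorE Γ} :
    toClassifying e = toClassifying e' ↔ ∃ γ : Γ, γ • e' = e := Quotient.eq''

lemma toClassifying_smul (γ : Γ) (e : MilnorE Γ) : toClassifying (γ • e) = toClassifying e :=
  toClassifying_eq_iff.2 ⟨γ, rfl⟩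

/-- The domain of the local section associated with a coordinate. -/
def chartDomain (Γ : Type u) [Group Γ] [TopologicalSpace Γ] (i : ℕ) : Set (Classifying Γ) :=
  toClassifying '' {e | e.t i ≠ 0}

lemma isOpen_chartDomain (i : ℕ) : IsOpen (chartDomain Γ i) :=
  isOpenMap_toClassifying _ (MilnorE.isOpen_t_ne_zero i)

/-- The local section that normalises the `i`-th coordinate to `1`. -/
noncomputable def localSection (i : ℕ) (β : Classifying Γ) : MilnorE Γ :=
  (MilnorE.coord i (Quotient.out β))⁻¹ • Quotient.out β

lemma toClassifying_localSection (i : ℕ) (β : Classifying Γ) :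
    toClassifying (localSection i β) = β := by
  rw [localSection, toClassifying_smul]
  exact Quotient.out_eq β

lemma localSection_toClassifying {i : ℕ} {e : MilnorE Γ} (h : e.t i ≠ 0) :
    localSection i (toClassifying e) = (MilnorE.coord i e)⁻¹ • e := by
  obtain ⟨γ, hγ⟩ := toClassifying_eq_iff.1 (Quotient.out_eq (toClassifying e))
  rw [localSection, ← hγ, MilnorE.coord_smul γ h, smul_smul]
  simp

/-- The quotient map is open, so continuity can be tested upstairs, where the section is e ↦ (g i)⁻¹
• e for every representative and does not depend on `Quotient.out`. -/
lemma continuousOn_localSection (i : ℕ) :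
    ContinuousOn (localSection i) (chartDomain Γ i) := by
  rintro _ ⟨e, he, rfl⟩
  refine ContinuousAt.continuousWithinAt ?_
  rw [ContinuousAt, ← isOpenMap_toClassifying.map_nhds_eq continuous_toClassifying.continuousAt,
    Filter.tendsto_map'_iff, localSection_toClassifying he]
  have h1 : ContinuousAt (fun e => (MilnorE.coord i e)⁻¹ • e) e :=
    (MilnorE.continuousAt_coord he).inv.smul continuousAt_id
  refine h1.tendsto.congr' ?_
  filter_upwards [(MilnorE.isOpen_t_ne_zero i).mem_nhds he] with e' he'
  exact (localSection_toClassifying he').symm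

lemma exists_mem_chartDomain (β : Classifying Γ) : ∃ i, β ∈ chartDomain Γ i := by
  obtain ⟨i, hi⟩ := MilnorE.exists_ne_zero (Quotient.out β)
  exact ⟨i, _, hi, Quotient.out_eq β⟩

/-- Two lifts differ by a continuous map to the group. -/
lemma exists_translation {T : Type*} [TopologicalSpace T] {S : Set T} {f f' : T → MilnorE Γ}
    (hf : ContinuousOn f S) (hf' : ContinuousOn f' S)
    (h : ∀ t ∈ S, toClassifying (f' t) = toClassifying (f t)) :
    ∃ γ : T → Γ, ContinuousOn γ S ∧ ∀ t ∈ S, γ t • f t = f' t := by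
  have h1 : ∀ t, ∃ γ : Γ, t ∈ S → γ • f t = f' t := fun t => by
    by_cases ht : t ∈ S
    · obtain ⟨γ, hγ⟩ := toClassifying_eq_iff.1 (h t ht)
      exact ⟨γ, fun _ => hγ⟩
    · exact ⟨1, fun h => absurd h ht⟩
  choose γ hγ using h1
  refine ⟨γ, fun t₀ ht₀ => ?_, hγ⟩
  -- The translation is unique because the action is free; near t₀ it is a quotient of the i-th
  -- coordinates of the two lifts.
  obtain ⟨i, hi⟩ := MilnorE.exists_ne_zero (f t₀)
  have hi' : (f' t₀).t i ≠ 0 := by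
    rw [← hγ t₀ ht₀]
    exact hi
  have hγ' : ∀ t ∈ S, (f t).t i ≠ 0 →
      MilnorE.coord i (f' t) * (MilnorE.coord i (f t))⁻¹ = γ t := by
    intro t ht hti
    rw [← hγ t ht, MilnorE.coord_smul _ hti, mul_inv_cancel_right]
  have hc : ContinuousWithinAt (fun t => MilnorE.coord i (f' t) * (MilnorE.coord i (f t))⁻¹) S t₀ :=
    ((MilnorE.continuousAt_coord hi').comp_continuousWithinAt (hf' t₀ ht₀)).mul
      ((MilnorE.continuousAt_coord hi).comp_continuousWithinAt (hf t₀ ht₀)).inv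
  refine hc.congr_of_eventuallyEq ?_ (hγ' t₀ ht₀ hi).symm
  filter_upwards [(hf t₀ ht₀) ((MilnorE.isOpen_t_ne_zero i).mem_nhds hi), self_mem_nhdsWithin] with t h1 h2
  exact (hγ' t h2 h1).symm

/-- The map `b` lifts to `EΓ` over the set `S`. -/
def HasLiftOn {T : Type*} [TopologicalSpace T] (b : T → Classifying Γ) (S : Set T) : Prop :=
  ∃ f : T → MilnorE Γ, ContinuousOn f S ∧ ∀ t ∈ S, toClassifying (f t) = b t

lemma HasLiftOn.mono {T : Type*} [TopologicalSpace T] {b : T → Classifying Γ} {S S' : Set T}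
    (h : HasLiftOn b S) (hS : S' ⊆ S) : HasLiftOn b S' := by
  obtain ⟨f, hf, hfb⟩ := h
  exact ⟨f, hf.mono hS, fun t ht => hfb t (hS ht)⟩

/-- On the wall x_c = a the two lifts differ by a map to Γ. Composed with the projection to the
wall, this map corrects the lift over the upper part so that both agree on the wall. The condition
`hSa` keeps the projection inside S. -/
lemma HasLiftOn.glue {N : ℕ} {b : (Fin N → ℝ) → Classifying Γ} {S : Set (Fin N → ℝ)}
    (hS : IsClosed S) (c : Fin N) (a : ℝ) (hSa : ∀ x ∈ S, a ≤ x c → Function.update x c a ∈ S)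
    (h₁ : HasLiftOn b (S ∩ {x | x c ≤ a})) (h₂ : HasLiftOn b (S ∩ {x | a ≤ x c})) :
    HasLiftOn b S := by
  obtain ⟨f₁, hf₁, hb₁⟩ := h₁
  obtain ⟨f₂, hf₂, hb₂⟩ := h₂
  obtain ⟨γ, hγ, hγf⟩ := exists_translation (S := S ∩ {x | x c = a}) (f := f₂) (f' := f₁)
    (hf₂.mono fun x hx => ⟨hx.1, hx.2.ge⟩) (hf₁.mono fun x hx => ⟨hx.1, hx.2.le⟩)
    (fun x hx => (hb₁ x ⟨hx.1, hx.2.le⟩).trans (hb₂ x ⟨hx.1, hx.2.ge⟩).symm)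
  have hupd : ∀ x ∈ S ∩ {x | a ≤ x c}, Function.update x c a ∈ S ∩ {x | x c = a} := fun x hx =>
    ⟨hSa x hx.1 hx.2, by simp⟩
  classical
  let f : (Fin N → ℝ) → MilnorE Γ := fun x =>
    if x c ≤ a then f₁ x else γ (Function.update x c a) • f₂ x
  have e₁ : ∀ x ∈ S ∩ {x | x c ≤ a}, f x = f₁ x := fun x hx => if_pos hx.2
  have e₂ : ∀ x ∈ S ∩ {x | a ≤ x c}, f x = γ (Function.update x c a) • f₂ x := by
    intro x hx
    by_cases h : x c ≤ a
    · have hxa : x c = a := le_antisymm h hx.2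
      rw [e₁ x ⟨hx.1, h⟩]
      have : Function.update x c a = x := by rw [← hxa, Function.update_eq_self]
      rw [this, hγf x ⟨hx.1, hxa⟩]
    · exact if_neg h
  have hu : S = (S ∩ {x | x c ≤ a}) ∪ (S ∩ {x | a ≤ x c}) := by
    ext x
    constructor
    · intro hx
      rcases le_total (x c) a with h | h
      · exact Or.inl ⟨hx, h⟩
      · exact Or.inr ⟨hx, h⟩
    · rintro (h | h) <;> exact h.1
  refine ⟨f, ?_, fun x hx => ?_⟩
  · rw [hu]
    refine ContinuousOn.union_of_isClosed (hf₁.congr e₁) (ContinuousOn.congr ?_ e₂)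
      (hS.inter (isClosed_le (continuous_apply c) continuous_const))
      (hS.inter (isClosed_le continuous_const (continuous_apply c)))
    refine ContinuousOn.smul (hγ.comp ?_ hupd) hf₂
    exact (continuous_id.update c continuous_const).continuousOn
  · rcases le_total (x c) a with h | h
    · rw [e₁ x ⟨hx, h⟩, hb₁ x ⟨hx, h⟩]
    · rw [e₂ x ⟨hx, h⟩, toClassifying_smul, hb₂ x ⟨hx, h⟩]

/-- Continuous maps from a cube to `BΓ` lift to `EΓ`. -/
lemma hasLiftOn_cube {N : ℕ} {b : (Fin N → ℝ) → Classifying Γ} (hb : Continuous b) :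
    HasLiftOn b (Icc 0 1) := by
  -- By the Lebesgue number lemma, a box with all sides at most δ/2 is mapped into one chart domain,
  -- where a local section exists.
  obtain ⟨δ, hδ, hcover⟩ := lebesgue_number_lemma_of_metric (s := Icc (0 : Fin N → ℝ) 1)
    (c := fun i => b ⁻¹' chartDomain Γ i) isCompact_Icc (fun i => (isOpen_chartDomain i).preimage hb)
    (fun x _ => mem_iUnion.2 (exists_mem_chartDomain (b x)))
  have hsmall : ∀ lo hi : Fin N → ℝ, 0 ≤ lo → lo ≤ hi → hi ≤ 1 → (∀ i, hi i - lo i ≤ δ / 2) →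
      HasLiftOn b (Icc lo hi) := by
    intro lo hi h0 h h1 hε
    obtain ⟨i, hi'⟩ := hcover lo ⟨h0, h.trans h1⟩
    refine ⟨localSection i ∘ b, (continuousOn_localSection i).comp hb.continuousOn fun x hx => ?_,
      fun x _ => toClassifying_localSection i (b x)⟩
    refine hi' ?_
    rw [Metric.mem_ball]
    refine lt_of_le_of_lt ((dist_pi_le_iff (by positivity : 0 ≤ δ / 2)).2 fun j => ?_) (half_lt_self hδ)
    rw [Real.dist_eq, abs_of_nonneg (sub_nonneg.2 (hx.1 j))]
    exact (sub_le_sub_right (hx.2 j) _).trans (hε j)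
  -- Induction on the set s of directions in which the box may still be long.
  have key : ∀ (s : Finset (Fin N)) (lo hi : Fin N → ℝ), 0 ≤ lo → lo ≤ hi → hi ≤ 1 →
      (∀ i ∉ s, hi i - lo i ≤ δ / 2) → HasLiftOn b (Icc lo hi) := by
    intro s
    induction s using Finset.induction_on with
    | empty => exact fun lo hi h0 h h1 hε => hsmall lo hi h0 h h1 fun i => hε i (Finset.notMem_empty i)
    | insert c s hc ih =>
      -- In direction c, slabs of width δ/2 are cut off one at a time; m bounds their number.
      have inner : ∀ (m : ℕ) (lo hi : Fin N → ℝ), 0 ≤ lo → lo ≤ hi → hi ≤ 1 →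
          (∀ i ∉ insert c s, hi i - lo i ≤ δ / 2) → hi c - lo c ≤ m * (δ / 2) →
          HasLiftOn b (Icc lo hi) := by
        intro m
        induction m with
        | zero =>
          intro lo hi h0 h h1 hε hm
          refine ih lo hi h0 h h1 fun i hi' => ?_
          by_cases hic : i = c
          · subst hic
            refine hm.trans ?_
            simp only [Nat.cast_zero, zero_mul]
            positivity
          · exact hε i (by simp [hic, hi'])
        | succ m ihm =>
          intro lo hi h0 h h1 hε hm
          by_cases hle : hi c - lo c ≤ δ / 2
          · refine ih lo hi h0 h h1 fun i hi' => ?_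
            by_cases hic : i = c
            · subst hic
              exact hle
            · exact hε i (by simp [hic, hi'])
          · push Not at hle
            have ha1 : lo c ≤ lo c + δ / 2 := by linarith
            have ha2 : lo c + δ / 2 ≤ hi c := by linarith
            refine HasLiftOn.glue isClosed_Icc c (lo c + δ / 2) (fun x hx _ => ?_) ?_ ?_
            · refine ⟨fun i => ?_, fun i => ?_⟩
              · by_cases hic : i = c
                · subst hic
                  simpa using ha1
                · simpa [hic] using hx.1 i
              · by_cases hic : i = c
                · subst hic
                  simpa using ha2
                · simpa [hic] using hx.2 i
            · refine (ih lo (Function.update hi c (lo c + δ / 2)) h0 ?_ ?_ ?_).mono ?_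
              · intro i
                by_cases hic : i = c
                · subst hic
                  simpa using ha1
                · simpa [hic] using h i
              · intro i
                by_cases hic : i = c
                · subst hic
                  simpa using ha2.trans (h1 i)
                · simpa [hic] using h1 i
              · intro i hi'
                by_cases hic : i = c
                · subst hic
                  simp
                · simpa [hic] using hε i (by simp [hic, hi'])
              · rintro x ⟨hx, hxc⟩
                refine ⟨hx.1, fun i => ?_⟩
                by_cases hic : i = c
                · subst hic
                  simpa using hxc
                · simpa [hic] using hx.2 i
            · refine (ihm (Function.update lo c (lo c + δ / 2)) hi ?_ ?_ h1 ?_ ?_).mono ?_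
              · intro i
                by_cases hic : i = c
                · subst hic
                  simpa using (h0 i).trans ha1
                · simpa [hic] using h0 i
              · intro i
                by_cases hic : i = c
                · subst hic
                  simpa using ha2
                · simpa [hic] using h i
              · intro i hi'
                have hic : i ≠ c := fun h => hi' (by simp [h])
                simpa [hic] using hε i hi'
              · simp only [Function.update_self]
                push_cast at hm
                linarith
              · rintro x ⟨hx, hxc⟩
                refine ⟨fun i => ?_, hx.2⟩
                by_cases hic : i = c
                · subst hic
                  simpa using hxc
                · simpa [hic] using hx.1 i
      intro lo hi h0 h h1 hε
      obtain ⟨m, hm⟩ := exists_nat_ge ((hi c - lo c) / (δ / 2))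
      exact inner m lo hi h0 h h1 hε ((div_le_iff₀ (by positivity)).1 hm)
  exact key Finset.univ 0 1 le_rfl zero_le_one le_rfl fun i hi => absurd (Finset.mem_univ i) hi

/-- A retraction of Euclidean space onto the standard simplex. -/
lemma exists_retraction_stdSimplex (n : ℕ) :
    ∃ r : C(Fin (n + 1) → ℝ, stdSimplex ℝ (Fin (n + 1))), ∀ x : stdSimplex ℝ (Fin (n + 1)), r x = x := by
  let P : (Fin (n + 1) → ℝ) → ℝ := fun x => ∑ j, max (x j) 0
  -- Negative coordinates are clipped, and the deficit from total 1 is added to every coordinate.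
  -- The total is then at least 1, so normalisation is continuous, and points of the simplex do not
  -- move.
  let y : (Fin (n + 1) → ℝ) → Fin (n + 1) → ℝ := fun x i => max (x i) 0 + max 0 (1 - P x)
  have hP : Continuous P := by fun_prop
  have hy : Continuous y := by fun_prop
  have hy0 : ∀ x i, 0 ≤ y x i := fun x i => add_nonneg (le_max_right _ _) (le_max_left _ _)
  have hsum : ∀ x, 1 ≤ ∑ i, y x i := by
    intro x
    have h1 : ∑ i, y x i = P x + (n + 1) * max 0 (1 - P x) := by
      simp [y, P, Finset.sum_add_distrib]
    have h2 : 0 ≤ max 0 (1 - P x) := le_max_left _ _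
    have h3 : 1 - P x ≤ max 0 (1 - P x) := le_max_right _ _
    have h4 : 0 ≤ (n : ℝ) * max 0 (1 - P x) := by positivity
    rw [h1]
    linarith
  have hpos : ∀ x, 0 < ∑ i, y x i := fun x => lt_of_lt_of_le one_pos (hsum x)
  refine ⟨⟨fun x => ⟨fun i => y x i / ∑ j, y x j, fun i => div_nonneg (hy0 x i) (hpos x).le, ?_⟩, ?_⟩, ?_⟩
  · rw [← Finset.sum_div, div_self (hpos x).ne']
  · refine Continuous.subtype_mk (continuous_pi fun i => ?_) _
    exact ((continuous_apply i).comp hy).div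
      (continuous_finsetSum _ fun j _ => (continuous_apply j).comp hy) fun x => (hpos x).ne'
  · intro x
    have h1 : ∀ i, max (x.1 i) 0 = x.1 i := fun i => max_eq_left (x.2.1 i)
    have h2 : P x.1 = 1 := by
      simp only [P, h1]
      exact x.2.2
    have h3 : ∀ i, y x.1 i = x.1 i := fun i => by simp [y, h1, h2]
    refine Subtype.ext (funext fun i => ?_)
    change y x.1 i / ∑ j, y x.1 j = x.1 i
    simp only [h3]
    rw [show ∑ j, x.1 j = 1 from x.2.2, div_one]

/-- Singular simplices of `BΓ` lift to `EΓ`. -/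
theorem exists_lift_stdSimplex {n : ℕ} (b : C(stdSimplex ℝ (Fin (n + 1)), Classifying Γ)) :
    ∃ f : C(stdSimplex ℝ (Fin (n + 1)), MilnorE Γ), ∀ x, toClassifying (f x) = b x := by
  obtain ⟨r, hr⟩ := exists_retraction_stdSimplex n
  -- The retraction extends b to Euclidean space; the lift over the unit cube is restricted to the
  -- simplex, which lies in the cube.
  obtain ⟨f, hf, hfb⟩ := hasLiftOn_cube (b.continuous.comp r.continuous)
  have hmem : ∀ x : stdSimplex ℝ (Fin (n + 1)), x.1 ∈ Icc (0 : Fin (n + 1) → ℝ) 1 := fun x =>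
    ⟨x.2.1, fun i => (Finset.single_le_sum (fun j _ => x.2.1 j) (Finset.mem_univ i)).trans_eq x.2.2⟩
  refine ⟨⟨fun x => f x.1, hf.comp_continuous continuous_subtype_val hmem⟩, fun x => ?_⟩
  exact (hfb x.1 (hmem x)).trans (congrArg b (hr x))

variable {X : Type u} [TopologicalSpace X] [MulAction Γ X]

/-- The projection `EΓ × X → EΓ ×_Γ X`. -/
def toBorel (z : MilnorE Γ × X) : Borel Γ X := Quotient.mk'' z

lemma continuous_toBorel : Continuous (toBorel (Γ := Γ) (X := X)) := continuous_quotient_mk'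

lemma toBorel_eq_iff {z z' : MilnorE Γ × X} : toBorel z = toBorel z' ↔ ∃ γ : Γ, γ • z' = z :=
  Quotient.eq''

lemma toBorel_injective_right (e : MilnorE Γ) {x x' : X} (h : toBorel (e, x) = toBorel (e, x')) :
    x = x' := by
  obtain ⟨γ, hγ⟩ := toBorel_eq_iff.1 h
  have h1 : γ = 1 := MilnorE.eq_one_of_smul_eq (congrArg Prod.fst hγ)
  subst h1
  exact (congrArg Prod.snd hγ).symm.trans (one_smul Γ x')

/-- A map to the Borel construction with a lift of its projection to `EΓ` is given by a continuous
map to the fibre. -/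
theorem exists_fibre_coordinate [ContinuousSMul Γ X] {T : Type*} [TopologicalSpace T]
    (f : C(T, MilnorE Γ)) (e : C(T, Borel Γ X))
    (h : ∀ t, borelProj Γ X (e t) = toClassifying (f t)) :
    ∃ x : C(T, X), ∀ t, toBorel (f t, x t) = e t := by
  have h1 : ∀ t, ∃ x : X, toBorel (f t, x) = e t := by
    intro t
    obtain ⟨⟨e', x'⟩, hz⟩ : ∃ z, toBorel z = e t := Quotient.exists_rep (e t)
    obtain ⟨γ, hγ⟩ := toClassifying_eq_iff.1 (show toClassifying (f t) = toClassifying e' by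
      rw [← h, ← hz]
      rfl)
    refine ⟨γ • x', ?_⟩
    rw [← hz]
    exact toBorel_eq_iff.2 ⟨γ, Prod.ext hγ rfl⟩
  choose x hx using h1
  refine ⟨⟨x, continuous_iff_continuousAt.2 fun t₀ => ?_⟩, hx⟩
  obtain ⟨i, hi⟩ := MilnorE.exists_ne_zero (f t₀)
  -- A local fibre coordinate: (g i)⁻¹ • x is invariant under the diagonal action wherever t i ≠ 0,
  -- hence continuous on the quotient there. The fibre coordinate relative to f is recovered as (g i
  -- of f) • ξ.
  let ξ : Borel Γ X → X := fun y => (MilnorE.coord i (Quotient.out y).1)⁻¹ • (Quotient.out y).2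
  have hξ : ∀ z : MilnorE Γ × X, z.1.t i ≠ 0 →
      ξ (toBorel z) = (MilnorE.coord i z.1)⁻¹ • z.2 := by
    intro z hz
    obtain ⟨γ, hγ⟩ := toBorel_eq_iff.1 (Quotient.out_eq (toBorel z))
    change (MilnorE.coord i (Quotient.out (toBorel z)).1)⁻¹ • (Quotient.out (toBorel z)).2 = _
    rw [← hγ, Prod.smul_fst, Prod.smul_snd, MilnorE.coord_smul γ hz, smul_smul]
    simp
  have hopen : IsOpenMap (toBorel (Γ := Γ) (X := X)) := isOpenMap_quotient_mk'_mul
  have hcont : ContinuousAt ξ (e t₀) := by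
    rw [← hx t₀, ContinuousAt, ← hopen.map_nhds_eq continuous_toBorel.continuousAt,
      Filter.tendsto_map'_iff, hξ (f t₀, x t₀) hi]
    have h1 : ContinuousAt (fun z : MilnorE Γ × X => (MilnorE.coord i z.1)⁻¹ • z.2) (f t₀, x t₀) :=
      (ContinuousAt.comp (f := Prod.fst) (x := (f t₀, x t₀)) (MilnorE.continuousAt_coord hi)
        continuousAt_fst).inv.smul continuousAt_snd
    refine h1.tendsto.congr' ?_
    filter_upwards [continuousAt_fst ((MilnorE.isOpen_t_ne_zero i).mem_nhds hi)] with z hz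
    exact (hξ z hz).symm
  have h2 : ContinuousAt (fun t => MilnorE.coord i (f t) • ξ (e t)) t₀ :=
    ((MilnorE.continuousAt_coord hi).comp f.continuous.continuousAt).smul
      (hcont.comp e.continuous.continuousAt)
  refine h2.congr ?_
  filter_upwards [f.continuous.continuousAt ((MilnorE.isOpen_t_ne_zero i).mem_nhds hi)] with t ht
  rw [← hx t, hξ (f t, x t) ht, smul_smul, mul_inv_cancel, one_smul]

end Lifting

end Halving

namespace Halving

open CategoryTheory Simplicial Opposite MonoidalCategory CartesianMonoidalCategory

/-! ### The Borel construction over a singular simplex -/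

section BorelSimplices

/-- The singular simplicial set. -/
noncomputable abbrev Sing (Y : Type u) [TopologicalSpace Y] : SSet.{u} :=
  TopCat.toSSet.obj (TopCat.of Y)

/-- The map of singular simplicial sets induced by a continuous map. -/
noncomputable abbrev singMap {Y Z : Type u} [TopologicalSpace Y] [TopologicalSpace Z] (f : C(Y, Z)) :
    Sing Y ⟶ Sing Z :=
  TopCat.toSSet.map (TopCat.ofHom f)

variable {Y Z : Type u} [TopologicalSpace Y] [TopologicalSpace Z]

/-- A singular simplex as a continuous map. -/
noncomputable def simplexMap {n : SimplexCategoryᵒᵖ} (s : (Sing Y).obj n) :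
    C(SimplexCategory.toTop.{u}.obj n.unop, Y) := (ULift.down s).hom

/-- A continuous map as a singular simplex. -/
noncomputable def mkSimplex {n : SimplexCategoryᵒᵖ} (f : C(SimplexCategory.toTop.{u}.obj n.unop, Y)) :
    (Sing Y).obj n := ULift.up (TopCat.ofHom f)

lemma simplexMap_injective {n : SimplexCategoryᵒᵖ} {s s' : (Sing Y).obj n}
    (h : ∀ t, simplexMap s t = simplexMap s' t) : s = s' :=
  congrArg mkSimplex (ContinuousMap.ext h)

variable {Γ : Type u} [Group Γ] [TopologicalSpace Γ] {X : Type u} [TopologicalSpace X]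
  [MulAction Γ X]

variable (Γ) in
/-- The projection `EΓ → BΓ` on singular simplices. -/
noncomputable def singToClassifying : Sing (MilnorE Γ) ⟶ Sing (Classifying Γ) :=
  singMap ⟨toClassifying, continuous_quotient_mk'⟩

lemma exists_simplex_lift [IsTopologicalGroup Γ] {m : ℕ} (b : (Sing (Classifying Γ)) _⦋m⦌) :
    ∃ f : (Δ[m] : SSet.{u}) ⟶ Sing (MilnorE Γ),
      (singToClassifying Γ).app _ (SSet.yonedaEquiv f) = b := by
  obtain ⟨f, hf⟩ := exists_lift_stdSimplex
    ((simplexMap b).comp ⟨ULift.up, continuous_uliftUp⟩ : C(stdSimplex ℝ (Fin (m + 1)), _))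
  refine ⟨SSet.yonedaEquiv.symm (mkSimplex (f.comp ⟨ULift.down, continuous_uliftDown⟩)), ?_⟩
  rw [Equiv.apply_symm_apply]
  exact simplexMap_injective fun t => hf t.down

variable (Γ X) in
/-- The projection `EΓ × X → EΓ ×_Γ X` on singular simplices. -/
noncomputable def singToBorel : Sing (MilnorE Γ) ⊗ Sing X ⟶ Sing (Borel Γ X) where
  app n := ↾ fun z : (Sing (MilnorE Γ)).obj n × (Sing X).obj n =>
    mkSimplex ((⟨toBorel, continuous_quotient_mk'⟩ : C(MilnorE Γ × X, Borel Γ X)).comp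
      ((simplexMap z.1).prodMk (simplexMap z.2)))
  naturality _ _ _ := rfl

variable (X) in
/-- The restriction of `EΓ ×_Γ X` to a simplex of `EΓ`. -/
noncomputable def borelOver {m : ℕ} (f : (Δ[m] : SSet.{u}) ⟶ Sing (MilnorE Γ)) :
    (Δ[m] : SSet.{u}) ⊗ Sing X ⟶ Sing (Borel Γ X) :=
  f ▷ Sing X ≫ singToBorel Γ X

lemma borelOver_comp {l m : ℕ} (θ : (Δ[l] : SSet.{u}) ⟶ Δ[m])
    (f : (Δ[m] : SSet.{u}) ⟶ Sing (MilnorE Γ)) :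
    borelOver X (θ ≫ f) = θ ▷ Sing X ≫ borelOver X f := rfl

/-- A lift of the simplex to EΓ trivialises the bundle over it: freeness of the action gives
injectivity, and `exists_fibre_coordinate` gives surjectivity on singular simplices. -/
lemma exists_iso_pullback [IsTopologicalGroup Γ] [ContinuousSMul Γ X] {m : ℕ}
    (f : (Δ[m] : SSet.{u}) ⟶ Sing (MilnorE Γ)) :
    ∃ j : (Δ[m] : SSet.{u}) ⊗ Sing X ⟶ (pullbackFunctor (singMap (borelProj Γ X))).obj
        (simplexOver ((singToClassifying Γ).app _ (SSet.yonedaEquiv f))),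
      IsIso j ∧ j ≫ pullbackSnd _ _ = borelOver X f := by
  set b := (singToClassifying Γ).app _ (SSet.yonedaEquiv f) with hb
  have hbf : (simplexOver b).hom = f ≫ singToClassifying Γ := by
    change SSet.yonedaEquiv.symm b = _
    rw [Equiv.symm_apply_eq, hb, SSet.yonedaEquiv_comp]
  have hbf' : ∀ n (θ : (Δ[m] : SSet.{u}).obj n) t,
      simplexMap ((simplexOver b).hom.app n θ) t = toClassifying (simplexMap (f.app n θ) t) := by
    intro n θ t
    rw [hbf]
    rfl
  let j : (Δ[m] : SSet.{u}) ⊗ Sing X ⟶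
      (pullbackFunctor (singMap (borelProj Γ X))).obj (simplexOver b) :=
    { app := fun n => ↾ fun z : (Δ[m] : SSet.{u}).obj n × (Sing X).obj n =>
        ⟨(z.1, (borelOver X f).app n z), simplexMap_injective fun t => hbf' n z.1 t⟩
      naturality := fun n n' φ => by
        refine ConcreteCategory.hom_ext _ _ fun x => ?_
        exact Subtype.ext (Prod.ext rfl (app_map (borelOver X f) φ.unop x)) }
  refine ⟨j, ?_, rfl⟩
  have hj : ∀ n, IsIso (j.app n) := by
    intro n
    rw [isIso_iff_bijective]
    constructor
    · rintro ⟨θ, x⟩ ⟨θ', x'⟩ h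
      have h1 : θ = θ' := congrArg (fun y => y.1.1) h
      subst h1
      have h2 : (borelOver X f).app n (show (Δ[m] ⊗ Sing X : SSet.{u}).obj n from (θ, x)) =
        (borelOver X f).app n (show (Δ[m] ⊗ Sing X : SSet.{u}).obj n from (θ, x')) :=
        congrArg (fun y => y.1.2) h
      refine Prod.ext rfl (simplexMap_injective fun t => ?_)
      have h3 := congrArg (fun s => simplexMap s t) h2
      exact toBorel_injective_right _ h3
    · rintro ⟨⟨θ, y⟩, h⟩
      obtain ⟨x, hx⟩ := exists_fibre_coordinate (simplexMap (f.app n θ)) (simplexMap y) fun t =>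
        (congrArg (fun s => simplexMap s t) h).symm.trans (hbf' n θ t)
      refine ⟨(θ, mkSimplex x), Subtype.ext (Prod.ext rfl (simplexMap_injective fun t => ?_))⟩
      exact hx t
  exact NatIso.isIso_of_isIso_app j

end BorelSimplices

/-! ### The fibre condition over all simplices of BΓ -/

section LerayHirschBorel

variable {R : Type v} [Field R] {Γ : Type u} [Group Γ] [TopologicalSpace Γ] [IsTopologicalGroup Γ]
  {X : Type u} [TopologicalSpace X] [MulAction Γ X] [ContinuousSMul Γ X]
  (τ : ∀ q, HDeg R X q →ₗ[R] HDeg R (Borel Γ X) q)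

/-- The map Δ[l] × Sing X → Δ[m] × Sing X commutes with the projections to Sing X, so it is an
isomorphism in cohomology. Hence the fibre condition passes between a simplex and its vertices. -/
lemma bijective_borelOver_comp_iff {l m : ℕ} (θ : (Δ[l] : SSet.{u}) ⟶ Δ[m])
    (f : (Δ[m] : SSet.{u}) ⟶ Sing (MilnorE Γ)) (q : ℕ) :
    (Function.Bijective fun v => scohomologyMap R (borelOver X (θ ≫ f)) q (τ q v)) ↔
      Function.Bijective fun v => scohomologyMap R (borelOver X f) q (τ q v) := by
  have h1 : Function.Bijective (scohomologyMap R (θ ▷ Sing X) q) := by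
    have h2 : θ ▷ Sing X ≫ snd _ _ = snd _ _ := whiskerRight_snd θ _
    have h3 := scohomologyMap_snd_bijective (R := R) l (Sing X) q
    rw [← h2] at h3
    have h4 : ⇑(scohomologyMap R (θ ▷ Sing X ≫ snd _ _) q) =
        scohomologyMap R (θ ▷ Sing X) q ∘ scohomologyMap R (snd _ _) q :=
      funext fun x => scohomologyMap_comp _ _ _ _
    rw [h4] at h3
    exact (Function.Bijective.of_comp_iff _ (scohomologyMap_snd_bijective m (Sing X) q)).1 h3
  rw [← Function.Bijective.of_comp_iff' h1]
  refine iff_of_eq (congrArg _ (funext fun v => ?_))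
  rw [borelOver_comp, scohomologyMap_comp]
  rfl

lemma bijective_pullbackSnd_iff {m : ℕ} (f : (Δ[m] : SSet.{u}) ⟶ Sing (MilnorE Γ)) (q : ℕ) :
    (Function.Bijective fun v => scohomologyMap R (pullbackSnd (singMap (borelProj Γ X))
      (simplexOver ((singToClassifying Γ).app _ (SSet.yonedaEquiv f)))) q (τ q v)) ↔
      Function.Bijective fun v => scohomologyMap R (borelOver X f) q (τ q v) := by
  obtain ⟨j, hj, hjf⟩ := exists_iso_pullback (X := X) f
  rw [← Function.Bijective.of_comp_iff' (scohomologyMap_bijective_of_isIso (R := R) j q), ← hjf]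
  refine iff_of_eq (congrArg _ (funext fun v => ?_))
  rw [scohomologyMap_comp]
  rfl

/-- Over the base vertex the restriction is the fibre inclusion up to Δ[0] × Sing X ≃ Sing X, and
`τ` is a section of its pullback. -/
lemma bijective_borelOver_base (q : ℕ)
    (hτ : ∀ x, scohomologyMap R (singMap (fibreInclusion Γ X)) q (τ q x) = x) :
    Function.Bijective fun v => scohomologyMap R (borelOver X (SSet.yonedaEquiv.symm
      (mkSimplex (.const _ MilnorE.base)) : (Δ[0] : SSet.{u}) ⟶ Sing (MilnorE Γ))) q (τ q v) := by
  set f : (Δ[0] : SSet.{u}) ⟶ Sing (MilnorE Γ) := SSet.yonedaEquiv.symm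
      (mkSimplex (.const _ MilnorE.base)) with hf
  let s : Sing X ⟶ (Δ[0] : SSet.{u}) ⊗ Sing X :=
    lift (SSet.stdSimplex.isTerminalObj₀.from _) (𝟙 _)
  have h1 : s ≫ snd _ _ = 𝟙 _ := lift_snd _ _
  have h2 : s ≫ borelOver X f = singMap (fibreInclusion Γ X) := rfl
  have h3 : Function.Bijective (scohomologyMap R s q) := by
    have h4 : ⇑(scohomologyMap R (s ≫ snd _ _) q) =
        scohomologyMap R s q ∘ scohomologyMap R (snd _ _) q :=
      funext fun x => scohomologyMap_comp _ _ _ _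
    refine (Function.Bijective.of_comp_iff _ (scohomologyMap_snd_bijective 0 (Sing X) q)).1 ?_
    rw [← h4, h1]
    exact scohomologyMap_bijective_of_isIso _ _
  rw [← Function.Bijective.of_comp_iff' h3]
  convert! Function.bijective_id using 1
  funext v
  change scohomologyMap R s q (scohomologyMap R (borelOver X f) q (τ q v)) = v
  rw [← scohomologyMap_comp, h2, hτ]

/-- Classes that restrict to a basis of the cohomology of the fibre over the base point restrict to
bases over all simplices of `BΓ`, if `BΓ` is connected. -/
theorem restrictsToBases_borelProj
    (h0 : ∀ a : HDeg R (Classifying Γ) 0, ∃ r : R, a = r • cls R _ 0 (oneCocycle R _))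
    (hτ : ∀ q x, scohomologyMap R (singMap (fibreInclusion Γ X)) q (τ q x) = x) :
    RestrictsToBases (singMap (borelProj Γ X)) τ := by
  intro m b q
  let G : ∀ {l : ℕ}, (Sing (Classifying Γ)) _⦋l⦌ → Prop := fun b =>
    Function.Bijective fun v => scohomologyMap R (pullbackSnd (singMap (borelProj Γ X))
      (simplexOver b)) q (τ q v)
  have hG : ∀ {k l : ℕ} (θ : ⦋k⦌ ⟶ ⦋l⦌) (b : (Sing (Classifying Γ)) _⦋l⦌),
      G ((Sing (Classifying Γ)).map θ.op b) ↔ G b := by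
    intro k l θ b
    obtain ⟨f, rfl⟩ := exists_simplex_lift b
    have h1 : (Sing (Classifying Γ)).map θ.op ((singToClassifying Γ).app _ (SSet.yonedaEquiv f)) =
        (singToClassifying Γ).app _ (SSet.yonedaEquiv (SSet.stdSimplex.map θ ≫ f)) := by
      rw [← app_map]
      congr 1
      exact (SSet.yonedaEquiv_naturality _ _)
    rw [h1]
    exact (bijective_pullbackSnd_iff τ _ q).trans ((bijective_borelOver_comp_iff τ _ f q).trans
      (bijective_pullbackSnd_iff τ f q).symm)
  classical
  -- Connectedness enters only through H^0: by `hG` the indicator function of the fibre condition is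
  -- a 0-cocycle, hence constant, and it is 1 at the base point.
  let c : Cochain R (Sing (Classifying Γ)) 0 := fun b => if G b then 1 else 0
  have hc : c ∈ cocycles R (Sing (Classifying Γ)) 0 := by
    rw [cocycles, LinearMap.mem_ker]
    funext s
    have h1 : ∀ i : Fin 2, c ((Sing (Classifying Γ)).δ i s) = if G s then 1 else 0 := fun i => by
      exact if_congr (hG (SimplexCategory.δ i) s) rfl rfl
    change ∑ i : Fin 2, (-1 : R) ^ (i : ℕ) * c ((Sing (Classifying Γ)).δ i s) = 0
    simp only [h1, Fin.sum_univ_two, ← add_mul]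
    simp
  obtain ⟨r, hr⟩ := h0 (cls R _ 0 ⟨c, hc⟩)
  rw [← map_smul, cls_eq_iff] at hr
  have hcr : ∀ b, c b = r := by
    intro b
    have h1 := congrFun (sub_eq_zero.1 (show c - r • (oneCocycle R _).1 = 0 from hr)) b
    rw [h1]
    exact mul_one r
  have hbase : G ((singToClassifying Γ).app _ (mkSimplex (n := op ⦋0⦌) (.const _ MilnorE.base))) := by
    have := (bijective_pullbackSnd_iff τ _ q).2 (bijective_borelOver_base τ q (hτ q))
    rwa [Equiv.apply_symm_apply] at this
  have hr1 : r = 1 := by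
    rw [← hcr ((singToClassifying Γ).app _ (mkSimplex (n := op ⦋0⦌) (.const _ MilnorE.base)))]
    exact if_pos hbase
  refine (hG (SimplexCategory.const ⦋0⦌ ⦋m⦌ 0) b).1 ?_
  by_contra h
  have h2 := hcr ((Sing (Classifying Γ)).map (SimplexCategory.const ⦋0⦌ ⦋m⦌ 0).op b)
  rw [show c ((Sing (Classifying Γ)).map (SimplexCategory.const ⦋0⦌ ⦋m⦌ 0).op b) = 0 from if_neg h,
    hr1] at h2
  exact zero_ne_one h2

end LerayHirschBorel

end Halving

namespace Halving

open CategoryTheory DirectSum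

section Pullback

variable {R : Type v} [CommRing R] {X Y Z : Type u} [TopologicalSpace X] [TopologicalSpace Y]
  [TopologicalSpace Z]

lemma pullback_of (f : C(X, Y)) (n : ℕ) (x : HDeg R Y n) :
    pullback R f (of (HDeg R Y) n x) = of (HDeg R X) n (scohomologyMap R (singMap f) n x) :=
  DirectSum.toAddMonoid_of _ _ _

lemma pullback_comp (g : C(Y, Z)) (f : C(X, Y)) (x : HRing R Z) :
    pullback R f (pullback R g x) = pullback R (g.comp f) x := by
  induction x using DirectSum.induction_on with
  | zero => simp only [map_zero]
  | of n x =>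
    rw [pullback_of, pullback_of, pullback_of, ← scohomologyMap_comp]
    rfl
  | add x y hx hy => simp only [map_add, hx, hy]

lemma pullback_id (x : HRing R X) : pullback R (.id X) x = x := by
  induction x using DirectSum.induction_on with
  | zero => simp only [map_zero]
  | of n x =>
    rw [pullback_of]
    exact congrArg _ (scohomologyMap_id n x)
  | add x y hx hy => simp only [map_add, hx, hy]

lemma pullback_mem_degreePart (f : C(X, Y)) {n : ℕ} {x : HRing R Y} (hx : x ∈ degreePart R Y n) :
    pullback R f x ∈ degreePart R X n := by
  obtain ⟨x, rfl⟩ := hx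
  exact ⟨_, (pullback_of f n x).symm⟩

lemma of_mul_of_eq_cup {p q n : ℕ} (h : p + q = n) (a : HDeg R X p) (b : HDeg R X q) :
    of (HDeg R X) p a * of (HDeg R X) q b = of (HDeg R X) n (cup h a b) := by
  subst h
  exact DirectSum.of_mul_of a b

lemma mul_mem_degreePart {p q n : ℕ} (h : p + q = n) {a b : HRing R X} (ha : a ∈ degreePart R X p)
    (hb : b ∈ degreePart R X q) : a * b ∈ degreePart R X n := by
  obtain ⟨a, rfl⟩ := ha
  obtain ⟨b, rfl⟩ := hb
  exact ⟨_, (of_mul_of_eq_cup h a b).symm⟩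

lemma one_mem_degreePart : (1 : HRing R X) ∈ degreePart R X 0 :=
  ⟨_, rfl⟩

lemma mem_degreePart_of_forall {n : ℕ} {x : HRing R X} (h : ∀ m, m ≠ n → x m = 0) :
    x ∈ degreePart R X n := by
  refine ⟨x n, DFinsupp.ext fun m => ?_⟩
  change of (HDeg R X) n (x n) m = x m
  by_cases hm : n = m
  · subst hm
    exact DirectSum.of_eq_same _ _
  · rw [h m (Ne.symm hm)]
    exact DirectSum.of_eq_of_ne _ _ _ (Ne.symm hm)

lemma apply_eq_zero_of_mem_degreePart {m n : ℕ} (h : m ≠ n) {x : HRing R X}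
    (hx : x ∈ degreePart R X n) : x m = 0 := by
  obtain ⟨x, rfl⟩ := hx
  exact DirectSum.of_eq_of_ne _ _ _ h

end Pullback

/-! ### The cohomology of BΓ and centrality of the generator -/

section HalvingPair

variable {R : Type v} [Field R] {Γ : Type u} [Group Γ] [TopologicalSpace Γ] {D : ℕ}
  {u : HDeg R (Classifying Γ) D}

/-- The component of degree `n` of the power of the generator which may have this degree. -/
noncomputable def generatorPow (u : HDeg R (Classifying Γ) D) (n : ℕ) : HDeg R (Classifying Γ) n :=
  (of (HDeg R (Classifying Γ)) D u ^ (n / D)) n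

lemma pow_mem_degreePart (u : HDeg R (Classifying Γ) D) (k : ℕ) :
    of (HDeg R (Classifying Γ)) D u ^ k ∈ degreePart R (Classifying Γ) (k * D) := by
  induction k with
  | zero => simpa using one_mem_degreePart
  | succ k ih =>
    rw [pow_succ]
    exact mul_mem_degreePart (by ring) ih ⟨u, rfl⟩

lemma of_generatorPow (hD : 0 < D) (k : ℕ) :
    of (HDeg R (Classifying Γ)) (k * D) (generatorPow u (k * D)) =
      of (HDeg R (Classifying Γ)) D u ^ k := by
  obtain ⟨x, hx⟩ := pow_mem_degreePart u k
  change of _ _ x = _ at hx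
  rw [generatorPow, Nat.mul_div_cancel _ hD, ← hx, DirectSum.of_eq_same]

/-- Rounding down in n / D is harmless: the power is then homogeneous of a degree different from n.
-/
lemma generatorPow_eq_zero {n : ℕ} (h : ¬ D ∣ n) : generatorPow u n = 0 :=
  apply_eq_zero_of_mem_degreePart (fun h' => h ⟨n / D, by rw [mul_comm]; exact h'⟩)
    (pow_mem_degreePart u (n / D))

namespace IsHalvingPair

variable (hu : IsHalvingPair D u)
include hu

/-- In the polynomial representing a class, only the exponent n / D can contribute to degree n. Thus
every H^n(BΓ) is spanned by one element, which is zero unless D ∣ n. -/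
lemma exists_eq_smul {n : ℕ} (a : HDeg R (Classifying Γ) n) : ∃ r : R, a = r • generatorPow u n := by
  obtain ⟨p, hp⟩ := hu.bijective.2 (of _ n a)
  refine ⟨p.coeff (n / D), ?_⟩
  have h1 := congrArg (fun x : HRing R (Classifying Γ) => x n) hp
  change _ = of _ n a n at h1
  rw [DirectSum.of_eq_same] at h1
  rw [← h1]
  change DirectSum.component R ℕ _ n _ = _
  rw [Polynomial.aeval_eq_sum_range' (n := max (p.natDegree + 1) (n / D + 1)) (by omega), map_sum,
    Finset.sum_eq_single (n / D)]
  · rw [map_smul]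
    rfl
  · intro k _ hk
    rw [map_smul]
    convert! smul_zero _ using 2
    refine apply_eq_zero_of_mem_degreePart (fun h => hk ?_) (pow_mem_degreePart u k)
    rw [h, Nat.mul_div_cancel _ hu.pos]
  · intro h
    exact absurd (Finset.mem_range.2 (by omega)) h

lemma pow_ne_zero (k : ℕ) : of (HDeg R (Classifying Γ)) D u ^ k ≠ 0 := by
  intro h
  have h1 : (Polynomial.X ^ k : Polynomial R) = 0 := hu.bijective.1 (by simpa using h)
  exact _root_.pow_ne_zero k Polynomial.X_ne_zero h1

lemma generatorPow_ne_zero (k : ℕ) : generatorPow u (k * D) ≠ 0 := by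
  intro h
  apply hu.pow_ne_zero k
  rw [← of_generatorPow hu.pos, h, map_zero]

omit hu in
lemma generatorPow_zero : generatorPow u 0 = cls R _ 0 (oneCocycle R _) := by
  rw [generatorPow, Nat.zero_div, pow_zero]
  exact DirectSum.of_eq_same _ _

/-- The generator has even degree or the characteristic is `2`. -/
lemma neg_one_pow : (-1 : R) ^ D = 1 := by
  have h1 := cup_graded_comm (R := R) (rfl : D + D = D + D) rfl u u
  have h2 : cup (rfl : D + D = D + D) u u ≠ 0 := by
    intro h
    apply hu.pow_ne_zero 2
    rw [pow_two, of_mul_of_eq_cup rfl, h, map_zero]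
  -- As u² ≠ 0, commuting u with itself forces (-1)^(D·D) = 1, and D·D has the parity of D.
  have h3 : ((-1 : R) ^ (D * D) - 1) • cup (rfl : D + D = D + D) u u = 0 := by
    rw [sub_smul, one_smul, ← h1, sub_self]
  have h4 := sub_eq_zero.1 ((smul_eq_zero.1 h3).resolve_right h2)
  rcases Nat.even_or_odd D with h | h
  · exact h.neg_one_pow
  · rw [(h.mul h).neg_one_pow] at h4
    rw [h4, one_pow]

/-- Elements of the degree of the generator are central. -/
lemma commute_of {Y : Type u} [TopologicalSpace Y] (a : HDeg R Y D) (y : HRing R Y) :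
    Commute (of (HDeg R Y) D a) y := by
  induction y using DirectSum.induction_on with
  | zero => exact Commute.zero_right _
  | of n y =>
    change _ * _ = _ * _
    rw [of_mul_of_eq_cup rfl, of_mul_of_eq_cup (Nat.add_comm n D),
      cup_graded_comm rfl (Nat.add_comm n D), pow_mul, hu.neg_one_pow, one_pow, one_smul]
  | add x y hx hy => exact hx.add_right hy

end IsHalvingPair

end HalvingPair

/-! ### The Leray–Hirsch theorem for the Borel construction -/

section LerayHirschMap

variable {R : Type v} [Field R] {Γ : Type u} [Group Γ] [TopologicalSpace Γ] {D : ℕ}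
  {X : Type u} [TopologicalSpace X] [MulAction Γ X]

variable (X) in
/-- The generator as an equivariant class. -/
noncomputable def eqGenerator (u : HDeg R (Classifying Γ) D) : EqRing R Γ X :=
  fromClassifying R Γ X (of (HDeg R (Classifying Γ)) D u)

lemma IsHalvingPair.commute_eqGenerator {u : HDeg R (Classifying Γ) D} (hu : IsHalvingPair D u)
    (y : EqRing R Γ X) : Commute (eqGenerator X u) y := by
  rw [eqGenerator, fromClassifying, pullback_of]
  exact hu.commute_of _ y

/-- The map `(vₖ) ↦ ∑ₖ σ(vₖ) uᵏ`. -/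
noncomputable def lerayHirschMap (u : HDeg R (Classifying Γ) D) (σ : HRing R X →ₗ[R] EqRing R Γ X) :
    (ℕ →₀ HRing R X) →ₗ[R] EqRing R Γ X :=
  Finsupp.lsum R fun k => LinearMap.mulRight R (eqGenerator X u ^ k) ∘ₗ σ

lemma lerayHirschMap_single (u : HDeg R (Classifying Γ) D) (σ : HRing R X →ₗ[R] EqRing R Γ X) (k : ℕ)
    (x : HRing R X) : lerayHirschMap u σ (Finsupp.single k x) = σ x * eqGenerator X u ^ k := by
  simp [lerayHirschMap]

/-- The components of a degree-preserving map. -/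
noncomputable def degreeComponent (σ : HRing R X →ₗ[R] EqRing R Γ X) (q : ℕ) :
    HDeg R X q →ₗ[R] HDeg R (Borel Γ X) q :=
  DirectSum.component R ℕ _ q ∘ₗ σ ∘ₗ DirectSum.lof R ℕ _ q

namespace IsLerayHirschSection

variable {σ : HRing R X →ₗ[R] EqRing R Γ X} (hσ : IsLerayHirschSection σ)
include hσ

lemma apply_of (q : ℕ) (x : HDeg R X q) :
    σ (of (HDeg R X) q x) = of (HDeg R (Borel Γ X)) q (degreeComponent σ q x) := by
  obtain ⟨y, hy⟩ := hσ.degree q (of (HDeg R X) q x) ⟨x, rfl⟩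
  change of _ q y = _ at hy
  change _ = of _ q (σ (of _ q x) q)
  rw [← hy, DirectSum.of_eq_same]

lemma scohomologyMap_degreeComponent (q : ℕ) (x : HDeg R X q) :
    scohomologyMap R (singMap (fibreInclusion Γ X)) q (degreeComponent σ q x) = x := by
  have h := hσ.section_eq (of (HDeg R X) q x)
  rw [hσ.apply_of, forget, pullback_of] at h
  exact DirectSum.of_injective q h

variable [IsTopologicalGroup Γ] [ContinuousSMul Γ X] {u : HDeg R (Classifying Γ) D}
  (hu : IsHalvingPair D u)
include hu

lemma restrictsToBases : RestrictsToBases (singMap (borelProj Γ X)) (degreeComponent σ) :=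
  restrictsToBases_borelProj _ (fun a => by
    simpa only [IsHalvingPair.generatorPow_zero] using hu.exists_eq_smul a)
    hσ.scohomologyMap_degreeComponent

lemma lerayHirschMap_single_of (k q n : ℕ) (h : k * D + q = n) (x : HDeg R X q) :
    lerayHirschMap u σ (Finsupp.single k (of (HDeg R X) q x)) =
      of (HDeg R (Borel Γ X)) n (cup h (scohomologyMap R (singMap (borelProj Γ X)) (k * D)
        (generatorPow u (k * D))) (degreeComponent σ q x)) := by
  -- The cochain-level theorem has the base class on the left; the central power of u is moved there
  -- without a sign.
  rw [lerayHirschMap_single, ← ((hu.commute_eqGenerator _).pow_left k).eq, hσ.apply_of, eqGenerator,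
    ← map_pow, ← of_generatorPow hu.pos, fromClassifying, pullback_of, of_mul_of_eq_cup h]

/-- A translation from sums over exponents k to sums over bidegrees (a, b), with k = a / D.
Bidegrees with D ∤ a contribute nothing because `generatorPow` vanishes there. -/
lemma lerayHirschMap_apply (v : ℕ →₀ HRing R X) (n : ℕ) :
    lerayHirschMap u σ v n = ∑ i : Bidegree n, cup i.2 (scohomologyMap R (singMap (borelProj Γ X))
      i.1.1 (generatorPow u i.1.1)) (degreeComponent σ i.1.2 (v (i.1.1 / D) i.1.2)) := by
  let A : (ℕ →₀ HRing R X) →ₗ[R] HDeg R (Borel Γ X) n :=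
    DirectSum.component R ℕ _ n ∘ₗ lerayHirschMap u σ
  let B : (ℕ →₀ HRing R X) →ₗ[R] HDeg R (Borel Γ X) n :=
    ∑ i : Bidegree n, cup i.2 (scohomologyMap R (singMap (borelProj Γ X)) i.1.1
      (generatorPow u i.1.1)) ∘ₗ degreeComponent σ i.1.2 ∘ₗ DirectSum.component R ℕ _ i.1.2 ∘ₗ
        Finsupp.lapply (i.1.1 / D)
  have hB : ∀ v, B v = ∑ i : Bidegree n, cup i.2 (scohomologyMap R (singMap (borelProj Γ X))
      i.1.1 (generatorPow u i.1.1)) (degreeComponent σ i.1.2 (v (i.1.1 / D) i.1.2)) := by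
    intro v
    simp only [B, LinearMap.sum_apply]
    rfl
  suffices A = B from (LinearMap.congr_fun this v).trans (hB v)
  refine Finsupp.lhom_ext' fun k => DirectSum.linearMap_ext _ fun q => LinearMap.ext fun x => ?_
  change lerayHirschMap u σ (Finsupp.single k (of (HDeg R X) q x)) n =
    B (Finsupp.single k (of (HDeg R X) q x))
  rw [hB]
  have hne : ∀ i : Bidegree n, i.1 ≠ (k * D, q) →
      cup i.2 (scohomologyMap R (singMap (borelProj Γ X)) i.1.1 (generatorPow u i.1.1))
        (degreeComponent σ i.1.2 (Finsupp.single k (of (HDeg R X) q x) (i.1.1 / D) i.1.2)) = 0 := by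
    rintro ⟨⟨a, b⟩, hab⟩ hi
    by_cases ha : D ∣ a
    · obtain ⟨c, rfl⟩ := ha
      have h1 : (Finsupp.single k (of (HDeg R X) q x) (D * c / D)) b = 0 := by
        rw [Nat.mul_div_cancel_left _ hu.pos]
        by_cases hc : k = c
        · subst hc
          rw [Finsupp.single_eq_same]
          refine DirectSum.of_eq_of_ne _ _ _ fun h => hi ?_
          exact Prod.ext (mul_comm _ _) h
        · rw [Finsupp.single_eq_of_ne (Ne.symm hc)]
          rfl
      change cup _ _ (degreeComponent σ b ((Finsupp.single k (of (HDeg R X) q x) (D * c / D)) b)) = 0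
      rw [h1, map_zero, map_zero]
    · change cup _ (scohomologyMap R _ a (generatorPow u a)) _ = 0
      rw [generatorPow_eq_zero ha, map_zero, map_zero, LinearMap.zero_apply]
  by_cases hn : k * D + q = n
  · rw [Finset.sum_eq_single (⟨(k * D, q), hn⟩ : Bidegree n) (fun i _ hi => hne i fun h =>
      hi (Subtype.ext h)) (fun h => absurd (Finset.mem_univ _) h),
      hσ.lerayHirschMap_single_of hu k q n hn, DirectSum.of_eq_same]
    simp only [Nat.mul_div_cancel _ hu.pos, Finsupp.single_eq_same, DirectSum.of_eq_same]
  · rw [hσ.lerayHirschMap_single_of hu k q _ rfl, DirectSum.of_eq_of_ne _ _ _ (Ne.symm hn),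
      Finset.sum_eq_zero fun i _ => hne i fun h => hn ?_]
    have := i.2
    rwa [h] at this

/-- The components of degree `n` of `∑ₖ σ(vₖ) uᵏ` determine the components of degree `n - kD`
of `vₖ`. -/
theorem apply_eq_zero_of_lerayHirschMap_apply_eq_zero {v : ℕ →₀ HRing R X} {n : ℕ}
    (h : lerayHirschMap u σ v n = 0) (k q : ℕ) (hk : k * D + q = n) : v k q = 0 := by
  rw [hσ.lerayHirschMap_apply hu] at h
  have h1 := (hσ.restrictsToBases hu).eq_zero_of_sum_eq_zero (generatorPow u)
    (fun i => v (i.1.1 / D) i.1.2) h ⟨(k * D, q), hk⟩ (hu.generatorPow_ne_zero k)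
  simpa only [Nat.mul_div_cancel _ hu.pos] using h1

/-- The Leray-Hirsch theorem for the Borel construction. -/
theorem lerayHirschMap_bijective : Function.Bijective (lerayHirschMap u σ) := by
  constructor
  · rw [injective_iff_map_eq_zero]
    intro v hv
    refine Finsupp.ext fun k => DFinsupp.ext fun q => ?_
    exact hσ.apply_eq_zero_of_lerayHirschMap_apply_eq_zero hu (n := k * D + q) (by rw [hv]; rfl) k q rfl
  · rw [← LinearMap.range_eq_top, eq_top_iff]
    rintro y -
    induction y using DirectSum.induction_on with
    | zero => exact Submodule.zero_mem _
    | add x y hx hy => exact Submodule.add_mem _ hx hy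
    | of n y =>
      obtain ⟨v, rfl⟩ := (hσ.restrictsToBases hu).exists_eq_sum (generatorPow u)
        (fun l a => hu.exists_eq_smul a) y
      rw [map_sum]
      refine Submodule.sum_mem _ ?_
      rintro ⟨⟨a, b⟩, hab⟩ -
      by_cases ha : D ∣ a
      · obtain ⟨c, rfl⟩ : ∃ c, a = c * D := ⟨a / D, (Nat.div_mul_cancel ha).symm⟩
        exact ⟨_, hσ.lerayHirschMap_single_of hu c b n hab _⟩
      · change of _ n (cup _ (scohomologyMap R _ a (generatorPow u a)) _) ∈ _
        rw [generatorPow_eq_zero ha, map_zero, map_zero, LinearMap.zero_apply, map_zero]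
        exact Submodule.zero_mem _

end IsLerayHirschSection

end LerayHirschMap

end Halving

namespace Halving

open CategoryTheory DirectSum

/-! ### Equivariant cohomology of the fixed point set -/

section FixedPoints

variable {R : Type v} [Field R] {Γ : Type u} [Group Γ] [TopologicalSpace Γ] {D : ℕ}
  {X : Type u} [TopologicalSpace X] [MulAction Γ X]

instance : ContinuousSMul Γ (Fixed Γ X) where
  continuous_smul := continuous_snd.congr fun z => (Subtype.ext (z.2.2 z.1)).symm

/-- The projection B_ΓX^Γ → X^Γ is a left inverse of the fibre inclusion. Leray–Hirsch for this
section replaces the Künneth theorem for BΓ × X^Γ. -/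
lemma isLerayHirschSection_borelFixedProj :
    IsLerayHirschSection (pullback R (borelFixedProj Γ X)).toLinearMap where
  degree _ _ hx := pullback_mem_degreePart _ hx
  section_eq x := (pullback_comp _ _ x).trans (pullback_id x)

lemma restrictFixed_fromClassifying (b : HRing R (Classifying Γ)) :
    restrictFixed R Γ X (fromClassifying R Γ X b) = fromClassifying R Γ (Fixed Γ X) b := by
  rw [restrictFixed, fromClassifying, fromClassifying, pullback_comp]
  congr 2
  ext z
  induction z using Quotient.inductionOn'
  rfl

lemma restrictFixed_eqGenerator (u : HDeg R (Classifying Γ) D) :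
    restrictFixed R Γ X (eqGenerator X u) = eqGenerator (Fixed Γ X) u :=
  restrictFixed_fromClassifying _

lemma polyToEq_eq_lerayHirschMap (u : HDeg R (Classifying Γ) D)
    {p : Polynomial (HRing R (Fixed Γ X))} {v : ℕ →₀ HRing R (Fixed Γ X)}
    (h : ∀ k, p.coeff k = v k) :
    polyToEq X D u p = lerayHirschMap u (pullback R (borelFixedProj Γ X)).toLinearMap v := by
  have hs : v.support = p.support := by
    ext k
    rw [Finsupp.mem_support_iff, Polynomial.mem_support_iff, h]
  rw [polyToEq, Polynomial.eval₂_eq_sum, Polynomial.sum_def, lerayHirschMap, Finsupp.lsum_apply,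
    Finsupp.sum, hs]
  refine Finset.sum_congr rfl fun k _ => ?_
  rw [h]
  rfl

variable [IsTopologicalGroup Γ] {u : HDeg R (Classifying Γ) D} (hu : IsHalvingPair D u)
include hu

variable (X) in
/-- `polyToEq` as an algebra homomorphism. -/
noncomputable def polyToEqHom : Polynomial (HRing R (Fixed Γ X)) →ₐ[R] EqRing R Γ (Fixed Γ X) :=
  Polynomial.eval₂AlgHom (pullback R (borelFixedProj Γ X)) (eqGenerator (Fixed Γ X) u)
    fun _ => (hu.commute_eqGenerator _).symm

lemma polyToEqHom_apply (p : Polynomial (HRing R (Fixed Γ X))) :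
    polyToEqHom X hu p = polyToEq X D u p := rfl

/-- This makes the polynomial representing an equivariant class unique, so that degrees and
coefficients of r(σ(x)) are meaningful. -/
lemma polyToEqHom_bijective : Function.Bijective (polyToEqHom X hu) := by
  have h := isLerayHirschSection_borelFixedProj.lerayHirschMap_bijective (R := R) (X := Fixed Γ X) hu
  constructor
  · rw [injective_iff_map_eq_zero]
    intro p hp
    rw [polyToEqHom_apply, polyToEq_eq_lerayHirschMap u (v := Finsupp.onFinset p.support p.coeff
      fun k => Polynomial.mem_support_iff.2) fun k => rfl, ← map_zero (lerayHirschMap u _)] at hp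
    exact Polynomial.ext fun k => DFunLike.congr_fun (h.1 hp) k
  · intro y
    obtain ⟨v, rfl⟩ := h.2 y
    exact ⟨∑ k ∈ v.support, Polynomial.monomial k (v k),
      polyToEq_eq_lerayHirschMap u fun k => by
        simp [Polynomial.finsetSum_coeff, Polynomial.coeff_monomial]⟩

lemma coeff_mem_degreePart {p : Polynomial (HRing R (Fixed Γ X))} {n : ℕ}
    (hp : polyToEq X D u p ∈ degreePart R (Borel Γ (Fixed Γ X)) n) {k q : ℕ} (h : k * D + q = n) :
    p.coeff k ∈ degreePart R (Fixed Γ X) q := by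
  refine mem_degreePart_of_forall fun m hm => ?_
  rw [polyToEq_eq_lerayHirschMap u (v := Finsupp.onFinset p.support p.coeff
      fun k => Polynomial.mem_support_iff.2) fun k => rfl] at hp
  exact isLerayHirschSection_borelFixedProj.apply_eq_zero_of_lerayHirschMap_apply_eq_zero hu
    (apply_eq_zero_of_mem_degreePart (m := k * D + m) (by omega) hp) k m rfl

end FixedPoints

/-! ### The degree argument: multiplicativity of the section and of κ -/

section HalvingSection

variable {R : Type v} [Field R] {Γ : Type u} [Group Γ] [TopologicalSpace Γ] [IsTopologicalGroup Γ]
  {D : ℕ} {X : Type u} [TopologicalSpace X] [MulAction Γ X]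
  {u : HDeg R (Classifying Γ) D}

/-- The polynomial that represents `r(σ(x))`. -/
noncomputable def restrictionPoly (hu : IsHalvingPair D u) (σ : HRing R X →ₗ[R] EqRing R Γ X) :
    HRing R X →ₗ[R] Polynomial (HRing R (Fixed Γ X)) :=
  (AlgEquiv.ofBijective _ (polyToEqHom_bijective (X := X) hu)).symm.toLinearMap ∘ₗ
    (restrictFixed R Γ X).toLinearMap ∘ₗ σ

lemma polyToEqHom_restrictionPoly (hu : IsHalvingPair D u) (σ : HRing R X →ₗ[R] EqRing R Γ X)
    (x : HRing R X) :
    polyToEqHom X hu (restrictionPoly hu σ x) = restrictFixed R Γ X (σ x) :=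
  (AlgEquiv.ofBijective _ (polyToEqHom_bijective (X := X) hu)).apply_symm_apply _

lemma eq_restrictionPoly (hu : IsHalvingPair D u) (σ : HRing R X →ₗ[R] EqRing R Γ X)
    {x : HRing R X} {p : Polynomial (HRing R (Fixed Γ X))}
    (hp : polyToEq X D u p = restrictFixed R Γ X (σ x)) : p = restrictionPoly hu σ x :=
  (polyToEqHom_bijective hu).1 (hp.trans (polyToEqHom_restrictionPoly hu σ x).symm)

namespace IsHalvingSection

variable {σ : HRing R X →ₗ[R] EqRing R Γ X} (hσ : IsHalvingSection D u σ)
include hσ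

lemma induction_on {P : HRing R X → Prop} (x : HRing R X)
    (h : ∀ i, ∀ x ∈ degreePart R X (2 * D * i), P x) (hadd : ∀ x y, P x → P y → P (x + y)) : P x := by
  induction x using DirectSum.induction_on with
  | zero => exact h 0 _ (Submodule.zero_mem _)
  | add x y hx hy => exact hadd x y hx hy
  | of n x =>
    by_cases hn : 2 * D ∣ n
    · obtain ⟨i, rfl⟩ := hn
      exact h i _ ⟨x, rfl⟩
    · have := hσ.vanish n hn
      rw [Subsingleton.elim x 0, map_zero]
      exact h 0 _ (Submodule.zero_mem _)

variable (hu : IsHalvingPair D u)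
include hu

lemma degree_restrictionPoly {i : ℕ} {x : HRing R X} (hx : x ∈ degreePart R X (2 * D * i))
    (h : x ≠ 0) : (restrictionPoly hu σ x).degree = i := by
  obtain ⟨p, hp, hpi⟩ := hσ.degree_condition i x hx h
  rwa [← eq_restrictionPoly hu σ hp]

lemma natDegree_restrictionPoly_le {i : ℕ} {x : HRing R X} (hx : x ∈ degreePart R X (2 * D * i)) :
    (restrictionPoly hu σ x).natDegree ≤ i := by
  rcases eq_or_ne x 0 with rfl | h
  · simp
  · exact Polynomial.natDegree_le_of_degree_le (hσ.degree_restrictionPoly hu hx h).le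

lemma coeff_restrictionPoly_ne_zero {i : ℕ} {x : HRing R X} (hx : x ∈ degreePart R X (2 * D * i))
    (h : x ≠ 0) : (restrictionPoly hu σ x).coeff i ≠ 0 :=
  Polynomial.coeff_ne_zero_of_eq_degree (hσ.degree_restrictionPoly hu hx h)

/-- `κ(x)` is the leading coefficient of `r(σ(x))`. -/
lemma isLeadingCoeff_iff {κ : HRing R X →ₗ[R] HRing R (Fixed Γ X)} :
    IsLeadingCoeff D u σ κ ↔ ∀ i, ∀ x ∈ degreePart R X (2 * D * i),
      κ x = (restrictionPoly hu σ x).coeff i := by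
  refine forall₃_congr fun i x hx => ⟨?_, fun h => ⟨_, polyToEqHom_restrictionPoly hu σ x, h⟩⟩
  rintro ⟨p, hp, h⟩
  rwa [← eq_restrictionPoly hu σ hp]

theorem existsUnique_isLeadingCoeff :
    ∃! κ : HRing R X →ₗ[R] HRing R (Fixed Γ X), IsLeadingCoeff D u σ κ := by
  have hD := hu.pos
  -- In a degree n not divisible by 2D the rounded exponent is irrelevant, because H^n(X) = 0.
  let κ : HRing R X →ₗ[R] HRing R (Fixed Γ X) := DirectSum.toModule R ℕ _ fun n =>
    (Polynomial.lcoeff (HRing R (Fixed Γ X)) (n / (2 * D))).restrictScalars R ∘ₗ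
      restrictionPoly hu σ ∘ₗ DirectSum.lof R ℕ _ n
  refine ⟨κ, (hσ.isLeadingCoeff_iff hu).2 ?_, fun κ' hκ' => LinearMap.ext fun x => ?_⟩
  · rintro i _ ⟨x, rfl⟩
    simp only [κ, DirectSum.toModule_lof]
    change (restrictionPoly hu σ _).coeff _ = _
    rw [Nat.mul_div_cancel_left _ (by positivity)]
  · replace hκ' := (hσ.isLeadingCoeff_iff hu).1 hκ'
    refine hσ.induction_on (P := fun x => κ' x = κ x) x ?_ fun x y hx hy => by rw [map_add, map_add, hx, hy]
    rintro i _ ⟨x, rfl⟩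
    rw [hκ' i _ ⟨x, rfl⟩]
    simp only [κ, DirectSum.toModule_lof]
    change _ = (restrictionPoly hu σ _).coeff _
    rw [Nat.mul_div_cancel_left _ (by positivity)]

variable [ContinuousSMul Γ X]

/-- In the expansion of 1, all v_k with k > 0 vanish for degree reasons, and ρ identifies v_0 with
1. -/
lemma map_one : σ 1 = 1 := by
  obtain ⟨v, hv⟩ := (hσ.lerayHirschMap_bijective hu).2 1
  have h1 : v = Finsupp.single 0 (v 0) := by
    refine Finsupp.ext fun k => ?_
    rcases eq_or_ne k 0 with rfl | hk
    · rw [Finsupp.single_eq_same]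
    · rw [Finsupp.single_eq_of_ne hk]
      refine DFinsupp.ext fun q => ?_
      refine hσ.apply_eq_zero_of_lerayHirschMap_apply_eq_zero hu (n := k * D + q) ?_ k q rfl
      rw [hv]
      have := hu.pos
      refine apply_eq_zero_of_mem_degreePart (n := 0) ?_ one_mem_degreePart
      positivity
  rw [h1, lerayHirschMap_single, pow_zero, mul_one] at hv
  have h2 := hσ.section_eq (v 0)
  rw [hv, _root_.map_one] at h2
  rw [h2, hv]

/-- The coefficients of an equivariant class of degree `2Dm` are zero, or of degree `2Ds` and
belong to a power of the generator of even exponent `2(m-s)`. -/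
lemma exists_mem_degreePart {v : ℕ →₀ HRing R X} {m : ℕ}
    (hv : lerayHirschMap u σ v ∈ degreePart R (Borel Γ X) (2 * D * m)) {k : ℕ} (hk : v k ≠ 0) :
    ∃ s, v k ∈ degreePart R X (2 * D * s) ∧ k + 2 * s = 2 * m := by
  have h1 : ∀ q, v k q ≠ 0 → k * D + q = 2 * D * m := fun q hq => by
    by_contra h
    exact hq (hσ.apply_eq_zero_of_lerayHirschMap_apply_eq_zero hu
      (apply_eq_zero_of_mem_degreePart h hv) k q rfl)
  obtain ⟨q, hq⟩ : ∃ q, v k q ≠ 0 := by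
    by_contra! h
    exact hk (DFinsupp.ext h)
  have h2 : 2 * D ∣ q := by
    by_contra h
    have := hσ.vanish q h
    exact hq (Subsingleton.elim _ _)
  obtain ⟨s, rfl⟩ := h2
  refine ⟨s, mem_degreePart_of_forall fun n hn => ?_, ?_⟩
  · by_contra h
    have h3 := h1 n h
    have h4 := h1 _ hq
    omega
  · refine Nat.eq_of_mul_eq_mul_left hu.pos ?_
    linarith [h1 _ hq]

/-- In the expansion ∑ σ(v_k) u^k of σ(x)σ(y), a term with k > 0 would have too high a degree in u
after restriction to X^Γ. -/
lemma map_mul_of_mem {i j : ℕ} {x y : HRing R X} (hx : x ∈ degreePart R X (2 * D * i))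
    (hy : y ∈ degreePart R X (2 * D * j)) : σ (x * y) = σ x * σ y := by
  obtain ⟨v, hv⟩ := (hσ.lerayHirschMap_bijective hu).2 (σ x * σ y)
  have hdeg : lerayHirschMap u σ v ∈ degreePart R (Borel Γ X) (2 * D * (i + j)) := by
    rw [hv]
    exact mul_mem_degreePart (by ring) (hσ.degree _ x hx) (hσ.degree _ y hy)
  have hpoly : restrictionPoly hu σ x * restrictionPoly hu σ y =
      ∑ k ∈ v.support, restrictionPoly hu σ (v k) * Polynomial.X ^ k := by
    apply (polyToEqHom_bijective hu).1
    rw [map_mul, polyToEqHom_restrictionPoly, polyToEqHom_restrictionPoly, ← map_mul, ← hv, map_sum,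
      lerayHirschMap, Finsupp.lsum_apply, Finsupp.sum, map_sum]
    refine Finset.sum_congr rfl fun k _ => ?_
    rw [map_mul, polyToEqHom_restrictionPoly, map_pow]
    change restrictFixed R Γ X (σ (v k) * eqGenerator X u ^ k) = _
    rw [map_mul, map_pow, restrictFixed_eqGenerator]
    congr 2
    exact (Polynomial.eval₂_X _ _).symm
  have hsupp : ∀ k ∈ v.support, k = 0 := by
    by_contra! h
    obtain ⟨k₀, hk₀, hk₀'⟩ := h
    set k := v.support.max' ⟨k₀, hk₀⟩ with hk
    have hkv : v k ≠ 0 := Finsupp.mem_support_iff.1 (v.support.max'_mem _)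
    have hkpos : k₀ ≤ k := v.support.le_max' _ hk₀
    obtain ⟨s, hs, hks⟩ := hσ.exists_mem_degreePart hu hdeg hkv
    -- Coefficients of u^(s+k) for the largest k, where s + k = i + j + k/2. The left side has
    -- degree at most i + j, and the terms with l < k have degree at most i + j + l/2, so only the
    -- nonzero leading coefficient of v_k contributes.
    have h1 := congrArg (fun p => Polynomial.coeff p (s + k)) hpoly
    simp only [Polynomial.finsetSum_coeff] at h1
    rw [Finset.sum_eq_single k, Polynomial.coeff_mul_X_pow, Polynomial.coeff_eq_zero_of_natDegree_lt] at h1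
    · exact hσ.coeff_restrictionPoly_ne_zero hu hs hkv h1.symm
    · refine lt_of_le_of_lt (Polynomial.natDegree_mul_le.trans (add_le_add
        (hσ.natDegree_restrictionPoly_le hu hx) (hσ.natDegree_restrictionPoly_le hu hy))) ?_
      omega
    · intro l hl hlk
      have hlk' : l ≤ k := v.support.le_max' _ hl
      obtain ⟨t, ht, hlt⟩ := hσ.exists_mem_degreePart hu hdeg (Finsupp.mem_support_iff.1 hl)
      rw [show s + k = (s + k - l) + l by omega, Polynomial.coeff_mul_X_pow]
      refine Polynomial.coeff_eq_zero_of_natDegree_lt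
        (lt_of_le_of_lt (hσ.natDegree_restrictionPoly_le hu ht) ?_)
      omega
    · exact fun h => absurd (Finsupp.mem_support_iff.2 hkv) h
  have hv0 : v = Finsupp.single 0 (v 0) := by
    refine Finsupp.ext fun k => ?_
    rcases eq_or_ne k 0 with rfl | hk
    · rw [Finsupp.single_eq_same]
    · rw [Finsupp.single_eq_of_ne hk]
      by_contra h
      exact hk (hsupp k (Finsupp.mem_support_iff.2 h))
  rw [hv0, lerayHirschMap_single, pow_zero, mul_one] at hv
  -- Now σ(x)σ(y) = σ(v_0), and the ring homomorphism ρ gives v_0 = xy.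
  have h2 := hσ.section_eq (v 0)
  rw [hv, map_mul, hσ.section_eq, hσ.section_eq] at h2
  rw [h2, hv]

lemma map_mul (x y : HRing R X) : σ (x * y) = σ x * σ y := by
  refine hσ.induction_on (P := fun x => σ (x * y) = σ x * σ y) x (fun i x hx => ?_) fun a b ha hb => by
    rw [add_mul, map_add, map_add, add_mul, ha, hb]
  refine hσ.induction_on (P := fun y => σ (x * y) = σ x * σ y) y (fun j y hy => hσ.map_mul_of_mem hu hx hy) fun a b ha hb => by
    rw [mul_add, map_add, map_add, mul_add, ha, hb]

lemma restrictionPoly_mul (x y : HRing R X) :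
    restrictionPoly hu σ (x * y) = restrictionPoly hu σ x * restrictionPoly hu σ y := by
  refine (eq_restrictionPoly hu σ ?_).symm
  rw [← polyToEqHom_apply hu, _root_.map_mul, polyToEqHom_restrictionPoly,
    polyToEqHom_restrictionPoly, ← _root_.map_mul, hσ.map_mul hu]

lemma restrictionPoly_one : restrictionPoly hu σ 1 = 1 := by
  refine (eq_restrictionPoly hu σ ?_).symm
  rw [← polyToEqHom_apply hu, _root_.map_one, hσ.map_one hu, _root_.map_one]

section LeadingCoeff

variable {κ : HRing R X →ₗ[R] HRing R (Fixed Γ X)} (hκ : IsLeadingCoeff D u σ κ)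
include hκ

-- The factor u^i takes away iD of the degree 2Di, which leaves Di for the coefficient.
omit [ContinuousSMul Γ X] in
lemma leadingCoeff_mem_degreePart {i : ℕ} {x : HRing R X} (hx : x ∈ degreePart R X (2 * D * i)) :
    κ x ∈ degreePart R (Fixed Γ X) (D * i) := by
  rw [(hσ.isLeadingCoeff_iff hu).1 hκ i x hx]
  refine coeff_mem_degreePart hu (n := 2 * D * i) ?_ (by ring)
  rw [← polyToEqHom_apply hu, polyToEqHom_restrictionPoly]
  exact pullback_mem_degreePart _ (hσ.degree _ x hx)

lemma leadingCoeff_one : κ 1 = 1 := by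
  rw [(hσ.isLeadingCoeff_iff hu).1 hκ 0 1 one_mem_degreePart, hσ.restrictionPoly_one hu,
    Polynomial.coeff_one_zero]

lemma leadingCoeff_mul (x y : HRing R X) : κ (x * y) = κ x * κ y := by
  refine hσ.induction_on (P := fun x => κ (x * y) = κ x * κ y) x (fun i x hx => ?_) fun a b ha hb => by
    rw [add_mul, map_add, map_add, add_mul, ha, hb]
  refine hσ.induction_on (P := fun y => κ (x * y) = κ x * κ y) y (fun j y hy => ?_) fun a b ha hb => by
    rw [mul_add, map_add, map_add, mul_add, ha, hb]
  have h := (hσ.isLeadingCoeff_iff hu).1 hκ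
  rw [h i x hx, h j y hy, h (i + j) (x * y) (mul_mem_degreePart (by ring) hx hy),
    hσ.restrictionPoly_mul hu]
  -- The factors have degrees at most i and j, so their top coefficients alone produce the
  -- coefficient of u^(i+j).
  exact Polynomial.coeff_mul_add_eq_of_natDegree_le (hσ.natDegree_restrictionPoly_le hu hx)
    (hσ.natDegree_restrictionPoly_le hu hy)

end LeadingCoeff

end IsHalvingSection

end HalvingSection

/-! ### The Leray–Hirsch isomorphism as an isomorphism of algebras -/

section Tensor

open TensorProduct

variable {R : Type v} [Field R] {Γ : Type u} [Group Γ] [TopologicalSpace Γ] [IsTopologicalGroup Γ]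
  {D : ℕ} {X : Type u} [TopologicalSpace X] [MulAction Γ X] {u : HDeg R (Classifying Γ) D}
  (hu : IsHalvingPair D u)
include hu

-- H^*(BΓ) is generated by the central element u, so the unsigned tensor product algebra is the
-- right source.
omit [IsTopologicalGroup Γ] in
lemma IsHalvingPair.commute_fromClassifying (y : EqRing R Γ X) (b : HRing R (Classifying Γ)) :
    Commute y (fromClassifying R Γ X b) := by
  obtain ⟨p, rfl⟩ := hu.bijective.2 b
  rw [← Polynomial.aeval_algHom_apply, Polynomial.aeval_def, Polynomial.eval₂_eq_sum,
    Polynomial.sum_def]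
  exact Commute.sum_right _ _ _ fun k _ =>
    (Algebra.commute_algebraMap_right _ _).mul_right ((hu.commute_eqGenerator y).symm.pow_right k)

/-- A multiplicative Leray-Hirsch section gives an isomorphism of algebras. -/
theorem exists_lerayHirsch_algEquiv [ContinuousSMul Γ X] (f : HRing R X →ₐ[R] EqRing R Γ X)
    (hf : IsLerayHirschSection f.toLinearMap) :
    ∃ L : HRing R X ⊗[R] HRing R (Classifying Γ) ≃ₐ[R] EqRing R Γ X,
      ∀ x b, L (x ⊗ₜ[R] b) = f x * fromClassifying R Γ X b := by
  classical
  let L : HRing R X ⊗[R] HRing R (Classifying Γ) →ₐ[R] EqRing R Γ X :=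
    Algebra.TensorProduct.lift f (fromClassifying R Γ X) fun x b => hu.commute_fromClassifying _ _
  have hL : ∀ x b, L (x ⊗ₜ[R] b) = f x * fromClassifying R Γ X b := fun x b =>
    Algebra.TensorProduct.lift_tmul _ _ _ x b
  let e : (ℕ →₀ R) ≃ₗ[R] HRing R (Classifying Γ) :=
    (Polynomial.basisMonomials R).repr.symm.trans
      (AlgEquiv.ofBijective _ hu.bijective).toLinearEquiv
  have he : ∀ k, e (Finsupp.single k 1) = of (HDeg R (Classifying Γ)) D u ^ k := fun k => by
    change Polynomial.aeval _ ((Polynomial.basisMonomials R).repr.symm (Finsupp.single k 1)) = _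
    simp
  -- The powers of u form a basis of H^*(BΓ); in these coordinates the algebra map becomes
  -- `lerayHirschMap`, which is bijective.
  let ψ : (ℕ →₀ HRing R X) ≃ₗ[R] HRing R X ⊗[R] HRing R (Classifying Γ) :=
    (finsuppScalarRight R R (HRing R X) ℕ).symm.trans (LinearEquiv.lTensor _ e)
  have hψ : L.toLinearMap ∘ₗ ψ.toLinearMap = lerayHirschMap u f.toLinearMap := by
    refine Finsupp.lhom_ext fun k x => ?_
    have h1 : ψ (Finsupp.single k x) = x ⊗ₜ (of (HDeg R (Classifying Γ)) D u ^ k) := by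
      simp only [ψ, LinearEquiv.trans_apply, finsuppScalarRight_symm_apply_single, ← he]
      rfl
    change L (ψ (Finsupp.single k x)) = _
    rw [h1, hL, lerayHirschMap_single, map_pow]
    rfl
  refine ⟨AlgEquiv.ofBijective L ?_, hL⟩
  have h2 : ⇑L ∘ ψ = lerayHirschMap u f.toLinearMap := congrArg DFunLike.coe hψ
  rw [← Function.Bijective.of_comp_iff _ ψ.bijective, h2]
  exact hf.lerayHirschMap_bijective hu

end Tensor

end Halving

open Halving
open scoped TensorProduct
theorem theorem2p4 {R : Type v} [Field R] {Γ : Type u} [Group Γ] [TopologicalSpace Γ]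
    [IsTopologicalGroup Γ] {X : Type u} [TopologicalSpace X] [MulAction Γ X] [ContinuousSMul Γ X]
    (D : ℕ) (u : HDeg R (Classifying Γ) D) (hu : IsHalvingPair D u)
    (σ : HRing R X →ₗ[R] EqRing R Γ X) (hσ : IsHalvingSection D u σ) :
    -- `κ` is well defined,
    (∃! κ : HRing R X →ₗ[R] HRing R (Fixed Γ X), IsLeadingCoeff D u σ κ) ∧
    -- it halves degrees and is a ring homomorphism,
    (∀ κ : HRing R X →ₗ[R] HRing R (Fixed Γ X), IsLeadingCoeff D u σ κ →
      (∀ i, ∀ x ∈ degreePart R X (2 * D * i), κ x ∈ degreePart R (Fixed Γ X) (D * i)) ∧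
      κ 1 = 1 ∧ ∀ a b, κ (a * b) = κ a * κ b) ∧
    -- `σ` is a ring homomorphism,
    (σ 1 = 1 ∧ ∀ a b, σ (a * b) = σ a * σ b) ∧
    -- and the Leray-Hirsch isomorphism is an isomorphism of algebras.
    ∃ L : HRing R X ⊗[R] HRing R (Classifying Γ) ≃ₐ[R] EqRing R Γ X,
      ∀ x b, L (x ⊗ₜ[R] b) = σ x * fromClassifying R Γ X b :=
  ⟨hσ.existsUnique_isLeadingCoeff hu,
    fun _ hκ => ⟨fun _ _ hx => hσ.leadingCoeff_mem_degreePart hu hκ hx,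
      hσ.leadingCoeff_one hu hκ, hσ.leadingCoeff_mul hu hκ⟩,
    ⟨hσ.map_one hu, hσ.map_mul hu⟩,
    exists_lerayHirsch_algEquiv hu (AlgHom.ofLinearMap σ (hσ.map_one hu) (hσ.map_mul hu))
      hσ.toIsLerayHirschSection⟩
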